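/- Let $M$ be a complete, connected, finite-dimensional $\mathcal C^\infty$ Riemannian manifold without boundary, with Levi-Civita connection $\nabla$ and curvature tensor $R(U,V)W=\nabla_U\nabla_VW-\nabla_V\nabla_UW-\nabla_{[U,V]}W$, and assume that $\sup_{x\in M}\|R(x)\|<\infty$. Let $f:M\to\mathbb R$ be a $\mathcal C^1$-function whose Riemannian gradient $V=\mathrm{grad}\,f$ belongs to $\mathfrak X^2_b(M)$, i.e. $V$ is a $\mathcal C^2$ vector field such that $\|V(x)\|$, $\|\nabla V(x)\|$ and $\|\nabla^2V(x)\|$ are bounded over $x\in M$. Let $\operatorname{retr}:TM\to M$ be a uniform first order retraction: $\operatorname{retr}$ is $\mathcal C^2$, for every $x\in M$ the restriction $\operatorname{retr}_x:T_xM\to M$ satisfies $\operatorname{retr}_x(0)=x$ and $D_0\operatorname{retr}_x=\mathrm{id}_{T_xM}$, and there is a constant $C'\ge0$ such that for all $x\in M$, $t\ge 0$ and $v\in T_xM$ with $\|v\|=1$ the curve $\gamma_s=\operatorname{retr}_x(sv)$ satisfies $\|\dot\gamma_t\|\vee\bigl\|\frac{\nabla}{dt}\dot\gamma_t\bigr\|\le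 C'$. Let $(\Xi,\mathcal G,\vartheta)$ be a probability space and let $\tilde f:M\times\Xi\to TM$ be a measurable map with $\tilde f(x,\xi)\in T_xM$ such that $$\mathbb E_\vartheta[\tilde f(x,\xi)]=\mathrm{grad}\,f(x)\ \text{ for all } x\in M \qquad\text{and}\qquad \sup_{y\in M}\mathbb E_\vartheta[\|\tilde f(y,\xi)\|^2]<\infty .$$ Let $(\xi_n)_{n\in\mathbb N}$ be an i.i.d. sequence of $\vartheta$-distributed random variables on a probability space $(\Omega,\mathcal F,\mathbb P)$. For $\eta>0$ and $x\in M$ let $(Z^\eta_n(x))_{n\ge0}$ be the Riemannian stochastic gradient descent (RSGD) scheme $$Z_0^\eta(x)=x,\qquad Z_n^\eta(x)=\operatorname{retr}_{Z_{n-1}^\eta(x)}\bigl(-\eta\,\tilde f(Z_{n-1}^\eta(x),\xi_n)\bigr),\quad n\ge1.$$ Then for every $x\in M$ the Riemannian gradient flow $\dot x_t(x)=-\mathrm{grad}\,f(x_t(x))$, $x_0(x)=x$, has a solution $(x_t(x))_{t\ge0}$ defined for all $t\ge0$, and for any such solutions the following holds. For all $T\ge0$ and every $g\in\mathcal C^2_b(M)$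 (i.e. $g:M\to\mathbb R$ is $\mathcal C^2$ and $|g|$, $\|\mathrm{grad}\,g\|$ and $\|\mathrm{Hess}\,g\|$ are bounded on $M$) there exists a constant $C\ge0$ such that for all $\eta>0$ $$\sup_{x\in M}\ \max_{n=0,\dots,\lfloor T/\eta\rfloor}\bigl|\mathbb E[g(Z_n^\eta(x))]-g(x_{n\eta}(x))\bigr|\le C\,\eta .$$ -/

import Mathlib

open Bundle Manifold MeasureTheory ProbabilityTheory
open scoped ContDiff Topology

noncomputable section

namespace RSGD

/-! ## The Levi-Civita connection

`M` is a smooth manifold without boundary modelled on a finite-dimensional space `E`, and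
`⟪·,·⟫` is a smooth Riemannian metric on it. -/

section Geometry

variable {E : Type*} [NormedAddCommGroup E] [NormedSpace ℝ E]
  {M : Type*} [TopologicalSpace M] [ChartedSpace E M]

theorem mvfderiv_congr {x : M} {φ ψ : M → E} (h : φ =ᶠ[𝓝 x] ψ) :
    mvfderiv 𝓘(ℝ, E) φ x = mvfderiv 𝓘(ℝ, E) ψ x := by
  unfold mvfderiv
  rw [h.mfderiv_eq, h.eq_of_nhds]

variable [IsManifold 𝓘(ℝ, E) ∞ M]

instance instFiniteDimensionalTangentSpace [FiniteDimensional ℝ E] (x : M) :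
    FiniteDimensional ℝ (TangentSpace 𝓘(ℝ, E) x) :=
  inferInstanceAs (FiniteDimensional ℝ E)

/-- The vector field with constant components in the preferred chart at `x`, with value `v`
at `x` (and zero outside the domain of that chart). -/
def chartExtend (x : M) (v : TangentSpace 𝓘(ℝ, E) x) (y : M) : TangentSpace 𝓘(ℝ, E) y :=
  (trivializationAt E (TangentSpace 𝓘(ℝ, E)) x).symmL ℝ y
    ((trivializationAt E (TangentSpace 𝓘(ℝ, E)) x).continuousLinearMapAt ℝ x v)

theorem chartExtend_add (x : M) (v w : TangentSpace 𝓘(ℝ, E) x) :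
    chartExtend x (v + w) = chartExtend x v + chartExtend x w := by
  ext y; simp only [chartExtend, map_add, Pi.add_apply]

theorem chartExtend_smul (x : M) (c : ℝ) (v : TangentSpace 𝓘(ℝ, E) x) :
    chartExtend x (c • v) = c • chartExtend x v := by
  ext y; simp only [chartExtend, map_smul, Pi.smul_apply]

theorem chartExtend_self (x : M) (v : TangentSpace 𝓘(ℝ, E) x) : chartExtend x v x = v :=
  Trivialization.symmL_continuousLinearMapAt _ (FiberBundle.mem_baseSet_trivializationAt' x) v

theorem chartExtend_coord (x : M) (v : TangentSpace 𝓘(ℝ, E) x) :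
    (fun y ↦ (trivializationAt E (TangentSpace 𝓘(ℝ, E)) x ⟨y, chartExtend x v y⟩).2) =ᶠ[𝓝 x]
      fun _ ↦ (trivializationAt E (TangentSpace 𝓘(ℝ, E)) x).continuousLinearMapAt ℝ x v := by
  have h := (trivializationAt E (TangentSpace 𝓘(ℝ, E)) x).open_baseSet.mem_nhds
    (FiberBundle.mem_baseSet_trivializationAt' x)
  filter_upwards [h] with y hy
  have := (trivializationAt E (TangentSpace 𝓘(ℝ, E)) x).continuousLinearMapAt_symmL (R := ℝ) hy
    ((trivializationAt E (TangentSpace 𝓘(ℝ, E)) x).continuousLinearMapAt ℝ x v)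
  rw [Trivialization.continuousLinearMapAt_apply,
    Trivialization.coe_linearMapAt_of_mem _ hy] at this
  exact this

theorem contMDiffAt_chartExtend (x : M) (v : TangentSpace 𝓘(ℝ, E) x) :
    ContMDiffAt 𝓘(ℝ, E) 𝓘(ℝ, E).tangent ∞
      (fun y ↦ (⟨y, chartExtend x v y⟩ : TangentBundle 𝓘(ℝ, E) M)) x := by
  rw [contMDiffAt_section]
  exact contMDiffAt_const.congr_of_eventuallyEq (chartExtend_coord x v)

theorem mdifferentiableAt_chartExtend (x : M) (v : TangentSpace 𝓘(ℝ, E) x) :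
    MDifferentiableAt 𝓘(ℝ, E) 𝓘(ℝ, E).tangent
      (fun y ↦ (⟨y, chartExtend x v y⟩ : TangentBundle 𝓘(ℝ, E) M)) x :=
  (contMDiffAt_chartExtend x v).mdifferentiableAt (by simp)

/-- The components of a vector field in the chart at `x`. -/
def coords (x : M) (σ : ∀ y : M, TangentSpace 𝓘(ℝ, E) y) (y : M) : E :=
  (trivializationAt E (TangentSpace 𝓘(ℝ, E)) x ⟨y, σ y⟩).2

theorem coords_add (x : M) (σ σ' : ∀ y : M, TangentSpace 𝓘(ℝ, E) y) :
    coords x (σ + σ') =ᶠ[𝓝 x] coords x σ + coords x σ' := by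
  filter_upwards [(trivializationAt E (TangentSpace 𝓘(ℝ, E)) x).open_baseSet.mem_nhds
    (FiberBundle.mem_baseSet_trivializationAt' x)] with y hy
  exact ((trivializationAt E (TangentSpace 𝓘(ℝ, E)) x).linear ℝ hy).map_add _ _

theorem coords_smul (x : M) (g : M → ℝ) (σ : ∀ y : M, TangentSpace 𝓘(ℝ, E) y) :
    coords x (g • σ) =ᶠ[𝓝 x] g • coords x σ := by
  filter_upwards [(trivializationAt E (TangentSpace 𝓘(ℝ, E)) x).open_baseSet.mem_nhds
    (FiberBundle.mem_baseSet_trivializationAt' x)] with y hy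
  exact ((trivializationAt E (TangentSpace 𝓘(ℝ, E)) x).linear ℝ hy).map_smul _ _

theorem symmL_coords (x : M) (σ : ∀ y : M, TangentSpace 𝓘(ℝ, E) y) :
    (trivializationAt E (TangentSpace 𝓘(ℝ, E)) x).symmL ℝ x (coords x σ x) = σ x := by
  have hx := FiberBundle.mem_baseSet_trivializationAt' (F := E)
    (E := (TangentSpace 𝓘(ℝ, E) : M → Type _)) x
  have := (trivializationAt E (TangentSpace 𝓘(ℝ, E)) x).symmL_continuousLinearMapAt (R := ℝ) hx (σ x)
  rwa [Trivialization.continuousLinearMapAt_apply, Trivialization.coe_linearMapAt_of_mem _ hx]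
    at this

theorem mdifferentiableAt_coords {x : M} {σ : ∀ y : M, TangentSpace 𝓘(ℝ, E) y}
    (hσ : MDifferentiableAt 𝓘(ℝ, E) 𝓘(ℝ, E).tangent
      (fun y ↦ (⟨y, σ y⟩ : TangentBundle 𝓘(ℝ, E) M)) x) :
    MDifferentiableAt 𝓘(ℝ, E) 𝓘(ℝ, E) (coords x σ) x :=
  (mdifferentiableAt_section _ _).1 hσ

theorem mlieBracket_chartExtend (x : M) (v w : TangentSpace 𝓘(ℝ, E) x) :
    VectorField.mlieBracket 𝓘(ℝ, E) (chartExtend x v) (chartExtend x w) x = 0 := by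
  have key (v : TangentSpace 𝓘(ℝ, E) x) :
      VectorField.mpullbackWithin 𝓘(ℝ, E) 𝓘(ℝ, E) (extChartAt 𝓘(ℝ, E) x).symm
        (chartExtend x v) (Set.range 𝓘(ℝ, E)) =ᶠ[𝓝 (extChartAt 𝓘(ℝ, E) x x)]
      fun _ ↦ (trivializationAt E (TangentSpace 𝓘(ℝ, E)) x).continuousLinearMapAt ℝ x v := by
    filter_upwards [extChartAt_target_mem_nhds (I := 𝓘(ℝ, E)) x] with y hy
    have hy' : (extChartAt 𝓘(ℝ, E) x).symm y ∈ (chartAt E x).source := by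
      simpa using (extChartAt 𝓘(ℝ, E) x).map_target hy
    rw [VectorField.mpullbackWithin_apply, chartExtend,
      TangentBundle.symmL_trivializationAt hy', (extChartAt 𝓘(ℝ, E) x).right_inv hy]
    exact ContinuousLinearMap.IsInvertible.inverse_apply_eq
      (isInvertible_mfderivWithin_extChartAt_symm (I := 𝓘(ℝ, E)) hy) |>.2 rfl
  have h0 := Filter.EventuallyEq.lieBracketWithin_vectorField_eq_of_mem (𝕜 := ℝ) (s := Set.univ)
    ((key v).filter_mono nhdsWithin_le_nhds) ((key w).filter_mono nhdsWithin_le_nhds)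
    (Set.mem_univ _)
  rw [← VectorField.mlieBracketWithin_univ, VectorField.mlieBracketWithin_apply]
  have hs : (extChartAt 𝓘(ℝ, E) x).symm ⁻¹' Set.univ ∩ Set.range 𝓘(ℝ, E) = Set.univ := by simp
  rw [hs, h0]
  simp only [VectorField.lieBracketWithin_univ, VectorField.lieBracket_eq, fderiv_fun_const,
    Pi.zero_apply, zero_apply, sub_self]
  exact map_zero _

variable [RiemannianBundle (fun x : M ↦ TangentSpace 𝓘(ℝ, E) x)]

instance instCompleteSpaceTangentSpace [FiniteDimensional ℝ E] (x : M) :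
    CompleteSpace (TangentSpace 𝓘(ℝ, E) x) :=
  FiniteDimensional.complete ℝ _

/-- The derivative at `x`, in the direction `u`, of the metric coefficient `⟪v, w⟫`, where `v` and
`w` are extended to a neighbourhood of `x` with constant components in the chart at `x`. -/
def metricDeriv (x : M) (v w u : TangentSpace 𝓘(ℝ, E) x) : ℝ :=
  mvfderiv 𝓘(ℝ, E) (fun y ↦ inner ℝ (chartExtend x v y) (chartExtend x w y)) x u

theorem metricDeriv_symm (x : M) (v w u : TangentSpace 𝓘(ℝ, E) x) :
    metricDeriv x v w u = metricDeriv x w v u := by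
  simp only [metricDeriv, real_inner_comm]

variable [IsContMDiffRiemannianBundle 𝓘(ℝ, E) ∞ E (fun x : M ↦ TangentSpace 𝓘(ℝ, E) x)]

theorem mdifferentiableAt_inner_chartExtend (x : M) (v w : TangentSpace 𝓘(ℝ, E) x) :
    MDifferentiableAt 𝓘(ℝ, E) 𝓘(ℝ, ℝ)
      (fun y ↦ inner ℝ (chartExtend x v y) (chartExtend x w y)) x :=
  MDifferentiableAt.inner_bundle (F := E) (E := fun y : M ↦ TangentSpace 𝓘(ℝ, E) y)
    (b := fun y ↦ y) (IB := 𝓘(ℝ, E)) (mdifferentiableAt_chartExtend x v)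
    (mdifferentiableAt_chartExtend x w)

theorem metricDeriv_add_left (x : M) (v v' w u : TangentSpace 𝓘(ℝ, E) x) :
    metricDeriv x (v + v') w u = metricDeriv x v w u + metricDeriv x v' w u := by
  simp only [metricDeriv, chartExtend_add, Pi.add_apply, inner_add_left]
  rw [mvfderiv_fun_add (mdifferentiableAt_inner_chartExtend x v w)
    (mdifferentiableAt_inner_chartExtend x v' w)]
  rfl

theorem metricDeriv_smul_left (x : M) (c : ℝ) (v w u : TangentSpace 𝓘(ℝ, E) x) :
    metricDeriv x (c • v) w u = c * metricDeriv x v w u := by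
  simp only [metricDeriv, chartExtend_smul, Pi.smul_apply, real_inner_smul_left]
  rw [mvfderiv_fun_mul mdifferentiableAt_const (mdifferentiableAt_inner_chartExtend x v w),
    mvfderiv_const]
  simp

theorem metricDeriv_add_right (x : M) (v w w' u : TangentSpace 𝓘(ℝ, E) x) :
    metricDeriv x v (w + w') u = metricDeriv x v w u + metricDeriv x v w' u := by
  rw [metricDeriv_symm, metricDeriv_add_left, metricDeriv_symm x w, metricDeriv_symm x w']

theorem metricDeriv_smul_right (x : M) (c : ℝ) (v w u : TangentSpace 𝓘(ℝ, E) x) :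
    metricDeriv x v (c • w) u = c * metricDeriv x v w u := by
  rw [metricDeriv_symm, metricDeriv_smul_left, metricDeriv_symm]

/-- The Christoffel symbols of the first kind at `x`, in the chart at `x`:
`w ↦ (∂_u ⟪v, w⟫ + ∂_v ⟪u, w⟫ - ∂_w ⟪u, v⟫) / 2`. -/
def christoffelForm (x : M) (u v : TangentSpace 𝓘(ℝ, E) x) : TangentSpace 𝓘(ℝ, E) x →ₗ[ℝ] ℝ where
  toFun w := (metricDeriv x v w u + metricDeriv x u w v - metricDeriv x u v w) / 2
  map_add' w w' := by
    simp only [metricDeriv_add_right]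
    simp only [metricDeriv, map_add]
    ring
  map_smul' c w := by
    simp only [metricDeriv_smul_right]
    simp only [metricDeriv, map_smul, smul_eq_mul, RingHom.id_apply]
    ring

variable [FiniteDimensional ℝ E]

/-- The Christoffel symbols (of the second kind) at `x` in the chart at `x`, as a bilinear map:
`⟪Γ(u, v), w⟫ = (∂_u ⟪v, w⟫ + ∂_v ⟪u, w⟫ - ∂_w ⟪u, v⟫) / 2`. -/
def christoffel (x : M) :
    TangentSpace 𝓘(ℝ, E) x →L[ℝ] TangentSpace 𝓘(ℝ, E) x →L[ℝ] TangentSpace 𝓘(ℝ, E) x :=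
  (LinearMap.mk₂ ℝ
    (fun u v ↦ (InnerProductSpace.toDual ℝ (TangentSpace 𝓘(ℝ, E) x)).symm
      (LinearMap.toContinuousLinearMap (christoffelForm x u v)))
    (fun u u' v ↦ by
      rw [← map_add, ← map_add]
      congr 2
      ext w
      simp only [christoffelForm, LinearMap.coe_mk, AddHom.coe_mk, LinearMap.add_apply,
        metricDeriv_add_left]
      simp only [metricDeriv, map_add]
      ring)
    (fun c u v ↦ by
      rw [← map_smul, ← map_smul]
      congr 2
      ext w
      simp only [christoffelForm, LinearMap.coe_mk, AddHom.coe_mk, LinearMap.smul_apply,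
        metricDeriv_smul_left]
      simp only [metricDeriv, map_smul, smul_eq_mul]
      ring)
    (fun u v v' ↦ by
      rw [← map_add, ← map_add]
      congr 2
      ext w
      simp only [christoffelForm, LinearMap.coe_mk, AddHom.coe_mk, LinearMap.add_apply,
        metricDeriv_add_left, metricDeriv_add_right]
      simp only [metricDeriv, map_add]
      ring)
    (fun c u v ↦ by
      rw [← map_smul, ← map_smul]
      congr 2
      ext w
      simp only [christoffelForm, LinearMap.coe_mk, AddHom.coe_mk, LinearMap.smul_apply,
        metricDeriv_smul_left, metricDeriv_smul_right]
      simp only [metricDeriv, map_smul, smul_eq_mul]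
      ring)).toContinuousBilinearMap

theorem inner_christoffel (x : M) (u v w : TangentSpace 𝓘(ℝ, E) x) :
    inner ℝ (christoffel x u v) w =
      (metricDeriv x v w u + metricDeriv x u w v - metricDeriv x u v w) / 2 := by
  rw [christoffel, LinearMap.toContinuousBilinearMap_apply, LinearMap.mk₂_apply,
    InnerProductSpace.toDual_symm_apply]
  rfl

theorem christoffel_symm (x : M) (u v : TangentSpace 𝓘(ℝ, E) x) :
    christoffel x u v = christoffel x v u := by
  refine ext_inner_right ℝ fun w ↦ ?_
  rw [inner_christoffel, inner_christoffel, metricDeriv_symm x u v w]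
  ring

/-- The Levi-Civita connection of the Riemannian manifold `M`: `leviCivita σ x u` is `∇_u σ`,
computed in the chart at `x` as `∂_u σ + Γ(σ x, u)`. -/
def leviCivita : CovariantDerivative 𝓘(ℝ, E) E (fun x : M ↦ TangentSpace 𝓘(ℝ, E) x) where
  toFun σ x :=
    (trivializationAt E (TangentSpace 𝓘(ℝ, E)) x).symmL ℝ x ∘L
      mvfderiv 𝓘(ℝ, E) (coords x σ) x + christoffel x (σ x)
  isCovariantDerivativeOnUniv := by
    constructor
    · intro σ σ' x hσ hσ' _
      have h : coords x (σ + σ') =ᶠ[𝓝 x] coords x σ + coords x σ' := coords_add x σ σ'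
      rw [mvfderiv_congr h, mvfderiv_add (mdifferentiableAt_coords hσ)
        (mdifferentiableAt_coords hσ'), Pi.add_apply, map_add, ContinuousLinearMap.comp_add]
      abel
    · intro σ g x hσ hg _
      have h : coords x (g • σ) =ᶠ[𝓝 x] g • coords x σ := coords_smul x g σ
      rw [mvfderiv_congr h, mvfderiv_smul hg (mdifferentiableAt_coords hσ)]
      ext u
      simp only [ContinuousLinearMap.comp_apply, _root_.add_apply,
        _root_.smul_apply, ContinuousLinearMap.smulRight_apply, map_add, map_smul,
        Pi.smul_apply', smul_add]
      rw [symmL_coords]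
      abel

theorem leviCivita_apply (σ : ∀ y : M, TangentSpace 𝓘(ℝ, E) y) (x : M)
    (u : TangentSpace 𝓘(ℝ, E) x) :
    leviCivita σ x u = (trivializationAt E (TangentSpace 𝓘(ℝ, E)) x).symmL ℝ x
      (mvfderiv 𝓘(ℝ, E) (coords x σ) x u) + christoffel x (σ x) u :=
  rfl

theorem leviCivita_chartExtend (x : M) (v u : TangentSpace 𝓘(ℝ, E) x) :
    leviCivita (chartExtend x v) x u = christoffel x v u := by
  have h : coords x (chartExtend x v) =ᶠ[𝓝 x] _ := chartExtend_coord x v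
  rw [leviCivita_apply, mvfderiv_congr h, mvfderiv_const, chartExtend_self]
  simp

/-- The Levi-Civita connection is compatible with the metric. -/
theorem leviCivita_isMetricCompatible :
    CovariantDerivative.IsMetricCompatible (I := 𝓘(ℝ, E)) (F := E)
      (V := fun x : M ↦ TangentSpace 𝓘(ℝ, E) x) leviCivita := by
  funext x
  ext v w u
  have h := CovariantDerivative.derivMetricTensor_apply (I := 𝓘(ℝ, E)) (F := E)
    (V := fun x : M ↦ TangentSpace 𝓘(ℝ, E) x) leviCivita
    (X := chartExtend x u) x (mdifferentiableAt_chartExtend x v) (mdifferentiableAt_chartExtend x w)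
  simp only [chartExtend_self, leviCivita_chartExtend] at h
  rw [h, inner_christoffel, real_inner_comm, inner_christoffel]
  change metricDeriv x v w u - _ - _ = 0
  rw [metricDeriv_symm x u w, metricDeriv_symm x w v, metricDeriv_symm x v u]
  ring

/-- The Levi-Civita connection is torsion-free. -/
theorem leviCivita_torsion_eq_zero :
    (leviCivita : CovariantDerivative 𝓘(ℝ, E) E
      (fun x : M ↦ TangentSpace 𝓘(ℝ, E) x)).torsion = 0 := by
  funext x
  ext v w
  have h := CovariantDerivative.torsion_apply (leviCivita (E := E) (M := M))
    (mdifferentiableAt_chartExtend x v) (mdifferentiableAt_chartExtend x w)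
  simp only [chartExtend_self, leviCivita_chartExtend] at h
  rw [h, christoffel_symm, mlieBracket_chartExtend]
  simp

/-! ## Derivatives along curves, gradient, Hessian, curvature -/

/-- The velocity `γ'(t)` of a curve. -/
def velocity (γ : ℝ → M) (t : ℝ) : TangentSpace 𝓘(ℝ, E) (γ t) :=
  mfderiv 𝓘(ℝ, ℝ) 𝓘(ℝ, E) γ t (1 : ℝ)

/-- The covariant derivative `∇V/dt` at time `t` of a vector field `V` along the curve `γ`, computed
in the chart at `γ t` as `V' + Γ(γ', V)`. -/
def covDerivAlong (γ : ℝ → M) (V : ∀ t, TangentSpace 𝓘(ℝ, E) (γ t)) (t : ℝ) :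
    TangentSpace 𝓘(ℝ, E) (γ t) :=
  (trivializationAt E (TangentSpace 𝓘(ℝ, E)) (γ t)).symmL ℝ (γ t)
      (deriv (fun s ↦ (trivializationAt E (TangentSpace 𝓘(ℝ, E)) (γ t) ⟨γ s, V s⟩).2) t) +
    christoffel (γ t) (velocity γ t) (V t)

/-- For the restriction to `γ` of a vector field `σ` on `M`, `∇σ/dt` is `∇_{γ'} σ`. -/
theorem covDerivAlong_comp {γ : ℝ → M} {σ : ∀ y : M, TangentSpace 𝓘(ℝ, E) y} {t : ℝ}
    (hγ : MDifferentiableAt 𝓘(ℝ, ℝ) 𝓘(ℝ, E) γ t)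
    (hσ : MDifferentiableAt 𝓘(ℝ, E) 𝓘(ℝ, E).tangent
      (fun y ↦ (⟨y, σ y⟩ : TangentBundle 𝓘(ℝ, E) M)) (γ t)) :
    covDerivAlong γ (fun s ↦ σ (γ s)) t = leviCivita σ (γ t) (velocity γ t) := by
  have h : deriv (fun s ↦ coords (γ t) σ (γ s)) t
      = mvfderiv 𝓘(ℝ, E) (coords (γ t) σ) (γ t) (velocity γ t) := by
    have h1 := mfderiv_comp_apply t (mdifferentiableAt_coords hσ) hγ (1 : ℝ)
    rw [mfderiv_eq_fderiv] at h1
    exact fderiv_apply_one_eq_deriv.symm.trans h1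
  rw [leviCivita_apply, christoffel_symm, ← h]
  rfl

variable (E) in
/-- The Riemannian gradient: `⟪grad f x, v⟫ = df_x(v)`. -/
def grad (f : M → ℝ) (x : M) : TangentSpace 𝓘(ℝ, E) x :=
  (InnerProductSpace.toDual ℝ (TangentSpace 𝓘(ℝ, E) x)).symm (mvfderiv 𝓘(ℝ, E) f x)

/-- The Riemannian Hessian: `Hess f (x) u = ∇_u (grad f)`. -/
def hess (f : M → ℝ) (x : M) (u : TangentSpace 𝓘(ℝ, E) x) : TangentSpace 𝓘(ℝ, E) x :=
  leviCivita (grad E f) x u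

/-- The second covariant derivative of a vector field,
`∇²V(u, w) = ∇_u (∇_W V) - ∇_{∇_u W} V`, where `W` is a vector field with `W x = w`. -/
def secondCovDeriv (V : ∀ y : M, TangentSpace 𝓘(ℝ, E) y) (x : M)
    (u w : TangentSpace 𝓘(ℝ, E) x) : TangentSpace 𝓘(ℝ, E) x :=
  leviCivita (fun y ↦ leviCivita V y (chartExtend x w y)) x u -
    leviCivita V x (leviCivita (chartExtend x w) x u)

/-- The curvature tensor `R(u, v) w = ∇_u ∇_V W - ∇_v ∇_U W - ∇_{[U, V]} W`, where `U`, `V`, `W` are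
vector fields with values `u`, `v`, `w` at `x`. -/
def curvature (x : M) (u v w : TangentSpace 𝓘(ℝ, E) x) : TangentSpace 𝓘(ℝ, E) x :=
  leviCivita (fun y ↦ leviCivita (chartExtend x w) y (chartExtend x v y)) x u -
    leviCivita (fun y ↦ leviCivita (chartExtend x w) y (chartExtend x u y)) x v -
    leviCivita (chartExtend x w) x
      (VectorField.mlieBracket 𝓘(ℝ, E) (chartExtend x u) (chartExtend x v) x)

variable (E M) in
/-- The norm of the curvature tensor is bounded on `M`. -/
def BoundedCurvature : Prop :=
  ∃ K : ℝ, ∀ (x : M) (u v w : TangentSpace 𝓘(ℝ, E) x),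
    ‖curvature x u v w‖ ≤ K * ‖u‖ * ‖v‖ * ‖w‖

/-! ## Bounded functions and vector fields, retractions, the gradient flow, and RSGD -/

variable (E) in
/-- `g` is of class `C²`, and `g`, its gradient and its Hessian are bounded. -/
structure IsC2Bounded (g : M → ℝ) : Prop where
  contMDiff : ContMDiff 𝓘(ℝ, E) 𝓘(ℝ, ℝ) 2 g
  bounded : ∃ K : ℝ, ∀ x : M, |g x| ≤ K ∧ ‖grad E g x‖ ≤ K ∧
    ∀ u : TangentSpace 𝓘(ℝ, E) x, ‖u‖ = 1 → ‖hess g x u‖ ≤ K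

/-- `V` is a vector field of class `C²`, and `V`, `∇V` and `∇²V` are bounded. -/
structure IsC2BoundedVectorField (V : ∀ x : M, TangentSpace 𝓘(ℝ, E) x) : Prop where
  contMDiff : ContMDiff 𝓘(ℝ, E) 𝓘(ℝ, E).tangent 2
    (fun x ↦ (⟨x, V x⟩ : TangentBundle 𝓘(ℝ, E) M))
  bounded : ∃ K : ℝ, ∀ x : M, ‖V x‖ ≤ K ∧
    (∀ u : TangentSpace 𝓘(ℝ, E) x, ‖u‖ = 1 → ‖leviCivita V x u‖ ≤ K) ∧
    ∀ u w : TangentSpace 𝓘(ℝ, E) x, ‖u‖ = 1 → ‖w‖ = 1 → ‖secondCovDeriv V x u w‖ ≤ K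

/-- `retr : TM → M` is a uniform first order retraction: a `C²` map with `retr_x(0) = x` and
`D_0 retr_x = id`, such that the velocities and accelerations of the curves `t ↦ retr_x(t v)`,
`t ≥ 0`, `‖v‖ = 1`, are bounded uniformly in `t`, `x` and `v`. -/
structure IsUniformFirstOrderRetraction (retr : TangentBundle 𝓘(ℝ, E) M → M) : Prop where
  contMDiff : ContMDiff 𝓘(ℝ, E).tangent 𝓘(ℝ, E) 2 retr
  map_zero : ∀ x : M, retr ⟨x, 0⟩ = x
  hasMFDerivAt_zero : ∀ x : M,
    HasMFDerivAt 𝓘(ℝ, E) 𝓘(ℝ, E) (fun v : E ↦ retr ⟨x, v⟩) 0 (ContinuousLinearMap.id ℝ E)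
  bounded : ∃ C : ℝ, ∀ (x : M) (v : TangentSpace 𝓘(ℝ, E) x), ‖v‖ = 1 → ∀ t : ℝ, 0 ≤ t →
    ‖velocity (E := E) (fun s ↦ retr ⟨x, s • v⟩) t‖ ≤ C ∧
    ‖covDerivAlong (E := E) (fun s ↦ retr ⟨x, s • v⟩)
      (velocity (fun s ↦ retr ⟨x, s • v⟩)) t‖ ≤ C

variable (E) in
/-- `X x t` is the solution at time `t ≥ 0` of `dx_t/dt = -grad f(x_t)` started at `x`. -/
def IsGradientFlow (f : M → ℝ) (X : M → ℝ → M) : Prop :=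
  ∀ x : M, X x 0 = x ∧
    IsMIntegralCurveOn (I := 𝓘(ℝ, E)) (X x) (fun y ↦ -grad E f y) (Set.Ici 0)

end Geometry

/-- Riemannian stochastic gradient descent with retraction `retr`, gradient estimator `F` and
learning rate `η`, started at `x`: `Z₀ = x` and `Zₙ₊₁ = retr_{Zₙ}(-η F(Zₙ, ξₙ))`. The samples are
indexed from `0`, so that `Zₙ` is a function of `ξ₀, …, ξₙ₋₁`. -/
def iterate {E : Type*} [NormedAddCommGroup E] [NormedSpace ℝ E] {M : Type*} [TopologicalSpace M]
    [ChartedSpace E M] {Ξ Ω : Type*} (retr : TangentBundle 𝓘(ℝ, E) M → M)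
    (F : ∀ x : M, Ξ → TangentSpace 𝓘(ℝ, E) x) (ξ : ℕ → Ω → Ξ) (η : ℝ) (x : M) : ℕ → Ω → M
  | 0, _ => x
  | n + 1, o => retr ⟨iterate retr F ξ η x n o, -η • F (iterate retr F ξ η x n o) (ξ n o)⟩

end RSGD

end

/-! Write V = -grad f, φ for its flow and u = g ∘ φ t. The error E[g(Z_n)] - g(φ_{nη} x) telescopes
into n one-step errors E[u(Z_{k+1})] - E[u(φ_η(Z_k))] with t = (n-k-1)η. If each of them is O(η²)
uniformly, then nη ≤ T leaves O(η). Since ξ_k is independent of Z_k, a one-step error is an average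
over y of ∫ u(retr_y(-ηF(y,s))) dθ(s) - u(φ_η y). To first order the retraction moves y by -ηF(y,s),
whose mean ηV(y) is also the first-order motion of the flow. The linear terms cancel, and only
quadratic remainders survive; the random one is controlled by the second moment of F
(`IsFlow.exists_weak_step_bound`).

The substance is that these remainders are uniform in t ∈ [0, T] and in y. Along a curve c, the
second derivative of g ∘ φ t ∘ c is ⟪Hess g S, S⟫ + ⟪grad g, A⟫, where S and A are the velocity and
the covariant acceleration of φ t ∘ c. As functions of t they solve ∇S/dt = ∇_S V and ∇A/dt =
∇²V(S,S) + ∇_A V + R(V,S)S (`IsFlow.variation`). The bounds on V, ∇V, ∇²V and R together with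
Gronwall's inequality bound S and A on [0, T] (`IsFlow.exists_bound_variation`), uniformly over
curves with bounded initial velocity and acceleration. The curves of the retraction and the
trajectories of V are of this kind (`IsFlow.exists_step_bound`).

Two foundations are needed. The flow is global because V is bounded and M is complete
(`exists_isMIntegralCurve_of_bounded`). And the equation for A contains a time derivative of second
space derivatives of the flow, although V is only C². The inverse function theorem on the path space
C([0,1], E) gives, in a chart, φ t z = z + t k(t,z) with k of class C² (`IsFlow.exists_contDiffAt`),
and the explicit factor t supplies the missing derivative. The variational equations then become
identities between Christoffel symbols in one chart. -/

noncomputable section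

set_option linter.unusedSectionVars false

namespace RSGD

/-! ## Superposition operators on spaces of continuous functions -/

section Superposition

universe u

variable {K : Type*} [TopologicalSpace K] [CompactSpace K]
  {E F : Type u} [NormedAddCommGroup E] [NormedSpace ℝ E]
  [NormedAddCommGroup F] [NormedSpace ℝ F]

set_option synthInstance.maxHeartbeats 200000 in
instance instNormedAddCommGroupPathsCLM : NormedAddCommGroup C(K, E →L[ℝ] F) := inferInstance

set_option synthInstance.maxHeartbeats 200000 in
instance instSeminormedAddCommGroupPathsCLM : SeminormedAddCommGroup C(K, E →L[ℝ] F) :=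
  inferInstance

set_option synthInstance.maxHeartbeats 200000 in
instance instNormedSpacePathsCLM : NormedSpace ℝ C(K, E →L[ℝ] F) := inferInstance

/-- Pointwise application `C(K, E →L F) → C(K, E) → C(K, F)` as a bounded bilinear map. -/
def pointwiseApply : C(K, E →L[ℝ] F) →L[ℝ] C(K, E) →L[ℝ] C(K, F) :=
  LinearMap.mkContinuous₂
    (LinearMap.mk₂ ℝ
      (fun (A : C(K, E →L[ℝ] F)) (h : C(K, E)) ↦ (⟨fun r ↦ A r (h r), by fun_prop⟩ : C(K, F)))
      (fun A A' h ↦ by ext; simp) (fun c A h ↦ by ext; simp)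
      (fun A h h' ↦ by ext; simp) (fun c A h ↦ by ext; simp)) 1
    (fun A h ↦ by
      rw [one_mul]
      refine (ContinuousMap.norm_le _ (by positivity)).2 fun r ↦ ?_
      exact (A r).le_opNorm_of_le (h.norm_coe_le_norm r) |>.trans
        (mul_le_mul_of_nonneg_right (A.norm_coe_le_norm r) (norm_nonneg _)))

/-- The superposition operator `γ ↦ W ∘ γ`. -/
def superpose (W : E → F) (hW : Continuous W) (γ : C(K, E)) : C(K, F) :=
  (⟨W, hW⟩ : C(E, F)).comp γ

omit [CompactSpace K] [NormedSpace ℝ E] [NormedSpace ℝ F] in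
theorem continuous_superpose (W : E → F) (hW : Continuous W) :
    Continuous (superpose W hW : C(K, E) → C(K, F)) :=
  ContinuousMap.continuous_postcomp _

/-- All values of γ and of small perturbations of γ lie in one ball, compact in finite dimension.
There W' is uniformly continuous, so the mean value inequality gives a remainder that is small
uniformly in the parameter of the path. -/
theorem hasFDerivAt_superpose [FiniteDimensional ℝ E] {W : E → F} (hW : Continuous W)
    {W' : E → E →L[ℝ] F} (hW' : ∀ x, HasFDerivAt W (W' x) x) (hc : Continuous W') (γ : C(K, E)) :
    HasFDerivAt (superpose W hW) (pointwiseApply (superpose W' hc γ)) γ := by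
  rw [hasFDerivAt_iff_isLittleO_nhds_zero, Asymptotics.isLittleO_iff]
  intro c hc0
  have := FiniteDimensional.proper ℝ E
  -- Radius ‖γ‖ + 1: perturbations h are taken with ‖h‖ < 1.
  have hS : IsCompact (Metric.closedBall (0 : E) (‖γ‖ + 1)) := isCompact_closedBall _ _
  obtain ⟨δ, hδ, hδ'⟩ := Metric.uniformContinuousOn_iff.1
    (hS.uniformContinuousOn_of_continuous hc.continuousOn) c hc0
  filter_upwards [Metric.ball_mem_nhds (0 : C(K, E)) (lt_min hδ one_pos)] with h hh
  rw [mem_ball_zero_iff, lt_min_iff] at hh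
  refine (ContinuousMap.norm_le _ (by positivity)).2 fun r ↦ ?_
  have hr : ‖h r‖ ≤ ‖h‖ := h.norm_coe_le_norm r
  have hγ : ‖γ r‖ ≤ ‖γ‖ := γ.norm_coe_le_norm r
  change ‖W (γ r + h r) - W (γ r) - W' (γ r) (h r)‖ ≤ c * ‖h‖
  have hball : Convex ℝ (Metric.closedBall (γ r) ‖h r‖) := convex_closedBall _ _
  have key := hball.norm_image_sub_le_of_norm_hasFDerivWithin_le' (f := W) (f' := W')
    (φ := W' (γ r)) (C := c) (x := γ r) (y := γ r + h r)
    (fun x _ ↦ (hW' x).hasFDerivWithinAt) (fun x hx ↦ ?_) (by simp) (by simp)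
  · rw [add_sub_cancel_left] at key
    exact key.trans (mul_le_mul_of_nonneg_left hr hc0.le)
  · rw [mem_closedBall_iff_norm] at hx
    rw [← dist_eq_norm]
    refine (hδ' x ?_ (γ r) ?_ ?_).le
    · rw [mem_closedBall_zero_iff]
      have : ‖x‖ ≤ ‖x - γ r‖ + ‖γ r‖ := by simpa using norm_add_le (x - γ r) (γ r)
      linarith
    · rw [mem_closedBall_zero_iff]; linarith
    · rw [dist_eq_norm]; linarith

/-- The derivative is the superposition operator of W' followed by a bounded linear map, so
induction on n applies with target E →L F in place of F. This is why E and F share a universe and F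
is generalized. -/
theorem contDiff_superpose [FiniteDimensional ℝ E] (n : ℕ) {F : Type u} [NormedAddCommGroup F]
    [NormedSpace ℝ F] {W : E → F} (hW : ContDiff ℝ n W) :
    ContDiff ℝ n (superpose W hW.continuous : C(K, E) → C(K, F)) := by
  induction n generalizing F with
  | zero => exact contDiff_zero.2 (continuous_superpose _ _)
  | succ n ih =>
    obtain ⟨W', hW', hd⟩ := contDiff_succ_iff_hasFDerivAt.1 hW
    refine contDiff_succ_iff_hasFDerivAt.2 ⟨fun γ ↦ pointwiseApply (superpose W' hW'.continuous γ),
      ?_, hasFDerivAt_superpose _ hd _⟩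
    exact pointwiseApply.contDiff.comp (ih hW')

end Superposition

/-! ## Dependence of solutions of an ODE on time and initial value -/

section Flow

open unitInterval

universe u

variable {E : Type u} [NormedAddCommGroup E] [NormedSpace ℝ E]

/-- Integration `f ↦ (r ↦ ∫₀ʳ f)` on `C([0, 1], E)`. -/
def integrateOperator : C(I, E) →L[ℝ] C(I, E) :=
  LinearMap.mkContinuous
    { toFun f := ⟨fun r ↦ ∫ ρ in (0 : ℝ)..r, Set.IccExtend zero_le_one f ρ, by
        have hf : Continuous (Set.IccExtend zero_le_one f) := f.continuous.Icc_extend'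
        exact (intervalIntegral.continuous_primitive (fun a b ↦ hf.intervalIntegrable a b) 0).comp
          continuous_subtype_val⟩
      map_add' f f' := by
        ext r
        have hf : Continuous (Set.IccExtend zero_le_one f) := f.continuous.Icc_extend'
        have hf' : Continuous (Set.IccExtend zero_le_one f') := f'.continuous.Icc_extend'
        exact intervalIntegral.integral_add (hf.intervalIntegrable _ _) (hf'.intervalIntegrable _ _)
      map_smul' c f := by
        ext r
        exact intervalIntegral.integral_smul c _ } 1
    (fun f ↦ by
      rw [one_mul]
      refine (ContinuousMap.norm_le _ (by positivity)).2 fun r ↦ ?_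
      have := intervalIntegral.norm_integral_le_of_norm_le_const (a := 0) (b := (r : ℝ))
        (f := Set.IccExtend zero_le_one f) (C := ‖f‖) (fun x _ ↦ f.norm_coe_le_norm _)
      refine this.trans (mul_le_of_le_one_right (norm_nonneg _) ?_)
      rw [sub_zero, abs_of_nonneg r.2.1]
      exact r.2.2)

theorem integrateOperator_apply (f : C(I, E)) (r : I) :
    integrateOperator f r = ∫ ρ in (0 : ℝ)..r, Set.IccExtend zero_le_one f ρ := rfl

theorem integrateOperator_const_one [CompleteSpace E] (z : E) :
    integrateOperator (ContinuousMap.const I z) 1 = z := by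
  rw [integrateOperator_apply]
  have : Set.IccExtend zero_le_one (ContinuousMap.const I z) = fun _ ↦ z := by
    ext; simp [Set.IccExtend]
  rw [this]; simp

/-- The constant paths, as a continuous linear map. -/
def constPath : E →L[ℝ] C(I, E) :=
  LinearMap.mkContinuous
    { toFun z := ContinuousMap.const I z
      map_add' _ _ := rfl
      map_smul' _ _ := rfl } 1
    (fun z ↦ by
      rw [one_mul]
      exact (ContinuousMap.norm_le _ (by positivity)).2 fun r ↦ le_rfl)

theorem constPath_apply (z : E) (r : I) : constPath z r = z := rfl

/-- Rescaled solution paths of `x' = W x` that depend continuously on `(t, z)` at `(0, z₀)` depend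
on them in a `C²` way. -/
theorem contDiffAt_solutionPath [FiniteDimensional ℝ E] {W : E → E} (hW : ContDiff ℝ 2 W) {z₀ : E}
    {a : ℝ × E → C(I, E)} (ha : ContinuousAt a (0, z₀)) (ha₀ : a (0, z₀) = constPath z₀)
    (h : ∀ᶠ p in 𝓝 (0, z₀), a p = constPath p.2 +
      p.1 • integrateOperator (superpose W hW.continuous (a p))) :
    ContDiffAt ℝ 2 a (0, z₀) := by
  have := FiniteDimensional.complete ℝ E
  have hN : ContDiff ℝ 2 (superpose W hW.continuous : C(I, E) → C(I, E)) :=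
    contDiff_superpose 2 hW
  let N : C(I, E) → C(I, E) := superpose W hW.continuous
  -- The integral equation says that the second component of H vanishes; the parameters (t, z) are
  -- carried along so that the inverse function theorem acts as an implicit one.
  let H : (ℝ × E) × C(I, E) → (ℝ × E) × C(I, E) := fun q ↦
    (q.1, q.2 - constPath q.1.2 - q.1.1 • integrateOperator (N q.2))
  have hJN : ContDiff ℝ 2 (fun q : (ℝ × E) × C(I, E) ↦ integrateOperator (N q.2)) :=
    integrateOperator.contDiff.comp (hN.comp contDiff_snd)
  have hH : ContDiff ℝ 2 H := by
    refine contDiff_fst.prodMk ((contDiff_snd.sub ?_).sub ?_)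
    · exact (ContinuousLinearMap.contDiff (F := C(I, E)) constPath).comp
        (contDiff_snd.comp contDiff_fst)
    · exact (contDiff_fst.comp contDiff_fst).smul hJN
  set q₀ : (ℝ × E) × C(I, E) := ((0, z₀), constPath z₀)
  let Lp : ℝ × E →L[ℝ] C(I, E) := constPath ∘L ContinuousLinearMap.snd ℝ ℝ E +
    (ContinuousLinearMap.fst ℝ ℝ E).smulRight (integrateOperator (N (constPath z₀)))
  -- At t = 0 the nonlinear term carries the factor t = 0, so its derivative in the path direction
  -- vanishes. The derivative of H is therefore unipotent, (p, h) ↦ (p, h - Lp p), and its inverse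
  -- is explicit.
  let e : ((ℝ × E) × C(I, E)) ≃L[ℝ] ((ℝ × E) × C(I, E)) :=
    ContinuousLinearEquiv.equivOfInverse
      ((ContinuousLinearMap.fst ℝ _ _).prod (ContinuousLinearMap.snd ℝ _ _ -
        Lp ∘L ContinuousLinearMap.fst ℝ _ _))
      ((ContinuousLinearMap.fst ℝ _ _).prod (ContinuousLinearMap.snd ℝ _ _ +
        Lp ∘L ContinuousLinearMap.fst ℝ _ _))
      (fun q ↦ by ext <;> simp) (fun q ↦ by ext <;> simp)
  have he : HasFDerivAt H (e : ((ℝ × E) × C(I, E)) →L[ℝ] ((ℝ × E) × C(I, E))) q₀ := by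
    have h1 : HasFDerivAt (fun q : (ℝ × E) × C(I, E) ↦ q.1) (ContinuousLinearMap.fst ℝ _ _) q₀ :=
      hasFDerivAt_fst
    have h2 : HasFDerivAt (fun q : (ℝ × E) × C(I, E) ↦ q.2) (ContinuousLinearMap.snd ℝ _ _) q₀ :=
      hasFDerivAt_snd
    have h3 : HasFDerivAt (fun q : (ℝ × E) × C(I, E) ↦ constPath q.1.2)
        (constPath ∘L ContinuousLinearMap.snd ℝ ℝ E ∘L ContinuousLinearMap.fst ℝ _ _) q₀ := by
      let L₃ : (ℝ × E) × C(I, E) →L[ℝ] C(I, E) :=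
        constPath ∘L ContinuousLinearMap.snd ℝ ℝ E ∘L ContinuousLinearMap.fst ℝ _ _
      exact L₃.hasFDerivAt
    have h4 : HasFDerivAt (fun q : (ℝ × E) × C(I, E) ↦ q.1.1)
        (ContinuousLinearMap.fst ℝ ℝ E ∘L ContinuousLinearMap.fst ℝ _ _) q₀ := by
      let L₄ : (ℝ × E) × C(I, E) →L[ℝ] ℝ :=
        ContinuousLinearMap.fst ℝ ℝ E ∘L ContinuousLinearMap.fst ℝ _ _
      exact L₄.hasFDerivAt
    have h5 := h4.smul ((hJN.differentiable (by simp)) q₀).hasFDerivAt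
    refine (h1.prodMk ((h2.sub h3).sub h5)).congr_fderiv ?_
    ext q <;> simp [e, Lp, q₀]
  have hinv := hH.contDiffAt.to_localInverse (a := q₀) he (by simp)
  -- Near q₀ the local inverse recovers q from H q. Continuity of `a` keeps (p, a p) in that
  -- neighbourhood, so a p is the second component of the inverse at (p, 0).
  have hleft : ∀ᶠ q in 𝓝 q₀, hH.contDiffAt.localInverse he (by simp) (H q) = q :=
    (hH.contDiffAt.hasStrictFDerivAt' he (by simp)).eventually_left_inverse
  have hcont : Filter.Tendsto (fun p ↦ (p, a p)) (𝓝 (0, z₀)) (𝓝 q₀) := by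
    have : ContinuousAt (fun p ↦ (p, a p)) (0, z₀) := continuousAt_id.prodMk ha
    simpa [ContinuousAt, ha₀, q₀] using this
  have hHq : H q₀ = ((0, z₀), 0) := by simp [H, q₀]
  rw [hHq] at hinv
  have hfin : ContDiffAt ℝ 2 (fun p : ℝ × E ↦
      (hH.contDiffAt.localInverse he (by simp) (p, (0 : C(I, E)))).2) (0, z₀) :=
    contDiffAt_snd.comp _ (hinv.comp (0, z₀) (contDiffAt_id.prodMk contDiffAt_const))
  refine hfin.congr_of_eventuallyEq ?_
  filter_upwards [hcont.eventually hleft, h] with p hp hp'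
  have : H (p, a p) = (p, 0) := by
    simp only [H, N, Prod.mk.injEq, true_and]
    nth_rewrite 1 [hp']
    simp
  rw [← this, hp]

/-- Under the hypotheses of `contDiffAt_solutionPath`, the time-`t` map is `z + t • k (t, z)` with a
`C²` function `k` such that `k (0, z) = W z`. -/
theorem exists_contDiffAt_solution_eq [FiniteDimensional ℝ E]
    {W : E → E} (hW : ContDiff ℝ 2 W) {z₀ : E}
    {a : ℝ × E → C(I, E)} (ha : ContinuousAt a (0, z₀)) (ha₀ : a (0, z₀) = constPath z₀)
    (h : ∀ᶠ p in 𝓝 (0, z₀), a p = constPath p.2 +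
      p.1 • integrateOperator (superpose W hW.continuous (a p))) :
    ∃ k : ℝ × E → E, ContDiffAt ℝ 2 k (0, z₀) ∧ (∀ᶠ p in 𝓝 (0, z₀), a p 1 = p.2 + p.1 • k p) ∧
      ∀ᶠ z in 𝓝 z₀, k (0, z) = W z := by
  have := FiniteDimensional.complete ℝ E
  -- k is the mean of W over the rescaled path; at t = 0 the path is constant and the mean is W z.
  refine ⟨fun p ↦ integrateOperator (superpose W hW.continuous (a p)) 1, ?_, ?_, ?_⟩
  · have h1 := contDiffAt_solutionPath hW ha ha₀ h
    have h2 : ContDiff ℝ 2 (superpose W hW.continuous : C(I, E) → C(I, E)) :=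
      contDiff_superpose 2 hW
    exact ((ContinuousMap.evalCLM ℝ (1 : I)).contDiff.comp
      (integrateOperator.contDiff.comp h2)).contDiffAt.comp _ h1
  · filter_upwards [h] with p hp
    nth_rewrite 1 [hp]
    simp [constPath_apply]
  · have hc : Filter.Tendsto (fun z : E ↦ ((0 : ℝ), z)) (𝓝 z₀) (𝓝 (0, z₀)) :=
      (Continuous.prodMk_right (0 : ℝ)).tendsto z₀
    filter_upwards [hc.eventually h] with z hz
    simp only [zero_smul, add_zero] at hz
    rw [hz]
    exact integrateOperator_const_one (W z)

end Flow

/-! ## Coordinate frames -/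

section Frame

variable {E : Type*} [NormedAddCommGroup E] [NormedSpace ℝ E]
  {M : Type*} [TopologicalSpace M] [ChartedSpace E M] [IsManifold 𝓘(ℝ, E) ∞ M]

theorem two_le_infty : (2 : WithTop ℕ∞) ≤ ∞ := ENat.LEInfty.out

/-- The coordinate frame of the chart at `x`, at the point `y`. -/
def frame (x y : M) : E →L[ℝ] TangentSpace 𝓘(ℝ, E) y :=
  (trivializationAt E (TangentSpace 𝓘(ℝ, E)) x).symmL ℝ y

/-- The components, in the chart at `x`, of tangent vectors at `y`. -/
def coframe (x y : M) : TangentSpace 𝓘(ℝ, E) y →L[ℝ] E :=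
  (trivializationAt E (TangentSpace 𝓘(ℝ, E)) x).continuousLinearMapAt ℝ y

theorem coframe_frame {x y : M} (hy : y ∈ (chartAt E x).source) (v : E) :
    coframe x y (frame x y v) = v :=
  (trivializationAt E (TangentSpace 𝓘(ℝ, E)) x).continuousLinearMapAt_symmL (R := ℝ) hy v

theorem frame_coframe {x y : M} (hy : y ∈ (chartAt E x).source) (u : TangentSpace 𝓘(ℝ, E) y) :
    frame x y (coframe x y u) = u :=
  (trivializationAt E (TangentSpace 𝓘(ℝ, E)) x).symmL_continuousLinearMapAt (R := ℝ) hy u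

theorem coframe_apply {x y : M} (hy : y ∈ (chartAt E x).source) (u : TangentSpace 𝓘(ℝ, E) y) :
    coframe x y u = (trivializationAt E (TangentSpace 𝓘(ℝ, E)) x ⟨y, u⟩).2 := by
  rw [coframe, Trivialization.continuousLinearMapAt_apply, Trivialization.coe_linearMapAt_of_mem]
  exact hy

theorem coframe_eq_mfderiv {x y : M} (hy : y ∈ (chartAt E x).source) :
    coframe x y = mfderiv 𝓘(ℝ, E) 𝓘(ℝ, E) (extChartAt 𝓘(ℝ, E) x) y :=
  TangentBundle.continuousLinearMapAt_trivializationAt hy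

theorem chartExtend_eq_frame (x : M) (v : TangentSpace 𝓘(ℝ, E) x) (y : M) :
    chartExtend x v y = frame x y (coframe x x v) := rfl

theorem source_mem_nhds {x y : M} (hy : y ∈ (chartAt E x).source) : (chartAt E x).source ∈ 𝓝 y :=
  (chartAt E x).open_source.mem_nhds hy

/-- The point with coordinates `z` in the chart at `x`. -/
abbrev pt (x : M) (z : E) : M := (extChartAt 𝓘(ℝ, E) x).symm z

/-- The coordinates of `y` in the chart at `x`. -/
abbrev coord (x y : M) : E := extChartAt 𝓘(ℝ, E) x y

theorem pt_coord {x y : M} (hy : y ∈ (chartAt E x).source) : pt x (coord x y : E) = y :=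
  (extChartAt 𝓘(ℝ, E) x).left_inv (by simpa using hy)

theorem isOpen_coordRange (x : M) : IsOpen (extChartAt 𝓘(ℝ, E) x).target :=
  isOpen_extChartAt_target x

theorem coord_mem {x y : M} (hy : y ∈ (chartAt E x).source) :
    (coord x y : E) ∈ (extChartAt 𝓘(ℝ, E) x).target :=
  (extChartAt 𝓘(ℝ, E) x).map_source (by simpa using hy)

theorem coordRange_mem_nhds {x y : M} (hy : y ∈ (chartAt E x).source) :
    (extChartAt 𝓘(ℝ, E) x).target ∈ 𝓝 (coord x y : E) :=
  (isOpen_coordRange x).mem_nhds (coord_mem hy)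

theorem pt_mem {x : M} {z : E} (hz : z ∈ (extChartAt 𝓘(ℝ, E) x).target) :
    pt x z ∈ (chartAt E x).source := by
  rw [← extChartAt_source 𝓘(ℝ, E)]
  exact (extChartAt 𝓘(ℝ, E) x).map_target hz

theorem coord_pt {x : M} {z : E} (hz : z ∈ (extChartAt 𝓘(ℝ, E) x).target) :
    coord x (pt x z) = z :=
  (extChartAt 𝓘(ℝ, E) x).right_inv hz

theorem contMDiffAt_coord {x y : M} (hy : y ∈ (chartAt E x).source) :
    ContMDiffAt 𝓘(ℝ, E) 𝓘(ℝ, E) ∞ (fun y : M ↦ (coord x y : E)) y :=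
  contMDiffAt_extChartAt' (by simpa using hy)

theorem contMDiffAt_pt {x : M} {z : E} (hz : z ∈ (extChartAt 𝓘(ℝ, E) x).target) :
    ContMDiffAt 𝓘(ℝ, E) 𝓘(ℝ, E) ∞ (pt x : E → M) z :=
  (contMDiffOn_extChartAt_symm x).contMDiffAt ((isOpen_coordRange x).mem_nhds hz)

theorem mfderiv_pt {x : M} {z : E} (hz : z ∈ (extChartAt 𝓘(ℝ, E) x).target) (v : E) :
    mfderiv 𝓘(ℝ, E) 𝓘(ℝ, E) (pt x) z v = frame x (pt x z) v := by
  rw [frame, TangentBundle.symmL_trivializationAt (pt_mem hz)]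
  have h := coord_pt hz
  simp only [coord, pt] at h
  rw [h, modelWithCornersSelf_coe, Set.range_id, mfderivWithin_univ]
  rfl

/-- The components in the chart at `x` of the vector field `σ`, as a function of the coordinates. -/
def rep (x : M) (σ : ∀ y : M, TangentSpace 𝓘(ℝ, E) y) (z : E) : E :=
  coframe x (pt x z) (σ (pt x z))

theorem rep_coord {x y : M} (hy : y ∈ (chartAt E x).source)
    (σ : ∀ y : M, TangentSpace 𝓘(ℝ, E) y) : rep x σ (coord x y) = coframe x y (σ y) := by
  rw [rep, pt_coord hy]

theorem frame_rep {x y : M} (hy : y ∈ (chartAt E x).source)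
    (σ : ∀ y : M, TangentSpace 𝓘(ℝ, E) y) : frame x y (rep x σ (coord x y)) = σ y := by
  rw [rep_coord hy, frame_coframe hy]

theorem rep_frame (x : M) (v : E) {z : E} (hz : z ∈ (extChartAt 𝓘(ℝ, E) x).target) :
    rep x (fun y ↦ frame x y v) z = v :=
  coframe_frame (pt_mem hz) v

theorem contMDiffAt_section_iff_coframe {n : WithTop ℕ∞} (hn : n ≤ ∞) {x y : M}
    (hy : y ∈ (chartAt E x).source) {σ : ∀ y : M, TangentSpace 𝓘(ℝ, E) y} :
    ContMDiffAt 𝓘(ℝ, E) 𝓘(ℝ, E).tangent n (fun y ↦ (⟨y, σ y⟩ : TangentBundle 𝓘(ℝ, E) M)) y ↔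
      ContMDiffAt 𝓘(ℝ, E) 𝓘(ℝ, E) n (fun y ↦ coframe x y (σ y)) y := by
  have : ContMDiffVectorBundle n E (TangentSpace 𝓘(ℝ, E) : M → Type _) 𝓘(ℝ, E) :=
    ContMDiffVectorBundle.of_le hn
  have := IsManifold.of_le (I := 𝓘(ℝ, E)) (M := M) hn
  rw [(trivializationAt E (TangentSpace 𝓘(ℝ, E)) x).contMDiffAt_section_iff hy]
  refine Filter.EventuallyEq.contMDiffAt_iff ?_
  filter_upwards [source_mem_nhds hy] with y' hy'
  exact (coframe_apply hy' _).symm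

theorem contMDiffAt_section_iff_rep {n : WithTop ℕ∞} (hn : n ≤ ∞) {x y : M}
    (hy : y ∈ (chartAt E x).source) {σ : ∀ y : M, TangentSpace 𝓘(ℝ, E) y} :
    ContMDiffAt 𝓘(ℝ, E) 𝓘(ℝ, E).tangent n (fun y ↦ (⟨y, σ y⟩ : TangentBundle 𝓘(ℝ, E) M)) y ↔
      ContDiffAt ℝ n (rep x σ) (coord x y) := by
  rw [contMDiffAt_section_iff_coframe hn hy, ← contMDiffAt_iff_contDiffAt]
  constructor
  · intro h
    have h2 : ContMDiffAt 𝓘(ℝ, E) 𝓘(ℝ, E) n (pt x : E → M) (coord x y) :=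
      (contMDiffAt_pt (coord_mem hy)).of_le hn
    exact ContMDiffAt.comp_of_eq h h2 (pt_coord hy)
  · intro h
    have h2 := ContMDiffAt.comp y h ((contMDiffAt_coord hy).of_le hn)
    refine h2.congr_of_eventuallyEq ?_
    filter_upwards [source_mem_nhds hy] with y' hy'
    exact (rep_coord hy' σ).symm

theorem mdifferentiableAt_section_of_rep {x y : M}
    (hy : y ∈ (chartAt E x).source) {σ : ∀ y : M, TangentSpace 𝓘(ℝ, E) y}
    (h : DifferentiableAt ℝ (rep x σ) (coord x y)) :
    MDifferentiableAt 𝓘(ℝ, E) 𝓘(ℝ, E).tangent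
      (fun y ↦ (⟨y, σ y⟩ : TangentBundle 𝓘(ℝ, E) M)) y := by
  rw [(trivializationAt E (TangentSpace 𝓘(ℝ, E)) x).mdifferentiableAt_section_iff 𝓘(ℝ, E) σ hy]
  have h2 := MDifferentiableAt.comp y h.mdifferentiableAt
    ((contMDiffAt_coord hy).mdifferentiableAt (by simp))
  refine h2.congr_of_eventuallyEq ?_
  filter_upwards [source_mem_nhds hy] with y' hy'
  exact ((rep_coord hy' σ).trans (coframe_apply hy' _)).symm

theorem contMDiffAt_frame {x y : M} (hy : y ∈ (chartAt E x).source) (v : E) :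
    ContMDiffAt 𝓘(ℝ, E) 𝓘(ℝ, E).tangent ∞
      (fun y ↦ (⟨y, frame x y v⟩ : TangentBundle 𝓘(ℝ, E) M)) y := by
  rw [contMDiffAt_section_iff_coframe le_rfl hy]
  refine contMDiffAt_const (c := v) |>.congr_of_eventuallyEq ?_
  filter_upwards [source_mem_nhds hy] with y' hy'
  exact coframe_frame hy' v

theorem mdifferentiableAt_frame {x y : M} (hy : y ∈ (chartAt E x).source) (v : E) :
    MDifferentiableAt 𝓘(ℝ, E) 𝓘(ℝ, E).tangent
      (fun y ↦ (⟨y, frame x y v⟩ : TangentBundle 𝓘(ℝ, E) M)) y :=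
  (contMDiffAt_frame hy v).mdifferentiableAt (by simp)

/-- A constant vector field on the model space. -/
def constField (v : E) (z : E) : TangentSpace 𝓘(ℝ, E) z := v

theorem mdifferentiableAt_constField (z : E) (v : E) :
    MDifferentiableAt 𝓘(ℝ, E) 𝓘(ℝ, E).tangent
      (fun z ↦ (⟨z, constField v z⟩ : TangentBundle 𝓘(ℝ, E) E)) z := by
  rw [mdifferentiableAt_section]
  simp only [constField, trivializationAt_model_space_apply]
  exact mdifferentiableAt_const

/-- The frame fields are pullbacks of constant fields under the chart, and the bracket is natural.
Unlike `mlieBracket_chartExtend`, this covers every point of the chart domain, as needed for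
comparing connections away from the centre. -/
theorem mlieBracket_frame [FiniteDimensional ℝ E] {x y : M} (hy : y ∈ (chartAt E x).source)
    (v w : E) :
    VectorField.mlieBracket 𝓘(ℝ, E) (fun y ↦ frame x y v) (fun y ↦ frame x y w) y = 0 := by
  have := FiniteDimensional.complete ℝ E
  have key (v : E) : (fun y ↦ frame x y v) =ᶠ[𝓝 y]
      VectorField.mpullback 𝓘(ℝ, E) 𝓘(ℝ, E) (extChartAt 𝓘(ℝ, E) x) (constField v) := by
    filter_upwards [source_mem_nhds hy] with y' hy'
    refine Eq.symm ((ContinuousLinearMap.IsInvertible.inverse_apply_eq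
      (isInvertible_mfderiv_extChartAt (by simpa using hy'))).2 ?_)
    rw [← coframe_eq_mfderiv hy']
    exact (coframe_frame hy' v).symm
  have hm : IsManifold 𝓘(ℝ, E) (minSmoothness ℝ 2) M := by
    rw [minSmoothness_of_isRCLikeNormedField]; infer_instance
  have hb (z : E) : VectorField.mlieBracket 𝓘(ℝ, E) (constField v) (constField w) z = 0 := by
    rw [← VectorField.mlieBracketWithin_univ, VectorField.mlieBracketWithin_eq_lieBracketWithin]
    change VectorField.lieBracketWithin ℝ (fun _ : E ↦ v) (fun _ : E ↦ w) Set.univ z = 0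
    simp [VectorField.lieBracketWithin_eq]
  rw [(key v).mlieBracket_vectorField_eq (key w),
    ← VectorField.mpullback_mlieBracket (n := 2) (mdifferentiableAt_constField _ v)
    (mdifferentiableAt_constField _ w)
    ((contMDiffAt_coord hy).of_le two_le_infty)
    (by rw [minSmoothness_of_isRCLikeNormedField]),
    VectorField.mpullback_apply]
  exact (congrArg _ (hb _)).trans (map_zero _)

theorem velocity_eq_frame {x : M} {γ : ℝ → M} {t : ℝ}
    (hγ : MDifferentiableAt 𝓘(ℝ, ℝ) 𝓘(ℝ, E) γ t) (hx : γ t ∈ (chartAt E x).source) :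
    velocity (E := E) γ t = frame x (γ t) (deriv (fun s ↦ (coord x (γ s) : E)) t) := by
  have h1 := mfderiv_comp_apply t ((contMDiffAt_coord hx).mdifferentiableAt (by simp)) hγ (1 : ℝ)
  rw [mfderiv_eq_fderiv] at h1
  have h2 : deriv (fun s ↦ (coord x (γ s) : E)) t = coframe x (γ t) (velocity γ t) := by
    rw [coframe_eq_mfderiv hx]
    exact fderiv_apply_one_eq_deriv.symm.trans h1
  rw [h2, frame_coframe hx]

end Frame

/-! ## Shortcut instances

Instance search on iterated spaces of linear maps is slow in the presence of a Riemannian bundle. -/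

section Shortcuts

variable {E F G : Type*} [NormedAddCommGroup E] [NormedSpace ℝ E] [NormedAddCommGroup F]
  [NormedSpace ℝ F] [NormedAddCommGroup G] [NormedSpace ℝ G]

instance instNormedAddCommGroupCLM : NormedAddCommGroup (E →L[ℝ] F) :=
  ContinuousLinearMap.toNormedAddCommGroup

instance instNormedAddCommGroupCLM₂ : NormedAddCommGroup (E →L[ℝ] F →L[ℝ] G) :=
  ContinuousLinearMap.toNormedAddCommGroup

instance instSeminormedAddCommGroupCLM : SeminormedAddCommGroup (E →L[ℝ] F) :=
  ContinuousLinearMap.toSeminormedAddCommGroup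

instance instSeminormedAddCommGroupCLM₂ : SeminormedAddCommGroup (E →L[ℝ] F →L[ℝ] G) :=
  ContinuousLinearMap.toSeminormedAddCommGroup

instance instAddCommGroupCLM : AddCommGroup (E →L[ℝ] F) := ContinuousLinearMap.addCommGroup

instance instAddCommGroupCLM₂ : AddCommGroup (E →L[ℝ] F →L[ℝ] G) :=
  ContinuousLinearMap.addCommGroup

instance instNormedSpaceCLM : NormedSpace ℝ (E →L[ℝ] F) := ContinuousLinearMap.toNormedSpace

instance instNormedSpaceCLM₂ : NormedSpace ℝ (E →L[ℝ] F →L[ℝ] G) :=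
  ContinuousLinearMap.toNormedSpace

end Shortcuts

/-! ## The metric and the Christoffel symbols in a chart -/

section Christoffel

variable {E : Type*} [NormedAddCommGroup E] [NormedSpace ℝ E] [FiniteDimensional ℝ E]
  {M : Type*} [TopologicalSpace M] [ChartedSpace E M] [IsManifold 𝓘(ℝ, E) ∞ M]
  [RiemannianBundle (fun x : M ↦ TangentSpace 𝓘(ℝ, E) x)]

/-- The metric in the chart at `x`, as a function of the coordinates. -/
def metricCoeff (x : M) (z : E) : E →L[ℝ] E →L[ℝ] ℝ :=
  (LinearMap.mk₂ ℝ (fun v w : E ↦ inner ℝ (frame x (pt x z) v) (frame x (pt x z) w))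
    (fun v v' w ↦ by rw [map_add, inner_add_left])
    (fun c v w ↦ by rw [map_smul, real_inner_smul_left, smul_eq_mul])
    (fun v w w' ↦ by rw [map_add, inner_add_right])
    (fun c v w ↦ by rw [map_smul, real_inner_smul_right, smul_eq_mul])).toContinuousBilinearMap

theorem metricCoeff_apply (x : M) (z v w : E) :
    metricCoeff x z v w = inner ℝ (frame x (pt x z) v) (frame x (pt x z) w) := rfl

theorem metricCoeff_symm (x : M) (z v w : E) : metricCoeff x z v w = metricCoeff x z w v := by
  rw [metricCoeff_apply, metricCoeff_apply, real_inner_comm]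

theorem inner_frame {x y : M} (hy : y ∈ (chartAt E x).source) (v w : E) :
    inner ℝ (frame x y v) (frame x y w) = metricCoeff x (coord x y) v w := by
  rw [metricCoeff_apply, pt_coord hy]

/-- Positive definiteness gives injectivity, and E and its dual have equal dimension. -/
theorem isInvertible_metricCoeff {x : M} {z : E} (hz : z ∈ (extChartAt 𝓘(ℝ, E) x).target) :
    (metricCoeff x z).IsInvertible := by
  have hinj : Function.Injective (metricCoeff x z) := by
    rw [injective_iff_map_eq_zero]
    intro v hv
    have h1 : metricCoeff x z v v = 0 := by rw [hv]; rfl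
    rw [metricCoeff_apply, inner_self_eq_zero] at h1
    rw [← coframe_frame (pt_mem hz) v, h1, map_zero]
  have hdim : Module.finrank ℝ E = Module.finrank ℝ (E →L[ℝ] ℝ) := by
    rw [← (LinearMap.toContinuousLinearMap (𝕜 := ℝ) (E := E) (F' := ℝ)).finrank_eq]
    exact (Subspace.dual_finrank_eq (K := ℝ) (V := E)).symm
  refine ⟨(LinearEquiv.ofInjectiveOfFinrankEq (metricCoeff x z : E →ₗ[ℝ] (E →L[ℝ] ℝ))
    hinj hdim).toContinuousLinearEquiv, ?_⟩
  ext v w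
  rfl

theorem metricCoeff_inverse {x : M} {z : E} (hz : z ∈ (extChartAt 𝓘(ℝ, E) x).target)
    (l : E →L[ℝ] ℝ) : metricCoeff x z ((metricCoeff x z).inverse l) = l :=
  (isInvertible_metricCoeff hz).self_apply_inverse l

theorem metricCoeff_ext {x : M} {z : E} (hz : z ∈ (extChartAt 𝓘(ℝ, E) x).target) {v w : E}
    (h : ∀ u, metricCoeff x z v u = metricCoeff x z w u) : v = w :=
  (isInvertible_metricCoeff hz).injective (ContinuousLinearMap.ext h)

/-- The Koszul form of the derivative `B` of a metric:
`w ↦ (B u (v, w) + B v (u, w) - B w (u, v)) / 2`. -/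
def koszulForm (B : E →L[ℝ] E →L[ℝ] E →L[ℝ] ℝ) (u v : E) : E →L[ℝ] ℝ :=
  (1 / 2 : ℝ) • (B u v + B v u - (B.flip u).flip v)

theorem koszulForm_apply (B : E →L[ℝ] E →L[ℝ] E →L[ℝ] ℝ) (u v w : E) :
    koszulForm B u v w = (B u v w + B v u w - B w u v) / 2 := by
  simp [koszulForm]; ring

/-- The Christoffel symbols in the chart at `x`, as a function of the coordinates. -/
def christoffelCoeff (x : M) (z : E) : E →L[ℝ] E →L[ℝ] E :=
  (LinearMap.mk₂ ℝ
    (fun u v : E ↦ (metricCoeff x z).inverse (koszulForm (fderiv ℝ (metricCoeff x) z) u v))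
    (fun u u' v ↦ by
      rw [← map_add]; congr 1; ext w
      simp only [_root_.add_apply, koszulForm_apply, map_add]; ring)
    (fun c u v ↦ by
      rw [← map_smul]; congr 1; ext w
      simp only [_root_.smul_apply, koszulForm_apply, map_smul, smul_eq_mul]; ring)
    (fun u v v' ↦ by
      rw [← map_add]; congr 1; ext w
      simp only [_root_.add_apply, koszulForm_apply, map_add]; ring)
    (fun c u v ↦ by
      rw [← map_smul]; congr 1; ext w
      simp only [_root_.smul_apply, koszulForm_apply, map_smul, smul_eq_mul]; ring)
    ).toContinuousBilinearMap

theorem christoffelCoeff_apply (x : M) (z u v : E) : christoffelCoeff x z u v =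
    (metricCoeff x z).inverse (koszulForm (fderiv ℝ (metricCoeff x) z) u v) := rfl

theorem metricCoeff_christoffelCoeff {x : M} {z : E} (hz : z ∈ (extChartAt 𝓘(ℝ, E) x).target)
    (u v w : E) : metricCoeff x z (christoffelCoeff x z u v) w =
      koszulForm (fderiv ℝ (metricCoeff x) z) u v w := by
  rw [christoffelCoeff_apply, metricCoeff_inverse hz]

variable [IsContMDiffRiemannianBundle 𝓘(ℝ, E) ∞ E (fun x : M ↦ TangentSpace 𝓘(ℝ, E) x)]

theorem contDiffOn_metricCoeff (x : M) :
    ContDiffOn ℝ ∞ (metricCoeff x) (extChartAt 𝓘(ℝ, E) x).target := by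
  rw [contDiffOn_clm_apply]
  intro v
  rw [contDiffOn_clm_apply]
  intro w z hz
  have h1 : ContMDiffAt 𝓘(ℝ, E) 𝓘(ℝ, ℝ) ∞
      (fun y ↦ inner ℝ (frame x y v) (frame x y w)) (pt x z) :=
    ContMDiffAt.inner_bundle (F := E) (E := fun y : M ↦ TangentSpace 𝓘(ℝ, E) y)
      (b := fun y ↦ y) (IB := 𝓘(ℝ, E)) (contMDiffAt_frame (pt_mem hz) v)
      (contMDiffAt_frame (pt_mem hz) w)
  exact (contMDiffAt_iff_contDiffAt.1 (h1.comp z (contMDiffAt_pt hz))).contDiffWithinAt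

theorem contDiffAt_metricCoeff {x : M} {z : E} (hz : z ∈ (extChartAt 𝓘(ℝ, E) x).target) :
    ContDiffAt ℝ ∞ (metricCoeff x) z :=
  (contDiffOn_metricCoeff x).contDiffAt ((isOpen_coordRange x).mem_nhds hz)

theorem fderiv_metricCoeff_symm {x : M} {z : E} (hz : z ∈ (extChartAt 𝓘(ℝ, E) x).target)
    (u v w : E) :
    fderiv ℝ (metricCoeff x) z u v w = fderiv ℝ (metricCoeff x) z u w v := by
  have hd : DifferentiableAt ℝ (metricCoeff x) z :=
    (contDiffAt_metricCoeff hz).differentiableAt (by simp)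
  have h (v w : E) : HasFDerivAt (fun z ↦ metricCoeff x z v w)
      (((fderiv ℝ (metricCoeff x) z).flip v).flip w) z := by
    have h1 := (hd.hasFDerivAt.clm_apply (hasFDerivAt_const v z)).clm_apply (hasFDerivAt_const w z)
    refine h1.congr_fderiv ?_
    ext u; simp
  have h2 := (h v w).unique (by simpa only [metricCoeff_symm x _ v w] using h w v)
  simpa using congr($h2 u)

theorem contDiffOn_christoffelCoeff (x : M) :
    ContDiffOn ℝ ∞ (christoffelCoeff x) (extChartAt 𝓘(ℝ, E) x).target := by
  have := FiniteDimensional.complete ℝ E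
  have hfd : ContDiffOn ℝ ∞ (fderiv ℝ (metricCoeff x)) (extChartAt 𝓘(ℝ, E) x).target :=
    (contDiffOn_metricCoeff x).fderiv_of_isOpen (isOpen_coordRange x) (by simp)
  rw [contDiffOn_clm_apply]
  intro u
  rw [contDiffOn_clm_apply]
  intro v
  refine ContDiffOn.clm_apply (f := fun z ↦ (metricCoeff x z).inverse) ?_ ?_
  · intro z hz
    exact ((isInvertible_metricCoeff hz).contDiffAt_map_inverse).comp_contDiffWithinAt z
      (contDiffOn_metricCoeff x z hz)
  · rw [contDiffOn_clm_apply]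
    intro w
    simp only [koszulForm_apply]
    have h (a b c : E) : ContDiffOn ℝ ∞ (fun z ↦ fderiv ℝ (metricCoeff x) z a b c)
        (extChartAt 𝓘(ℝ, E) x).target :=
      ((hfd.clm_apply contDiffOn_const).clm_apply contDiffOn_const).clm_apply contDiffOn_const
    exact (((h u v w).add (h v u w)).sub (h w u v)).div_const 2

theorem differentiableAt_christoffelCoeff {x : M} {z : E}
    (hz : z ∈ (extChartAt 𝓘(ℝ, E) x).target) : DifferentiableAt ℝ (christoffelCoeff x) z :=
  ((contDiffOn_christoffelCoeff x).contDiffAt ((isOpen_coordRange x).mem_nhds hz)).differentiableAt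
    (by simp)

theorem christoffelCoeff_symm {x : M} {z : E} (hz : z ∈ (extChartAt 𝓘(ℝ, E) x).target)
    (u v : E) : christoffelCoeff x z u v = christoffelCoeff x z v u := by
  refine metricCoeff_ext hz fun w ↦ ?_
  rw [metricCoeff_christoffelCoeff hz, metricCoeff_christoffelCoeff hz, koszulForm_apply,
    koszulForm_apply, fderiv_metricCoeff_symm hz w u v]
  ring

/-- Metric compatibility in coordinates: in the sum of the two Koszul forms everything except the
derivative in the direction u cancels by symmetry. -/
theorem fderiv_metricCoeff {x : M} {z : E} (hz : z ∈ (extChartAt 𝓘(ℝ, E) x).target)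
    (u v w : E) : fderiv ℝ (metricCoeff x) z u v w =
      metricCoeff x z (christoffelCoeff x z u v) w +
      metricCoeff x z v (christoffelCoeff x z u w) := by
  rw [metricCoeff_symm x z v, metricCoeff_christoffelCoeff hz, metricCoeff_christoffelCoeff hz,
    koszulForm_apply, koszulForm_apply, fderiv_metricCoeff_symm hz w u v,
    fderiv_metricCoeff_symm hz u w v]
  ring

/-- `leviCivita` at y is defined through the chart centred at y, so its symbols in another chart
cannot be read off. They are identified by uniqueness instead: vanishing torsion makes L symmetric,
compatibility expresses the derivative of the metric through L, and the Koszul formula then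
determines L. -/
theorem leviCivita_frame {x y : M} (hy : y ∈ (chartAt E x).source) (u v : E) :
    leviCivita (fun y ↦ frame x y v) y (frame x y u) =
      frame x y (christoffelCoeff x (coord x y) u v) := by
  have hz := coord_mem hy
  set L : E → E → E := fun u v ↦ coframe x y (leviCivita (fun y ↦ frame x y v) y (frame x y u))
    with hL
  have hLf (u v : E) : leviCivita (fun y ↦ frame x y v) y (frame x y u) = frame x y (L u v) :=
    (frame_coframe hy _).symm
  have hsymm (u v : E) : L u v = L v u := by
    have h := CovariantDerivative.torsion_apply (leviCivita (E := E) (M := M))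
      (mdifferentiableAt_frame hy u) (mdifferentiableAt_frame hy v)
    rw [leviCivita_torsion_eq_zero, mlieBracket_frame hy] at h
    have h' : leviCivita (fun y ↦ frame x y v) y (frame x y u) =
        leviCivita (fun y ↦ frame x y u) y (frame x y v) := by
      rw [eq_comm, ← sub_eq_zero]
      have h0 : (0 : TangentSpace 𝓘(ℝ, E) y) = _ := h
      rw [sub_zero] at h0
      rw [← neg_sub, ← h0, neg_zero]
    simp only [hL, h']
  have hcompat (u v w : E) : fderiv ℝ (metricCoeff x) (coord x y) u v w =
      metricCoeff x (coord x y) (L u v) w + metricCoeff x (coord x y) v (L u w) := by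
    have h := leviCivita_isMetricCompatible.mvfderiv_inner_eq (fun y ↦ frame x y u)
      (mdifferentiableAt_frame hy v) (mdifferentiableAt_frame hy w)
    have h' : mvfderiv 𝓘(ℝ, E) (fun y ↦ inner ℝ (frame x y v) (frame x y w)) y (frame x y u) =
      inner ℝ (frame x y (L u v)) (frame x y w) +
      inner ℝ (frame x y v) (frame x y (L u w)) := by rw [← hLf, ← hLf]; exact h
    rw [inner_frame hy, inner_frame hy] at h'
    rw [← h']
    have h1 : (fun y ↦ inner ℝ (frame x y v) (frame x y w)) =ᶠ[𝓝 y]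
        (fun z ↦ metricCoeff x z v w) ∘ fun y ↦ (coord x y : E) := by
      filter_upwards [source_mem_nhds hy] with y' hy'
      exact inner_frame hy' v w
    have hd : DifferentiableAt ℝ (metricCoeff x) (coord x y) :=
      (contDiffAt_metricCoeff hz).differentiableAt (by simp)
    have h2 := (hd.hasFDerivAt.clm_apply (hasFDerivAt_const v (coord x y))).clm_apply
      (hasFDerivAt_const w (coord x y))
    have h3 := mfderiv_comp_apply y h2.differentiableAt.mdifferentiableAt
      ((contMDiffAt_coord hy).mdifferentiableAt (by simp)) (frame x y u)
    have h4 : mfderiv 𝓘(ℝ, E) 𝓘(ℝ, E) (fun y ↦ (coord x y : E)) y (frame x y u) = u := by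
      have := congr($(coframe_eq_mfderiv hy) (frame x y u))
      exact this.symm.trans (coframe_frame hy u)
    rw [h4, mfderiv_eq_fderiv, h2.fderiv, ← h1.mfderiv_eq] at h3
    refine Eq.trans ?_ h3.symm
    simp only [ContinuousLinearMap.comp_zero, zero_add]
    rfl
  rw [hLf]
  congr 1
  refine metricCoeff_ext hz fun w ↦ ?_
  rw [metricCoeff_christoffelCoeff hz, koszulForm_apply, hcompat u v w, hcompat v u w,
    hcompat w u v, hsymm v u, hsymm w u, hsymm w v, metricCoeff_symm x _ (L u w) v]
  ring

end Christoffel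

/-! ## Covariant derivatives in a chart -/

section CovariantDerivative

variable {E : Type*} [NormedAddCommGroup E] [NormedSpace ℝ E] [FiniteDimensional ℝ E]
  {M : Type*} [TopologicalSpace M] [ChartedSpace E M] [IsManifold 𝓘(ℝ, E) ∞ M]
  [RiemannianBundle (fun x : M ↦ TangentSpace 𝓘(ℝ, E) x)]
  [IsContMDiffRiemannianBundle 𝓘(ℝ, E) ∞ E (fun x : M ↦ TangentSpace 𝓘(ℝ, E) x)]

-- Passing from the chart at x to the chart at γ t multiplies components by a transition map; T' is
-- its derivative along γ. The point is that T' depends on γ alone and so serves all fields V at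
-- once.
omit [RiemannianBundle (fun x : M ↦ TangentSpace 𝓘(ℝ, E) x)]
  [IsContMDiffRiemannianBundle 𝓘(ℝ, E) ∞ E (fun x : M ↦ TangentSpace 𝓘(ℝ, E) x)] in
theorem exists_hasDerivAt_trivialization {x : M} {γ : ℝ → M} {t : ℝ}
    (hγ : MDifferentiableAt 𝓘(ℝ, ℝ) 𝓘(ℝ, E) γ t) (hx : γ t ∈ (chartAt E x).source) :
    ∃ T' : E →L[ℝ] E, ∀ (V : ∀ t, TangentSpace 𝓘(ℝ, E) (γ t)) (v' : E),
      HasDerivAt (fun r ↦ coframe x (γ r) (V r)) v' t →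
      HasDerivAt (fun s ↦ (trivializationAt E (TangentSpace 𝓘(ℝ, E)) (γ t) ⟨γ s, V s⟩).2)
        (T' (coframe x (γ t) (V t)) + coframe (γ t) (γ t) (frame x (γ t) v')) t := by
  set e := trivializationAt E (TangentSpace 𝓘(ℝ, E)) x
  set e' := trivializationAt E (TangentSpace 𝓘(ℝ, E)) (γ t)
  have hp : γ t ∈ (chartAt E (γ t)).source := mem_chart_source E (γ t)
  let T : M → E →L[ℝ] E := fun b ↦ (e.coordChangeL ℝ e' b : E →L[ℝ] E)
  have hT (b : M) (hb : b ∈ (chartAt E x).source) (hb' : b ∈ (chartAt E (γ t)).source)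
      (v : E) : coframe (γ t) b (frame x b v) = T b v := by
    rw [coframe_apply hb']
    rw [frame, Trivialization.symmL_apply _ hb]
    exact (e.coordChangeL_apply (R := ℝ) e' ⟨hb, hb'⟩ v).symm
  have hTd : MDifferentiableAt 𝓘(ℝ, E) 𝓘(ℝ, E →L[ℝ] E) T (γ t) := by
    refine (mdifferentiableOn_coordChangeL (IB := 𝓘(ℝ, E)) e e').mdifferentiableAt ?_
    exact (e.open_baseSet.inter e'.open_baseSet).mem_nhds ⟨hx, hp⟩
  have hTγ : DifferentiableAt ℝ (T ∘ γ) t :=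
    mdifferentiableAt_iff_differentiableAt.1 (hTd.comp t hγ)
  refine ⟨deriv (T ∘ γ) t, fun V v' hv ↦ ?_⟩
  have h1 := hTγ.hasDerivAt.clm_apply hv
  rw [hT _ hx hp]
  refine h1.congr_of_eventuallyEq ?_
  filter_upwards [hγ.continuousAt (source_mem_nhds hx), hγ.continuousAt (source_mem_nhds hp)]
    with r hr hr'
  rw [Function.comp_apply, ← hT _ hr hr', frame_coframe hr, coframe_apply hr']

/-- Apart from the term v', the covariant derivative depends on V only through its value at t. That
remaining term can be computed on the frame field with the same value, where `leviCivita_frame`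
applies. The transformation law of Christoffel symbols is thus never written out. -/
theorem covDerivAlong_eq_frame {x : M} {γ : ℝ → M} {t : ℝ}
    (hγ : MDifferentiableAt 𝓘(ℝ, ℝ) 𝓘(ℝ, E) γ t) (hx : γ t ∈ (chartAt E x).source)
    {V : ∀ t, TangentSpace 𝓘(ℝ, E) (γ t)} {v' : E}
    (hv : HasDerivAt (fun r ↦ coframe x (γ r) (V r)) v' t) :
    covDerivAlong γ V t = frame x (γ t) (v' + christoffelCoeff x (coord x (γ t))
      (deriv (fun s ↦ (coord x (γ s) : E)) t) (coframe x (γ t) (V t))) := by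
  obtain ⟨T', hT'⟩ := exists_hasDerivAt_trivialization hγ hx
  set v₀ := coframe x (γ t) (V t) with hv₀
  have hV₀ : HasDerivAt (fun r ↦ coframe x (γ r) (frame x (γ r) v₀)) 0 t := by
    refine (hasDerivAt_const t v₀).congr_of_eventuallyEq ?_
    filter_upwards [hγ.continuousAt (source_mem_nhds hx)] with r hr
    exact coframe_frame hr v₀
  have h1 := (hT' V v' hv).deriv
  have h2 := (hT' (fun r ↦ frame x (γ r) v₀) 0 hV₀).deriv
  have h3 := covDerivAlong_comp hγ (mdifferentiableAt_frame hx v₀)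
  rw [velocity_eq_frame hγ hx, leviCivita_frame hx] at h3
  rw [covDerivAlong, h2, coframe_frame hx, map_zero, map_zero, add_zero] at h3
  rw [covDerivAlong, h1, map_add, map_add, ← h3, ← hv₀, hv₀, frame_coframe hx]
  have h4 : (trivializationAt E (TangentSpace 𝓘(ℝ, E)) (γ t)).symmL ℝ (γ t)
      (coframe (γ t) (γ t) (frame x (γ t) v')) = frame x (γ t) v' :=
    frame_coframe (mem_chart_source E (γ t)) _
  rw [h4]
  abel

/-- Restricting σ to the coordinate line through y in direction u reduces this to the formula for
derivatives along curves. -/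
theorem leviCivita_eq_frame {x y : M} (hy : y ∈ (chartAt E x).source)
    {σ : ∀ y : M, TangentSpace 𝓘(ℝ, E) y} (hσ : DifferentiableAt ℝ (rep x σ) (coord x y))
    (u : E) :
    leviCivita σ y (frame x y u) = frame x y (fderiv ℝ (rep x σ) (coord x y) u +
      christoffelCoeff x (coord x y) u (rep x σ (coord x y))) := by
  have hz := coord_mem hy
  let γ : ℝ → M := fun r ↦ pt x (coord x y + r • u)
  have hγ0 : γ 0 = y := by simp only [γ, zero_smul, add_zero, pt_coord hy]
  have hline : HasDerivAt (fun r : ℝ ↦ (coord x y : E) + r • u) u 0 := by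
    simpa using ((hasDerivAt_id (0 : ℝ)).smul_const u).const_add (coord x y : E)
  have hγ : MDifferentiableAt 𝓘(ℝ, ℝ) 𝓘(ℝ, E) γ 0 := by
    refine MDifferentiableAt.comp (0 : ℝ) (g := pt x) ?_ hline.differentiableAt.mdifferentiableAt
    refine (contMDiffAt_pt ?_).mdifferentiableAt (by simp)
    simpa using hz
  have hev : ∀ᶠ r in 𝓝 (0 : ℝ), (coord x y : E) + r • u ∈ (extChartAt 𝓘(ℝ, E) x).target := by
    refine hline.continuousAt ((isOpen_coordRange x).mem_nhds ?_)
    simpa using hz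
  have hco : (fun r ↦ (coord x (γ r) : E)) =ᶠ[𝓝 0] fun r ↦ (coord x y : E) + r • u := by
    filter_upwards [hev] with r hr
    exact coord_pt hr
  have hx : γ 0 ∈ (chartAt E x).source := by rwa [hγ0]
  have hv : HasDerivAt (fun r ↦ coframe x (γ r) (σ (γ r)))
      (fderiv ℝ (rep x σ) (coord x y) u) 0 := by
    have h1 : HasFDerivAt (rep x σ) (fderiv ℝ (rep x σ) (coord x y))
        ((coord x y : E) + (0 : ℝ) • u) := by simpa using hσ.hasFDerivAt
    exact h1.comp_hasDerivAt 0 hline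
  have h := covDerivAlong_eq_frame hγ hx (V := fun r ↦ σ (γ r)) hv
  rw [covDerivAlong_comp hγ (mdifferentiableAt_section_of_rep hx (by rwa [hγ0])),
    velocity_eq_frame hγ hx, hco.deriv_eq, hline.deriv] at h
  rw [rep_coord hy]
  exact hγ0 ▸ h

omit [IsContMDiffRiemannianBundle 𝓘(ℝ, E) ∞ E (fun x : M ↦ TangentSpace 𝓘(ℝ, E) x)] in
theorem inner_frame_left {x y : M} (hy : y ∈ (chartAt E x).source) (v : E)
    (w : TangentSpace 𝓘(ℝ, E) y) :
    inner ℝ (frame x y v) w = metricCoeff x (coord x y) v (coframe x y w) := by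
  rw [← inner_frame hy, frame_coframe hy]

omit [IsContMDiffRiemannianBundle 𝓘(ℝ, E) ∞ E (fun x : M ↦ TangentSpace 𝓘(ℝ, E) x)] in
theorem inner_frame_right {x y : M} (hy : y ∈ (chartAt E x).source) (v : TangentSpace 𝓘(ℝ, E) y)
    (w : E) : inner ℝ v (frame x y w) = metricCoeff x (coord x y) (coframe x y v) w := by
  rw [← inner_frame hy, frame_coframe hy]

/-- Covariant differentiation along a curve is compatible with the metric. -/
theorem hasDerivAt_inner_along {x : M} {γ : ℝ → M} {t : ℝ}
    (hγ : MDifferentiableAt 𝓘(ℝ, ℝ) 𝓘(ℝ, E) γ t) (hx : γ t ∈ (chartAt E x).source)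
    {V W : ∀ t, TangentSpace 𝓘(ℝ, E) (γ t)} {v' w' : E}
    (hv : HasDerivAt (fun r ↦ coframe x (γ r) (V r)) v' t)
    (hw : HasDerivAt (fun r ↦ coframe x (γ r) (W r)) w' t) :
    HasDerivAt (fun r ↦ (inner ℝ (V r) (W r) : ℝ))
      (inner ℝ (covDerivAlong γ V t) (W t) + inner ℝ (V t) (covDerivAlong γ W t)) t := by
  have hz := coord_mem hx
  have hc : HasDerivAt (fun r ↦ (coord x (γ r) : E)) (deriv (fun s ↦ (coord x (γ s) : E)) t) t := by
    refine DifferentiableAt.hasDerivAt (mdifferentiableAt_iff_differentiableAt.1 ?_)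
    exact ((contMDiffAt_coord hx).mdifferentiableAt (by simp)).comp t hγ
  have hg : HasFDerivAt (metricCoeff x) (fderiv ℝ (metricCoeff x) (coord x (γ t)))
      (coord x (γ t)) :=
    ((contDiffAt_metricCoeff hz).differentiableAt (by simp)).hasFDerivAt
  have h1 := ((hg.comp_hasDerivAt t hc).clm_apply hv).clm_apply hw
  have h2 : (fun r ↦ (inner ℝ (V r) (W r) : ℝ)) =ᶠ[𝓝 t] fun r ↦ metricCoeff x (coord x (γ r))
      (coframe x (γ r) (V r)) (coframe x (γ r) (W r)) := by
    filter_upwards [hγ.continuousAt (source_mem_nhds hx)] with r hr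
    rw [← inner_frame hr, frame_coframe hr, frame_coframe hr]
  refine (h1.congr_of_eventuallyEq h2).congr_deriv ?_
  rw [covDerivAlong_eq_frame hγ hx hv, covDerivAlong_eq_frame hγ hx hw]
  rw [inner_frame_left hx, inner_frame_right hx]
  simp only [_root_.add_apply, map_add, Function.comp_apply, fderiv_metricCoeff hz]
  ring

end CovariantDerivative

/-! ## Second covariant derivative, curvature and gradient in a chart -/

section SecondOrder

variable {E : Type*} [NormedAddCommGroup E] [NormedSpace ℝ E] [FiniteDimensional ℝ E]
  {M : Type*} [TopologicalSpace M] [ChartedSpace E M] [IsManifold 𝓘(ℝ, E) ∞ M]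
  [RiemannianBundle (fun x : M ↦ TangentSpace 𝓘(ℝ, E) x)]
  [IsContMDiffRiemannianBundle 𝓘(ℝ, E) ∞ E (fun x : M ↦ TangentSpace 𝓘(ℝ, E) x)]

theorem hasFDerivAt_rep_leviCivita {x y : M} (hy : y ∈ (chartAt E x).source)
    {V : ∀ y : M, TangentSpace 𝓘(ℝ, E) y} (hV : ContDiffAt ℝ 2 (rep x V) (coord x y)) (w : E) :
    HasFDerivAt (rep x (fun y ↦ leviCivita V y (frame x y w)))
      ((fderiv ℝ (fderiv ℝ (rep x V)) (coord x y)).flip w +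
        (christoffelCoeff x (coord x y) w ∘L fderiv ℝ (rep x V) (coord x y) +
          ((fderiv ℝ (christoffelCoeff x) (coord x y)).flip w).flip (rep x V (coord x y))))
      (coord x y) := by
  have hz := coord_mem hy
  have hev : ∀ᶠ z in 𝓝 (coord x y : E), ContDiffAt ℝ 2 (rep x V) z := hV.eventually (by simp)
  have h1 : rep x (fun y ↦ leviCivita V y (frame x y w)) =ᶠ[𝓝 (coord x y)]
      fun z ↦ fderiv ℝ (rep x V) z w + christoffelCoeff x z w (rep x V z) := by
    filter_upwards [hev, (isOpen_coordRange x).mem_nhds hz] with z hVz hz'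
    have hd := hVz.differentiableAt (by simp)
    rw [← coord_pt hz'] at hd
    rw [rep, leviCivita_eq_frame (pt_mem hz') hd, coframe_frame (pt_mem hz'), coord_pt hz']
  have hd1 : HasFDerivAt (fderiv ℝ (rep x V)) (fderiv ℝ (fderiv ℝ (rep x V)) (coord x y))
      (coord x y) :=
    ((hV.fderiv_right (m := 1) (by norm_num)).differentiableAt (by simp)).hasFDerivAt
  have hd2 := (hV.differentiableAt (by simp)).hasFDerivAt
  have hd3 := (differentiableAt_christoffelCoeff hz).hasFDerivAt
  have h2 := (hd1.clm_apply (hasFDerivAt_const w _)).add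
    ((hd3.clm_apply (hasFDerivAt_const w _)).clm_apply hd2)
  refine (h2.congr_of_eventuallyEq h1).congr_fderiv ?_
  simp only [ContinuousLinearMap.comp_zero, zero_add]

theorem leviCivita_leviCivita {x y : M} (hy : y ∈ (chartAt E x).source)
    {V : ∀ y : M, TangentSpace 𝓘(ℝ, E) y} (hV : ContDiffAt ℝ 2 (rep x V) (coord x y)) (u w : E) :
    leviCivita (fun y ↦ leviCivita V y (frame x y w)) y (frame x y u) =
      frame x y (fderiv ℝ (fderiv ℝ (rep x V)) (coord x y) u w +
        (christoffelCoeff x (coord x y) w (fderiv ℝ (rep x V) (coord x y) u) +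
          fderiv ℝ (christoffelCoeff x) (coord x y) u w (rep x V (coord x y))) +
        christoffelCoeff x (coord x y) u (fderiv ℝ (rep x V) (coord x y) w +
          christoffelCoeff x (coord x y) w (rep x V (coord x y)))) := by
  have h := hasFDerivAt_rep_leviCivita hy hV w
  rw [leviCivita_eq_frame hy h.differentiableAt, h.fderiv,
    rep_coord hy (fun y ↦ leviCivita V y (frame x y w)),
    leviCivita_eq_frame hy (hV.differentiableAt (by simp)), coframe_frame hy]
  rfl

omit [IsContMDiffRiemannianBundle 𝓘(ℝ, E) ∞ E (fun x : M ↦ TangentSpace 𝓘(ℝ, E) x)] in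
theorem chartExtend_frame (x : M) (w : E) :
    (chartExtend x (frame x x w)) = fun y ↦ frame x y w := by
  ext y
  rw [chartExtend_eq_frame, coframe_frame (mem_chart_source E x)]

/-- Restricted to the centre of the chart because the extension `chartExtend` in the definition is
taken in the chart centred at the point itself. -/
theorem secondCovDeriv_frame (x : M)
    {V : ∀ y : M, TangentSpace 𝓘(ℝ, E) y} (hV : ContDiffAt ℝ 2 (rep x V) (coord x x)) (u w : E) :
    secondCovDeriv V x (frame x x u) (frame x x w) =
      frame x x (fderiv ℝ (fderiv ℝ (rep x V)) (coord x x) u w +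
        (christoffelCoeff x (coord x x) w (fderiv ℝ (rep x V) (coord x x) u) +
          fderiv ℝ (christoffelCoeff x) (coord x x) u w (rep x V (coord x x))) +
        christoffelCoeff x (coord x x) u (fderiv ℝ (rep x V) (coord x x) w +
          christoffelCoeff x (coord x x) w (rep x V (coord x x))) -
        (fderiv ℝ (rep x V) (coord x x) (christoffelCoeff x (coord x x) u w) +
          christoffelCoeff x (coord x x) (christoffelCoeff x (coord x x) u w)
            (rep x V (coord x x)))) := by
  have hx := mem_chart_source E x
  rw [secondCovDeriv, chartExtend_frame, leviCivita_leviCivita hx hV, leviCivita_frame hx,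
    leviCivita_eq_frame hx (hV.differentiableAt (by simp)), ← map_sub]

omit [RiemannianBundle (fun x : M ↦ TangentSpace 𝓘(ℝ, E) x)]
  [IsContMDiffRiemannianBundle 𝓘(ℝ, E) ∞ E (fun x : M ↦ TangentSpace 𝓘(ℝ, E) x)] in
theorem rep_frame_eventuallyEq {x y : M} (hy : y ∈ (chartAt E x).source) (w : E) :
    rep x (fun y ↦ frame x y w) =ᶠ[𝓝 (coord x y)] fun _ ↦ w := by
  filter_upwards [coordRange_mem_nhds hy] with z hz
  exact rep_frame x w hz

theorem curvature_frame (x : M) (u v w : E) :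
    curvature x (frame x x u) (frame x x v) (frame x x w) =
      frame x x (fderiv ℝ (christoffelCoeff x) (coord x x) u v w +
        christoffelCoeff x (coord x x) u (christoffelCoeff x (coord x x) v w) -
        (fderiv ℝ (christoffelCoeff x) (coord x x) v u w +
          christoffelCoeff x (coord x x) v (christoffelCoeff x (coord x x) u w))) := by
  have hx := mem_chart_source E x
  have hc := rep_frame_eventuallyEq hx w
  have hW : ContDiffAt ℝ 2 (rep x (fun y ↦ frame x y w)) (coord x x) :=
    contDiffAt_const.congr_of_eventuallyEq hc
  have h1 : fderiv ℝ (rep x (fun y ↦ frame x y w)) =ᶠ[𝓝 (coord x x)] fun _ ↦ 0 := by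
    filter_upwards [hc.fderiv (𝕜 := ℝ)] with z hz
    rw [hz]; simp
  rw [curvature, mlieBracket_chartExtend, map_zero, sub_zero, chartExtend_frame, chartExtend_frame,
    chartExtend_frame, leviCivita_leviCivita hx hW, leviCivita_leviCivita hx hW, ← map_sub,
    h1.fderiv_eq, h1.eq_of_nhds, hc.eq_of_nhds]
  simp

theorem fderiv_christoffelCoeff_symm {x : M} {z : E} (hz : z ∈ (extChartAt 𝓘(ℝ, E) x).target)
    (u v w : E) :
    fderiv ℝ (christoffelCoeff x) z u v w = fderiv ℝ (christoffelCoeff x) z u w v := by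
  have h (v w : E) : HasFDerivAt (fun z ↦ christoffelCoeff x z v w)
      (((fderiv ℝ (christoffelCoeff x) z).flip v).flip w) z := by
    have h1 := ((differentiableAt_christoffelCoeff hz).hasFDerivAt.clm_apply
      (hasFDerivAt_const v z)).clm_apply (hasFDerivAt_const w z)
    refine h1.congr_fderiv ?_
    ext u; simp
  have h2 : (fun z ↦ christoffelCoeff x z v w) =ᶠ[𝓝 z] fun z ↦ christoffelCoeff x z w v := by
    filter_upwards [(isOpen_coordRange x).mem_nhds hz] with z hz
    exact christoffelCoeff_symm hz v w
  have h3 := (h v w).unique ((h w v).congr_of_eventuallyEq h2)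
  exact congr($h3 u)

/-- The right hand side of the equation of the covariant acceleration of a variation through
integral curves of `V`, in the chart at `x`. -/
theorem variation_frame (x : M) {V : ∀ y : M, TangentSpace 𝓘(ℝ, E) y}
    (hV : ContDiffAt ℝ 2 (rep x V) (coord x x)) (s a : E) :
    secondCovDeriv V x (frame x x s) (frame x x s) +
      leviCivita V x (frame x x (a + christoffelCoeff x (coord x x) s s)) +
      curvature x (V x) (frame x x s) (frame x x s) =
    frame x x (fderiv ℝ (fderiv ℝ (rep x V)) (coord x x) s s + fderiv ℝ (rep x V) (coord x x) a +
      (fderiv ℝ (christoffelCoeff x) (coord x x) (rep x V (coord x x)) s s +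
      christoffelCoeff x (coord x x) (fderiv ℝ (rep x V) (coord x x) s) s +
      christoffelCoeff x (coord x x) s (fderiv ℝ (rep x V) (coord x x) s)) +
      christoffelCoeff x (coord x x) (rep x V (coord x x))
        (a + christoffelCoeff x (coord x x) s s)) := by
  have hx := mem_chart_source E x
  have hz : (coord x x : E) ∈ (extChartAt 𝓘(ℝ, E) x).target := coord_mem hx
  rw [secondCovDeriv_frame x hV, leviCivita_eq_frame hx (hV.differentiableAt (by simp)),
    ← frame_rep hx V, curvature_frame, ← map_add, ← map_add]
  congr 1
  -- After these symmetries the terms ∂_sΓ(s, V) and Γ(s, Γ(s, V)) of ∇²V cancel against the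
  -- subtracted half of the curvature, and Γ(Γ(s, s), V) cancels between ∇²V and ∇V.
  rw [fderiv_christoffelCoeff_symm hz s s, christoffelCoeff_symm hz (fderiv ℝ (rep x V) _ s) s,
    christoffelCoeff_symm hz (a + _) (rep x V (coord x x)),
    christoffelCoeff_symm hz (christoffelCoeff x (coord x x) s s) (rep x V (coord x x)),
    christoffelCoeff_symm hz (rep x V (coord x x)) s]
  simp only [map_add]
  abel

theorem inner_grad (g : M → ℝ) (y : M) (u : TangentSpace 𝓘(ℝ, E) y) :
    inner ℝ (grad E g y) u = mvfderiv 𝓘(ℝ, E) g y u := by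
  rw [grad, InnerProductSpace.toDual_symm_apply]

/-- In coordinates the gradient is the inverse metric applied to the differential, so exactly one
derivative is lost. -/
theorem contDiffAt_rep_grad {x y : M} (hy : y ∈ (chartAt E x).source) {g : M → ℝ}
    (hg : ContMDiff 𝓘(ℝ, E) 𝓘(ℝ, ℝ) 2 g) : ContDiffAt ℝ 1 (rep x (grad E g)) (coord x y) := by
  have := FiniteDimensional.complete ℝ E
  have hz := coord_mem hy
  have hg' {z : E} (hz : z ∈ (extChartAt 𝓘(ℝ, E) x).target) :
      ContDiffAt ℝ 2 (fun z ↦ g (pt x z)) z :=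
    contMDiffAt_iff_contDiffAt.1 ((hg (pt x z)).comp z ((contMDiffAt_pt hz).of_le two_le_infty))
  have h1 : rep x (grad E g) =ᶠ[𝓝 (coord x y)]
      fun z ↦ (metricCoeff x z).inverse (fderiv ℝ (fun z ↦ g (pt x z)) z) := by
    filter_upwards [(isOpen_coordRange x).mem_nhds hz] with z hz
    refine metricCoeff_ext hz fun w ↦ ?_
    have h2 := inner_frame_right (pt_mem hz) (grad E g (pt x z)) w
    rw [coord_pt hz] at h2
    rw [metricCoeff_inverse hz, rep, ← h2, inner_grad, ← mfderiv_pt hz]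
    have h3 := mfderiv_comp_apply z ((hg (pt x z)).mdifferentiableAt (by simp))
      ((contMDiffAt_pt hz).mdifferentiableAt (by simp)) w
    rw [mfderiv_eq_fderiv] at h3
    exact h3.symm
  refine ContDiffAt.congr_of_eventuallyEq ?_ h1
  refine ContDiffAt.clm_apply ?_ ((hg' hz).fderiv_right (m := 1) (by norm_num))
  exact ((isInvertible_metricCoeff hz).contDiffAt_map_inverse).comp _
    ((contDiffAt_metricCoeff hz).of_le (by simp))

end SecondOrder

/-! ## Integral curves -/

section IntegralCurves

/-- A function which is `C²` at a point agrees near this point with a bounded `C²` function. -/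
theorem exists_contDiff_eventuallyEq {E F : Type*} [NormedAddCommGroup E] [NormedSpace ℝ E]
    [FiniteDimensional ℝ E] [NormedAddCommGroup F] [NormedSpace ℝ F] {f : E → F} {z₀ : E}
    (hf : ContDiffAt ℝ 2 f z₀) :
    ∃ g : E → F, ContDiff ℝ 2 g ∧ (∃ C, 0 < C ∧ ∀ z, ‖g z‖ ≤ C) ∧ g =ᶠ[𝓝 z₀] f := by
  have hev : ∀ᶠ z in 𝓝 z₀, ContDiffAt ℝ 2 f z := hf.eventually (by simp)
  obtain ⟨r, hr, hball⟩ := Metric.eventually_nhds_iff_ball.1 hev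
  let χ : ContDiffBump z₀ := ⟨r / 4, r / 2, by positivity, by linarith⟩
  have hg : ContDiff ℝ 2 (fun z ↦ χ z • f z) := by
    rw [contDiff_iff_contDiffAt]
    intro z
    by_cases hz : z ∈ Metric.ball z₀ r
    · exact χ.contDiffAt.smul (hball z hz)
    · have hz' : z ∉ tsupport χ := by
        rw [χ.tsupport_eq]
        intro h
        exact hz (Metric.closedBall_subset_ball (by change r / 2 < r; linarith) h)
      refine (contDiffAt_const (c := (0 : F))).congr_of_eventuallyEq ?_
      filter_upwards [(isClosed_tsupport χ).isOpen_compl.mem_nhds hz'] with w hw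
      rw [image_eq_zero_of_notMem_tsupport hw, zero_smul]
  refine ⟨_, hg, ?_, ?_⟩
  · obtain ⟨C, hC⟩ := (χ.hasCompactSupport.smul_right (f' := f)).exists_bound_of_continuous
      hg.continuous
    exact ⟨max C 1, by positivity, fun z ↦ (hC z).trans (le_max_left _ _)⟩
  · filter_upwards [χ.eventuallyEq_one] with z hz
    rw [hz]; simp

variable {E : Type*} [NormedAddCommGroup E] [NormedSpace ℝ E]

section

variable {M : Type*} [TopologicalSpace M] [ChartedSpace E M] [IsManifold 𝓘(ℝ, E) ∞ M]
  {V : ∀ y : M, TangentSpace 𝓘(ℝ, E) y}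

/-- The section `V` of the tangent bundle, as a map to the total space, is of class `C²`. -/
abbrev IsC2Field (V : ∀ y : M, TangentSpace 𝓘(ℝ, E) y) : Prop :=
  ContMDiff 𝓘(ℝ, E) 𝓘(ℝ, E).tangent 2 (fun y ↦ (⟨y, V y⟩ : TangentBundle 𝓘(ℝ, E) M))

theorem contDiffAt_rep (hV : IsC2Field V) {x y : M} (hy : y ∈ (chartAt E x).source) :
    ContDiffAt ℝ 2 (rep x V) (coord x y) :=
  (contMDiffAt_section_iff_rep two_le_infty hy).1 (hV y)

theorem hasDerivAt_coord {γ : ℝ → M} {t : ℝ} {v : TangentSpace 𝓘(ℝ, E) (γ t)}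
    (h : HasMFDerivAt 𝓘(ℝ, ℝ) 𝓘(ℝ, E) γ t ((1 : ℝ →L[ℝ] ℝ).smulRight v)) {x : M}
    (hx : γ t ∈ (chartAt E x).source) :
    HasDerivAt (fun s ↦ (coord x (γ s) : E)) (coframe x (γ t) v) t := by
  have h1 := HasMFDerivAt.comp t
    ((contMDiffAt_coord hx).mdifferentiableAt (by simp)).hasMFDerivAt h
  have h2 : HasFDerivAt (fun s ↦ (coord x (γ s) : E))
      ((coframe x (γ t) : TangentSpace 𝓘(ℝ, E) (γ t) →L[ℝ] E) ∘L
        (1 : ℝ →L[ℝ] ℝ).smulRight v) t := by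
    rw [coframe_eq_mfderiv hx]
    exact hasMFDerivAt_iff_hasFDerivAt.1 h1
  have h3 := h2.hasDerivAt
  rw [ContinuousLinearMap.comp_apply] at h3
  have h4 : ((1 : ℝ →L[ℝ] ℝ).smulRight v) 1 = v := one_smul ℝ v
  rwa [h4] at h3

theorem hasMFDerivAt_of_hasDerivAt {γ : ℝ → M} {t : ℝ} (hc : ContinuousAt γ t) {x : M}
    (hx : γ t ∈ (chartAt E x).source) {w : E}
    (h : HasDerivAt (fun s ↦ (coord x (γ s) : E)) w t) :
    HasMFDerivAt 𝓘(ℝ, ℝ) 𝓘(ℝ, E) γ t ((1 : ℝ →L[ℝ] ℝ).smulRight (frame x (γ t) w)) := by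
  have h0 : HasMFDerivAt 𝓘(ℝ, ℝ) 𝓘(ℝ, E) (fun s ↦ (coord x (γ s) : E)) t
      (ContinuousLinearMap.toSpanSingleton ℝ w : ℝ →L[ℝ] E) :=
    hasMFDerivAt_iff_hasFDerivAt.2 h.hasFDerivAt
  have h1 := HasMFDerivAt.comp t
    ((contMDiffAt_pt (coord_mem hx)).mdifferentiableAt (by simp)).hasMFDerivAt h0
  have h2 : γ =ᶠ[𝓝 t] (pt x ∘ fun s ↦ (coord x (γ s) : E)) := by
    filter_upwards [hc.eventually (source_mem_nhds hx)] with s hs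
    exact (pt_coord hs).symm
  have h3 := h1.congr_of_eventuallyEq h2
  refine (congrArg (HasMFDerivAt 𝓘(ℝ, ℝ) 𝓘(ℝ, E) γ t) ?_).mp h3
  have h4 := mfderiv_pt (coord_mem hx) w
  rw [pt_coord hx] at h4
  let D : E →L[ℝ] E := mfderiv 𝓘(ℝ, E) 𝓘(ℝ, E) (pt x) (coord x (γ t) : E)
  let w' : E := frame x (γ t) w
  have h5 : D ∘L ContinuousLinearMap.toSpanSingleton ℝ w = (1 : ℝ →L[ℝ] ℝ).smulRight w' := by
    refine ContinuousLinearMap.ext fun (r : ℝ) ↦ ?_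
    have h6 : D w = w' := h4
    simp [h6]
  exact h5

theorem velocity_eq {γ : ℝ → M} {t : ℝ} {v : TangentSpace 𝓘(ℝ, E) (γ t)}
    (h : HasMFDerivAt 𝓘(ℝ, ℝ) 𝓘(ℝ, E) γ t ((1 : ℝ →L[ℝ] ℝ).smulRight v)) :
    velocity γ t = v := by
  rw [velocity, h.mfderiv]
  exact one_smul ℝ v

theorem hasMFDerivAt_pt_comp {α : ℝ → E} {w : E} {t : ℝ} (h : HasDerivAt α w t) {x : M}
    (hx : α t ∈ (extChartAt 𝓘(ℝ, E) x).target) :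
    HasMFDerivAt 𝓘(ℝ, ℝ) 𝓘(ℝ, E) (fun s ↦ pt x (α s)) t
      ((1 : ℝ →L[ℝ] ℝ).smulRight (frame x (pt x (α t)) w)) := by
  have hc : ContinuousAt (fun s ↦ pt x (α s)) t :=
    ContinuousAt.comp (contMDiffAt_pt hx).continuousAt h.continuousAt
  refine hasMFDerivAt_of_hasDerivAt hc (pt_mem hx) (h.congr_of_eventuallyEq ?_)
  filter_upwards [h.continuousAt.eventually ((isOpen_coordRange x).mem_nhds hx)] with s hs
  exact coord_pt hs

theorem IsC2Field.continuousAt_rep (hV : IsC2Field V) {x y : M} (hy : y ∈ (chartAt E x).source) :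
    ContinuousAt (rep x V) (coord x y) :=
  (contDiffAt_rep hV hy).continuousAt

theorem hasMFDerivAt_of_isMIntegralCurveOn_Ioo {γ : ℝ → M} {a b t : ℝ}
    (hγ : IsMIntegralCurveOn (I := 𝓘(ℝ, E)) γ V (Set.Ioo a b)) (ht : t ∈ Set.Ioo a b) :
    HasMFDerivAt 𝓘(ℝ, ℝ) 𝓘(ℝ, E) γ t ((1 : ℝ →L[ℝ] ℝ).smulRight (V (γ t))) :=
  (hγ t ht).hasMFDerivAt (Ioo_mem_nhds ht.1 ht.2)

/-- An integral curve is only assumed differentiable. Its derivative is V along a continuous curve,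
hence continuous; class C¹ is what the length estimate requires. -/
theorem contMDiffAt_integralCurve (hV : IsC2Field V) {γ : ℝ → M} {a b t : ℝ}
    (hγ : IsMIntegralCurveOn (I := 𝓘(ℝ, E)) γ V (Set.Ioo a b)) (ht : t ∈ Set.Ioo a b) :
    ContMDiffAt 𝓘(ℝ, ℝ) 𝓘(ℝ, E) 1 γ t := by
  have hc (s : ℝ) (hs : s ∈ Set.Ioo a b) : ContinuousAt γ s :=
    (hasMFDerivAt_of_isMIntegralCurveOn_Ioo hγ hs).continuousAt
  have hx := mem_chart_source E (γ t)
  have hev : ∀ᶠ s in 𝓝 t, s ∈ Set.Ioo a b ∧ γ s ∈ (chartAt E (γ t)).source :=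
    Filter.Eventually.and (Ioo_mem_nhds ht.1 ht.2)
      ((hc t ht).eventually (source_mem_nhds hx))
  have h1 : ContDiffAt ℝ 1 (fun s ↦ (coord (γ t) (γ s) : E)) t := by
    rw [contDiffAt_one_iff]
    refine ⟨fun s ↦ ContinuousLinearMap.toSpanSingleton ℝ (rep (γ t) V (coord (γ t) (γ s))), _, hev,
      fun s hs ↦ ?_, fun s hs ↦ ?_⟩
    · refine ContinuousAt.continuousWithinAt ?_
      have h2 : ContinuousAt (fun s ↦ rep (γ t) V (coord (γ t) (γ s))) s :=
        ContinuousAt.comp (f := fun s ↦ (coord (γ t) (γ s) : E)) (hV.continuousAt_rep hs.2)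
          (ContinuousAt.comp (contMDiffAt_coord hs.2).continuousAt (hc s hs.1))
      exact (ContinuousLinearMap.toSpanSingletonCLE (𝕜 := ℝ) (E := E)).continuous.continuousAt.comp
        h2
    · have h2 := hasDerivAt_coord (hasMFDerivAt_of_isMIntegralCurveOn_Ioo hγ hs.1) hs.2
      rw [← rep_coord hs.2] at h2
      exact h2.hasFDerivAt
  have h2 := ((contMDiffAt_pt (coord_mem hx)).of_le (n := ∞) (m := 1) (by simp)).comp t
    h1.contMDiffAt
  refine h2.congr_of_eventuallyEq ?_
  filter_upwards [hev] with s hs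
  exact (pt_coord hs.2).symm

/-- Local integral curves exist for a uniform time near each point. -/
theorem exists_integralCurve_uniform [FiniteDimensional ℝ E] (hV : IsC2Field V) (x : M) :
    ∃ ε > 0, ∀ᶠ y in 𝓝 x, ∃ γ : ℝ → M, γ 0 = y ∧
      IsMIntegralCurveOn (I := 𝓘(ℝ, E)) γ V (Set.Ioo (-ε) ε) := by
  have := FiniteDimensional.complete ℝ E
  have hx := mem_chart_source E x
  obtain ⟨W, hW, ⟨C, hC0, hC⟩, hWV⟩ := exists_contDiff_eventuallyEq (contDiffAt_rep hV hx)
  obtain ⟨r, hr, hball⟩ := Metric.eventually_nhds_iff_ball.1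
    (hWV.and (show ∀ᶠ z in 𝓝 (coord x x : E), z ∈ (extChartAt 𝓘(ℝ, E) x).target from
      coordRange_mem_nhds hx))
  have hW1 : ContDiffAt ℝ 1 W (coord x x) := hW.contDiffAt.of_le (by norm_num)
  obtain ⟨r', hr', ε, hε, H⟩ :=
    hW1.exists_forall_mem_closedBall_exists_eq_forall_mem_Ioo_hasDerivAt 0
  -- The speed of W is at most C, so within time r / (2C) a solution starting less than r / 2 from
  -- the centre stays in the ball of radius r on which W represents V.
  refine ⟨min ε (r / 2 / C), by positivity, ?_⟩
  have h1 : ∀ᶠ y in 𝓝 x, (coord x y : E) ∈ Metric.ball (coord x x) (min r' (r / 2)) :=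
    (contMDiffAt_coord hx).continuousAt.eventually (Metric.ball_mem_nhds _ (by positivity))
  filter_upwards [h1, source_mem_nhds hx] with y hy hys
  obtain ⟨α, hα0, hα⟩ := H (coord x y) (Metric.ball_subset_closedBall
    (Metric.ball_subset_ball (min_le_left _ _) hy))
  simp only [zero_sub, zero_add] at hα
  have hmem (t : ℝ) (ht : t ∈ Set.Ioo (-(min ε (r / 2 / C))) (min ε (r / 2 / C))) :
      t ∈ Set.Ioo (-ε) ε ∧ α t ∈ Metric.ball (coord x x : E) r := by
    have hlt := abs_lt.2 ht
    have hte : t ∈ Set.Ioo (-ε) ε := abs_lt.1 (hlt.trans_le (min_le_left _ _))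
    refine ⟨hte, ?_⟩
    have h2 := (convex_Ioo (-ε) ε).norm_image_sub_le_of_norm_hasDerivWithin_le
      (fun s hs ↦ (hα s hs).hasDerivWithinAt) (fun s _ ↦ hC (α s))
      (show (0 : ℝ) ∈ Set.Ioo (-ε) ε by simp [hε]) hte
    rw [hα0, sub_zero, Real.norm_eq_abs] at h2
    have h3 : C * |t| < r / 2 := by
      have := hlt.trans_le (min_le_right _ _)
      rw [lt_div_iff₀ hC0] at this
      linarith
    have h4 := Metric.ball_subset_ball (min_le_right _ _) hy
    rw [Metric.mem_ball] at h4 ⊢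
    calc dist (α t) (coord x x) ≤ dist (α t) (coord x y) + dist (coord x y : E) (coord x x) :=
          dist_triangle _ _ _
      _ < r := by rw [dist_eq_norm (α t)]; linarith
  refine ⟨fun t ↦ pt x (α t), ?_, fun t ht ↦ ?_⟩
  · change pt x (α 0) = y
    rw [hα0, pt_coord hys]
  · obtain ⟨h2, h3⟩ := hmem t ht
    have h4 := hasMFDerivAt_pt_comp (hα t h2) (hball _ h3).2
    rw [(hball _ h3).1, rep, frame_coframe (pt_mem (hball _ h3).2)] at h4
    exact h4.hasMFDerivWithinAt

end

end IntegralCurves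

/-! ## Global integral curves of bounded vector fields -/

section GlobalFlow

variable {E : Type*} [NormedAddCommGroup E] [NormedSpace ℝ E] [FiniteDimensional ℝ E]
  {M : Type*} [MetricSpace M] [ChartedSpace E M] [IsManifold 𝓘(ℝ, E) ∞ M]
  [RiemannianBundle (fun x : M ↦ TangentSpace 𝓘(ℝ, E) x)]
  [IsContMDiffRiemannianBundle 𝓘(ℝ, E) ∞ E (fun x : M ↦ TangentSpace 𝓘(ℝ, E) x)]
  [IsRiemannianManifold 𝓘(ℝ, E) M]
  {V : ∀ y : M, TangentSpace 𝓘(ℝ, E) y} {K : ℝ}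

/-- The Riemannian distance is at most the length of the curve, and the speed is at most K. -/
theorem dist_integralCurve_le (hV : IsC2Field V) (hK0 : 0 ≤ K) (hK : ∀ y, ‖V y‖ ≤ K) {γ : ℝ → M}
    {a b s t : ℝ} (hγ : IsMIntegralCurveOn (I := 𝓘(ℝ, E)) γ V (Set.Ioo a b))
    (hs : s ∈ Set.Ioo a b) (ht : t ∈ Set.Ioo a b) : dist (γ s) (γ t) ≤ K * |t - s| := by
  wlog hst : s ≤ t generalizing s t
  · rw [dist_comm, abs_sub_comm]
    exact this ht hs (le_of_not_ge hst)
  have hsub (r : ℝ) (hr : r ∈ Set.Icc s t) : r ∈ Set.Ioo a b :=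
    ⟨hs.1.trans_le hr.1, hr.2.trans_lt ht.2⟩
  have h1 : ContMDiffOn 𝓘(ℝ, ℝ) 𝓘(ℝ, E) 1 γ (Set.Icc s t) := fun r hr ↦
    (contMDiffAt_integralCurve hV hγ (hsub r hr)).contMDiffWithinAt
  have h2 := riemannianEDist_le_pathELength h1 rfl rfl hst
  rw [← IsRiemannianManifold.out (I := 𝓘(ℝ, E)) (γ s) (γ t),
    pathELength_eq_lintegral_mfderiv_Icc] at h2
  have h3 : ∫⁻ r in Set.Icc s t, ‖mfderiv 𝓘(ℝ, ℝ) 𝓘(ℝ, E) γ r (1 : ℝ)‖ₑ ≤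
      ∫⁻ _ in Set.Icc s t, ENNReal.ofReal K := by
    refine setLIntegral_mono' measurableSet_Icc fun r hr ↦ ?_
    have h4 : velocity γ r = V (γ r) :=
      velocity_eq (hasMFDerivAt_of_isMIntegralCurveOn_Ioo hγ (hsub r hr))
    change ‖velocity (E := E) γ r‖ₑ ≤ _
    rw [h4, ← ofReal_norm]
    exact ENNReal.ofReal_le_ofReal (hK _)
  have h5 := h2.trans h3
  rw [setLIntegral_const, Real.volume_Icc, ← ENNReal.ofReal_mul hK0, edist_dist] at h5
  rw [abs_of_nonneg (sub_nonneg.2 hst)]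
  exact (ENNReal.ofReal_le_ofReal_iff (mul_nonneg hK0 (sub_nonneg.2 hst))).1 h5

variable [CompleteSpace M]

theorem IsC2Field.contMDiff_one (hV : IsC2Field V) :
    ContMDiff 𝓘(ℝ, E) 𝓘(ℝ, E).tangent 1 (fun y ↦ (⟨y, V y⟩ : TangentBundle 𝓘(ℝ, E) M)) :=
  hV.of_le (by norm_num)

/-- An integral curve of a bounded vector field can be continued past the ends of its interval. -/
theorem exists_integralCurve_near_endpoint (hV : IsC2Field V) (hK0 : 0 ≤ K) (hK : ∀ y, ‖V y‖ ≤ K)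
    {γ : ℝ → M} {a b : ℝ} (hγ : IsMIntegralCurveOn (I := 𝓘(ℝ, E)) γ V (Set.Ioo a b)) {e : ℝ}
    (he : e ∈ closure (Set.Ioo a b)) :
    ∃ t₁ ∈ Set.Ioo a b, ∃ ε, |t₁ - e| < ε ∧ ∃ β : ℝ → M, β t₁ = γ t₁ ∧
      IsMIntegralCurveOn (I := 𝓘(ℝ, E)) β V (Set.Ioo (t₁ - ε) (t₁ + ε)) := by
  have hlip : LipschitzOnWith K.toNNReal γ (Set.Ioo a b) := by
    refine LipschitzOnWith.of_dist_le_mul fun s hs t ht ↦ ?_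
    rw [Real.coe_toNNReal K hK0, Real.dist_eq, abs_sub_comm]
    exact dist_integralCurve_le hV hK0 hK hγ hs ht
  have hne : (𝓝[Set.Ioo a b] e).NeBot := mem_closure_iff_nhdsWithin_neBot.1 he
  -- The Lipschitz bound makes γ Cauchy at the endpoint e; this is where completeness of M enters.
  have hcau : Cauchy (Filter.map γ (𝓝[Set.Ioo a b] e)) := by
    refine Cauchy.map_of_le (cauchy_nhds.mono nhdsWithin_le_nhds) hlip.uniformContinuousOn
      (by rw [Filter.le_principal_iff]; exact self_mem_nhdsWithin)
  obtain ⟨y, hy⟩ := CompleteSpace.complete hcau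
  -- The existence time ε is uniform near the limit point y, so restarting at a time t₁ closer to e
  -- than ε carries the curve past e.
  obtain ⟨ε, hε, hev⟩ := exists_integralCurve_uniform hV y
  have h1 : ∀ᶠ t in 𝓝[Set.Ioo a b] e, |t - e| < ε :=
    nhdsWithin_le_nhds (by simpa [Real.dist_eq] using! Metric.ball_mem_nhds e hε)
  obtain ⟨t₁, ⟨⟨β, hβ0, hβ⟩, hε1⟩, ht₁⟩ :=
    (((show Filter.Tendsto γ _ _ from hy).eventually hev).and h1 |>.and
      self_mem_nhdsWithin).exists
  refine ⟨t₁, ht₁, ε, hε1, β ∘ (· - t₁), by simp [hβ0], ?_⟩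
  have h2 := isMIntegralCurveOn_comp_sub (dt := t₁).2 hβ
  refine h2.mono fun t ht ↦ ?_
  simp only [Set.mem_Ioo, Set.mem_ofPred_eq] at ht ⊢
  constructor <;> linarith [ht.1, ht.2]

/-- Uniqueness of integral curves lets the old curve be glued to the restarted one. Leaving e
arbitrary in the closure treats both endpoints at once. -/
theorem exists_integralCurve_extension (hV : IsC2Field V) (hK0 : 0 ≤ K) (hK : ∀ y, ‖V y‖ ≤ K)
    {γ : ℝ → M} {a b : ℝ} (hγ : IsMIntegralCurveOn (I := 𝓘(ℝ, E)) γ V (Set.Ioo a b)) {e : ℝ}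
    (he : e ∈ closure (Set.Ioo a b)) {t₀ : ℝ} (ht₀ : t₀ ∈ Set.Ioo a b) :
    ∃ ε > 0, ∃ β : ℝ → M, β t₀ = γ t₀ ∧
      IsMIntegralCurveOn (I := 𝓘(ℝ, E)) β V (Set.Ioo (min a (e - ε)) (max b (e + ε))) := by
  obtain ⟨t₁, ht₁, ε, hε, β, hβ1, hβ⟩ := exists_integralCurve_near_endpoint hV hK0 hK hγ he
  have hε0 : 0 < ε := (abs_nonneg _).trans_lt hε
  have hmem : t₁ ∈ Set.Ioo a b ∩ Set.Ioo (t₁ - ε) (t₁ + ε) := ⟨ht₁, by simp [hε0]⟩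
  have h := isMIntegralCurveOn_piecewise hV.contMDiff_one hγ hβ hmem hβ1.symm
  -- The part of the interval of radius ε around t₁ that is certain to remain on either side of e.
  refine ⟨ε - |t₁ - e|, by linarith, _, Set.piecewise_eq_of_mem _ _ _ ht₀, h.mono ?_⟩
  rw [Set.Ioo_union_Ioo' (by linarith [ht₁.1, ht₁.2]) (by linarith [ht₁.1, ht₁.2])]
  refine Set.Ioo_subset_Ioo ?_ ?_
  · exact min_le_min_left _ (by linarith [neg_abs_le (t₁ - e), le_abs_self (t₁ - e)])
  · exact max_le_max_left _ (by linarith [neg_abs_le (t₁ - e), le_abs_self (t₁ - e)])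

/-- A bounded vector field of class `C²` on a complete Riemannian manifold is complete. -/
theorem exists_isMIntegralCurve_of_bounded (hV : IsC2Field V) (hK0 : 0 ≤ K) (hK : ∀ y, ‖V y‖ ≤ K)
    (x : M) : ∃ γ : ℝ → M, γ 0 = x ∧ IsMIntegralCurve (I := 𝓘(ℝ, E)) γ V := by
  let S : Set ℝ := {a | ∃ γ : ℝ → M, γ 0 = x ∧
    IsMIntegralCurveOn (I := 𝓘(ℝ, E)) γ V (Set.Ioo (-a) a)}
  have hmono {a b : ℝ} (hab : a ≤ b) (hb : b ∈ S) : a ∈ S := by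
    obtain ⟨γ, h0, h1⟩ := hb
    exact ⟨γ, h0, h1.mono (Set.Ioo_subset_Ioo (neg_le_neg hab) hab)⟩
  obtain ⟨ε₀, hε₀, hloc⟩ : ∃ ε > 0, ε ∈ S := by
    obtain ⟨ε, hε, hev⟩ := exists_integralCurve_uniform hV x
    exact ⟨ε, hε, hev.self_of_nhds⟩
  suffices hS : ¬ BddAbove S by
    rw [exists_isMIntegralCurve_iff_exists_isMIntegralCurveOn_Ioo hV.contMDiff_one]
    intro a
    rw [not_bddAbove_iff] at hS
    obtain ⟨b, hb, hab⟩ := hS a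
    exact hmono hab.le hb
  intro hbdd
  have hpos : 0 < sSup S := hε₀.trans_le (le_csSup hbdd hloc)
  have hlt (a : ℝ) (ha : a < sSup S) : a ∈ S := by
    obtain ⟨b, hb, hab⟩ := exists_lt_of_lt_csSup ⟨_, hloc⟩ ha
    exact hmono hab.le hb
  have hsup : sSup S ∈ S := by
    have : Nonempty M := ⟨x⟩
    choose! γ hγ0 hγ using hlt
    -- The value at t is taken from the curve whose half-length is the midpoint of |t| and the
    -- supremum. By uniqueness these curves agree where they overlap, so the patched curve is
    -- locally one of them.
    let c : ℝ → ℝ := fun t ↦ (|t| + sSup S) / 2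
    refine ⟨fun t ↦ γ (c t) t, ?_, fun t ht ↦ ?_⟩
    · exact hγ0 _ (by simp only [c, abs_zero]; linarith)
    · have htS : |t| < sSup S := abs_lt.2 ht
      have hct : c t < sSup S := by simp only [c]; linarith
      have htc : |t| < c t := by simp only [c]; linarith
      have h1 : (fun t ↦ γ (c t) t) =ᶠ[𝓝 t] γ (c t) := by
        filter_upwards [isOpen_Ioo.mem_nhds (abs_lt.1 htc)] with r hr
        have hrt : |r| < c t := abs_lt.2 hr
        have hcr : c r < sSup S := by simp only [c]; linarith
        have hrc : |r| < c r := by simp only [c]; linarith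
        have hm : |r| < min (c r) (c t) := lt_min hrc hrt
        exact isMIntegralCurveOn_Ioo_eqOn_of_contMDiff_boundaryless (t₀ := 0)
          (abs_lt.1 (by rw [abs_zero]; exact (abs_nonneg r).trans_lt hm)) hV.contMDiff_one
          ((hγ _ hcr).mono (Set.Ioo_subset_Ioo (neg_le_neg (min_le_left _ _)) (min_le_left _ _)))
          ((hγ _ hct).mono (Set.Ioo_subset_Ioo (neg_le_neg (min_le_right _ _)) (min_le_right _ _)))
          ((hγ0 _ hcr).trans (hγ0 _ hct).symm) (abs_lt.1 hm)
      exact ((hasMFDerivAt_of_isMIntegralCurveOn_Ioo (hγ _ hct)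
        (abs_lt.1 htc)).congr_of_eventuallyEq h1).hasMFDerivWithinAt
  obtain ⟨γ, hγ0, hγ⟩ := hsup
  have hcl : closure (Set.Ioo (-sSup S) (sSup S)) = Set.Icc (-sSup S) (sSup S) :=
    closure_Ioo (by linarith)
  -- Extending at the right end and then at the left end exceeds the supremum.
  obtain ⟨ε₁, hε₁, β, hβ0, hβ⟩ := exists_integralCurve_extension hV hK0 hK hγ (e := sSup S)
    (by rw [hcl]; exact ⟨by linarith, le_rfl⟩) (t₀ := 0) ⟨by linarith, hpos⟩
  have hβ' : IsMIntegralCurveOn (I := 𝓘(ℝ, E)) β V (Set.Ioo (-sSup S) (sSup S + ε₁)) :=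
    hβ.mono (Set.Ioo_subset_Ioo (min_le_left _ _) (le_max_right _ _))
  obtain ⟨ε₂, hε₂, α, hα0, hα⟩ := exists_integralCurve_extension hV hK0 hK hβ' (e := -sSup S)
    (by rw [closure_Ioo (by linarith)]; exact ⟨le_rfl, by linarith⟩) (t₀ := 0)
    ⟨by linarith, by linarith⟩
  have hmem : sSup S + min ε₁ ε₂ ∈ S := by
    refine ⟨α, hα0.trans (hβ0.trans hγ0), hα.mono (Set.Ioo_subset_Ioo ?_ ?_)⟩
    · exact (min_le_right _ _).trans (by linarith [min_le_right ε₁ ε₂])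
    · exact le_trans (by linarith [min_le_left ε₁ ε₂]) (le_max_left _ _)
  linarith [le_csSup hbdd hmem, lt_min hε₁ hε₂]

/-- A family of global integral curves of `V`, one for each starting point. -/
structure IsFlow (V : ∀ y : M, TangentSpace 𝓘(ℝ, E) y) (φ : ℝ → M → M) : Prop where
  map_zero : ∀ x, φ 0 x = x
  isMIntegralCurve : ∀ x, IsMIntegralCurve (I := 𝓘(ℝ, E)) (fun t ↦ φ t x) V

theorem exists_isFlow (hV : IsC2Field V) (hK0 : 0 ≤ K) (hK : ∀ y, ‖V y‖ ≤ K) :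
    ∃ φ : ℝ → M → M, IsFlow V φ := by
  choose γ h0 h using exists_isMIntegralCurve_of_bounded hV hK0 hK
  exact ⟨fun t x ↦ γ x t, h0, h⟩

variable {φ : ℝ → M → M}

theorem IsFlow.map_add (hφ : IsFlow V φ) (hV : IsC2Field V) (s t : ℝ) (x : M) :
    φ (s + t) x = φ s (φ t x) := by
  have h1 := (hφ.isMIntegralCurve x).comp_add t
  have h2 := isMIntegralCurve_Ioo_eq_of_contMDiff_boundaryless (t₀ := 0) hV.contMDiff_one h1
    (hφ.isMIntegralCurve (φ t x)) (by simp [hφ.map_zero])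
  exact congrFun h2 s

theorem IsFlow.dist_le (hφ : IsFlow V φ) (hV : IsC2Field V) (hK0 : 0 ≤ K) (hK : ∀ y, ‖V y‖ ≤ K)
    (t : ℝ) (x : M) : dist (φ t x) x ≤ K * |t| := by
  have h := dist_integralCurve_le hV hK0 hK (s := 0) (t := t) (a := -(|t| + 1)) (b := |t| + 1)
    ((hφ.isMIntegralCurve x).isMIntegralCurveOn _)
    (abs_lt.1 (by rw [abs_zero]; positivity)) (abs_lt.1 (by linarith))
  simpa [hφ.map_zero, dist_comm] using h

theorem IsFlow.hasMFDerivAt (hφ : IsFlow V φ) (t : ℝ) (x : M) :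
    HasMFDerivAt 𝓘(ℝ, ℝ) 𝓘(ℝ, E) (fun t ↦ φ t x) t ((1 : ℝ →L[ℝ] ℝ).smulRight (V (φ t x))) :=
  hφ.isMIntegralCurve x t

theorem IsFlow.continuous_time (hφ : IsFlow V φ) (x : M) : Continuous (fun t ↦ φ t x) :=
  continuous_iff_continuousAt.2 fun t ↦ (hφ.hasMFDerivAt t x).continuousAt

theorem IsFlow.velocity_eq (hφ : IsFlow V φ) (t : ℝ) (x : M) :
    velocity (fun t ↦ φ t x) t = V (φ t x) :=
  RSGD.velocity_eq (hφ.hasMFDerivAt t x)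

end GlobalFlow

/-! ## Regularity of the flow -/

section FlowRegularity

open unitInterval

variable {E : Type*} [NormedAddCommGroup E] [NormedSpace ℝ E] [FiniteDimensional ℝ E]
  {M : Type*} [MetricSpace M] [ChartedSpace E M] [IsManifold 𝓘(ℝ, E) ∞ M]
  [RiemannianBundle (fun x : M ↦ TangentSpace 𝓘(ℝ, E) x)]
  [IsContMDiffRiemannianBundle 𝓘(ℝ, E) ∞ E (fun x : M ↦ TangentSpace 𝓘(ℝ, E) x)]
  [IsRiemannianManifold 𝓘(ℝ, E) M] [CompleteSpace M]
  {V : ∀ y : M, TangentSpace 𝓘(ℝ, E) y} {K : ℝ} {φ : ℝ → M → M}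

/-- Only the speed bound is used: trajectories move by at most K|s|. This provides continuity at
time zero, jointly in time and starting point, before any regularity of the flow is known. -/
theorem IsFlow.eventually_mem (hφ : IsFlow V φ) (hV : IsC2Field V) (hK0 : 0 ≤ K)
    (hK : ∀ y, ‖V y‖ ≤ K) (x : M) {U : Set M} (hU : U ∈ 𝓝 x) :
    ∀ᶠ p : ℝ × M in 𝓝 (0, x), ∀ s : ℝ, |s| ≤ |p.1| → φ s p.2 ∈ U := by
  obtain ⟨δ, hδ, hball⟩ := Metric.mem_nhds_iff.1 hU
  have hc : Continuous fun p : ℝ × M ↦ K * |p.1| + dist p.2 x := by fun_prop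
  have h1 : ∀ᶠ p : ℝ × M in 𝓝 (0, x), K * |p.1| + dist p.2 x < δ :=
    hc.continuousAt.eventually_lt continuousAt_const (by simpa using hδ)
  filter_upwards [h1] with p hp s hs
  refine hball ?_
  calc dist (φ s p.2) x ≤ dist (φ s p.2) p.2 + dist p.2 x := dist_triangle _ _ _
    _ ≤ K * |p.1| + dist p.2 x := by
      gcongr
      exact (hφ.dist_le hV hK0 hK s p.2).trans (by gcongr)
    _ < δ := hp

theorem IsFlow.eventually_mem_pt (hφ : IsFlow V φ) (hV : IsC2Field V) (hK0 : 0 ≤ K)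
    (hK : ∀ y, ‖V y‖ ≤ K) (x : M) {U : Set M} (hU : U ∈ 𝓝 x) :
    ∀ᶠ p : ℝ × E in 𝓝 (0, coord x x), ∀ s : ℝ, |s| ≤ |p.1| → φ s (pt x p.2) ∈ U := by
  have hx := mem_chart_source E x
  have hc : Filter.Tendsto (fun p : ℝ × E ↦ (p.1, pt x p.2)) (𝓝 (0, coord x x)) (𝓝 (0, x)) := by
    refine Filter.Tendsto.prodMk_nhds (continuous_fst.tendsto' _ _ rfl) ?_
    have h1 := (contMDiffAt_pt (coord_mem hx)).continuousAt
    rw [ContinuousAt, pt_coord hx] at h1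
    exact h1.comp (continuous_snd.tendsto' _ _ rfl)
  exact hc.eventually (hφ.eventually_mem hV hK0 hK x hU)

/-- In the chart at `x`, the flow of `V` has the form `z + t k(t, z)` with `k` of class `C²` and
`k(0, ·) = V`. -/
theorem IsFlow.exists_contDiffAt (hφ : IsFlow V φ) (hV : IsC2Field V) (hK0 : 0 ≤ K)
    (hK : ∀ y, ‖V y‖ ≤ K) (x : M) :
    ∃ k : ℝ × E → E, ContDiffAt ℝ 2 k (0, coord x x) ∧
      (∀ᶠ p : ℝ × E in 𝓝 (0, coord x x), φ p.1 (pt x p.2) ∈ (chartAt E x).source ∧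
        (coord x (φ p.1 (pt x p.2)) : E) = p.2 + p.1 • k p) ∧
      ∀ᶠ z in 𝓝 (coord x x), k (0, z) = rep x V z := by
  classical
  have hx := mem_chart_source E x
  obtain ⟨W, hW, -, hWV⟩ := exists_contDiff_eventuallyEq (contDiffAt_rep hV hx)
  set z₀ : E := coord x x with hz₀
  have hcx : ContinuousAt (fun y : M ↦ (coord x y : E)) x := (contMDiffAt_coord hx).continuousAt
  -- Rescaling time to [0, 1] turns t into a parameter: the path solves y' = t W(y) on a fixed
  -- interval.
  let path (p : ℝ × E) (r : ℝ) : E := coord x (φ (p.1 * r) (pt x p.2))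
  -- The default value 0 plays no role, since for p near (0, z₀) the path is continuous.
  let a : ℝ × E → C(I, E) := fun p ↦
    if h : Continuous (fun r : I ↦ path p r) then ⟨_, h⟩ else 0
  have hmem {U : Set M} (hU : U ∈ 𝓝 x) : ∀ᶠ p : ℝ × E in 𝓝 (0, z₀), ∀ r ∈ Set.Icc (0 : ℝ) 1,
      φ (p.1 * r) (pt x p.2) ∈ U := by
    filter_upwards [hφ.eventually_mem_pt hV hK0 hK x hU] with p hp r hr
    refine hp _ ?_
    rw [abs_mul, abs_of_nonneg hr.1]
    exact mul_le_of_le_one_right (abs_nonneg _) hr.2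
  have hderiv : ∀ᶠ p : ℝ × E in 𝓝 (0, z₀), ∀ r ∈ Set.Icc (0 : ℝ) 1,
      HasDerivAt (path p) (p.1 • W (path p r)) r := by
    have hU : {y : M | y ∈ (chartAt E x).source ∧ W (coord x y) = rep x V (coord x y)} ∈ 𝓝 x :=
      Filter.inter_mem (source_mem_nhds hx) (hcx.eventually hWV)
    filter_upwards [hmem hU] with p hp r hr
    obtain ⟨h1, h2⟩ := hp r hr
    have h3 := hasDerivAt_coord (hφ.hasMFDerivAt (p.1 * r) (pt x p.2)) h1
    rw [← rep_coord h1, ← h2] at h3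
    have h4 : HasDerivAt (fun r : ℝ ↦ p.1 * r) p.1 r := by
      simpa using (hasDerivAt_id r).const_mul p.1
    exact h3.scomp r h4
  have hcont {p : ℝ × E} (h : ∀ r ∈ Set.Icc (0 : ℝ) 1,
      HasDerivAt (path p) (p.1 • W (path p r)) r) : Continuous (fun r : I ↦ path p r) :=
    continuousOn_iff_continuous_domRestrict.1 fun r hr ↦ (h r hr).continuousAt.continuousWithinAt
  have ha_apply : ∀ᶠ p in 𝓝 (0, z₀), ∀ r : I, a p r = path p r := by
    filter_upwards [hderiv] with p hp r
    simp only [a, dif_pos (hcont hp)]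
    rfl
  have ha₀ : a (0, z₀) = constPath z₀ := by
    ext r
    rw [ha_apply.self_of_nhds r, constPath_apply]
    simp only [path, zero_mul, hφ.map_zero]
    rw [hz₀, pt_coord hx]
  have ha : ContinuousAt a (0, z₀) := by
    rw [Metric.continuousAt_iff']
    intro e he
    have hU : {y : M | dist (coord x y : E) z₀ < e / 2} ∈ 𝓝 x :=
      hcx.eventually (Metric.ball_mem_nhds _ (by positivity))
    filter_upwards [hmem hU, ha_apply] with p hp hap
    rw [ha₀]
    refine lt_of_le_of_lt ((ContinuousMap.dist_le (by positivity : 0 ≤ e / 2)).2 fun r ↦ ?_)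
      (half_lt_self he)
    rw [hap r, constPath_apply]
    exact (hp r r.2).le
  have heq : ∀ᶠ p in 𝓝 (0, z₀), a p = constPath p.2 +
      p.1 • integrateOperator (superpose W hW.continuous (a p)) := by
    have htarget : ∀ᶠ p : ℝ × E in 𝓝 (0, z₀), p.2 ∈ (extChartAt 𝓘(ℝ, E) x).target :=
      (continuous_snd.tendsto' _ _ rfl).eventually (coordRange_mem_nhds hx)
    filter_upwards [hderiv, ha_apply, htarget] with p hp hap hpt
    ext r
    have hsub (ρ : ℝ) (hρ : ρ ∈ Set.uIcc 0 (r : ℝ)) : ρ ∈ Set.Icc (0 : ℝ) 1 := by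
      rw [Set.uIcc_of_le r.2.1] at hρ
      exact ⟨hρ.1, hρ.2.trans r.2.2⟩
    have h0 : path p 0 = p.2 := by
      simp only [path, mul_zero, hφ.map_zero]
      exact coord_pt hpt
    have hci : ContinuousOn (fun ρ ↦ W (path p ρ)) (Set.uIcc 0 (r : ℝ)) := fun ρ hρ ↦
      (hW.continuous.continuousAt.comp (hp ρ (hsub ρ hρ)).continuousAt).continuousWithinAt
    have h1 := intervalIntegral.integral_eq_sub_of_hasDerivAt
      (fun ρ hρ ↦ hp ρ (hsub ρ hρ)) (hci.const_smul p.1).intervalIntegrable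
    have h2 : ∫ ρ in (0 : ℝ)..r, Set.IccExtend zero_le_one (superpose W hW.continuous (a p)) ρ =
        ∫ ρ in (0 : ℝ)..r, W (path p ρ) := by
      refine intervalIntegral.integral_congr fun ρ hρ ↦ ?_
      rw [Set.IccExtend_of_mem _ _ (hsub ρ hρ)]
      change W (a p ⟨ρ, hsub ρ hρ⟩) = _
      rw [hap]
    rw [hap, ContinuousMap.add_apply, ContinuousMap.smul_apply, constPath_apply,
      integrateOperator_apply, h2, ← intervalIntegral.integral_smul, h1, h0]
    abel
  obtain ⟨k, hk, hak, hk0⟩ := exists_contDiffAt_solution_eq hW ha ha₀ heq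
  refine ⟨k, hk, ?_, ?_⟩
  · filter_upwards [hak, ha_apply, hmem (source_mem_nhds hx)] with p h1 h2 h3
    have h4 := h3 1 ⟨zero_le_one, le_rfl⟩
    rw [mul_one] at h4
    refine ⟨h4, ?_⟩
    rw [← h1, h2 1]
    simp only [path, Set.Icc.coe_one, mul_one]
  · filter_upwards [hk0, hWV] with z h1 h2
    rw [h1, h2]

/-- Locally in space and time, the flow of `V` is jointly of class `C²`. -/
theorem IsFlow.contMDiffAt_zero (hφ : IsFlow V φ) (hV : IsC2Field V) (hK0 : 0 ≤ K)
    (hK : ∀ y, ‖V y‖ ≤ K) (x : M) :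
    ContMDiffAt (𝓘(ℝ, ℝ).prod 𝓘(ℝ, E)) 𝓘(ℝ, E) 2 (fun p : ℝ × M ↦ φ p.1 p.2) (0, x) := by
  obtain ⟨k, hk, hkφ, -⟩ := hφ.exists_contDiffAt hV hK0 hK x
  have hx := mem_chart_source E x
  have hc : ContMDiffAt (𝓘(ℝ, ℝ).prod 𝓘(ℝ, E)) 𝓘(ℝ, ℝ × E) 2
      (fun p : ℝ × M ↦ (p.1, (coord x p.2 : E))) (0, x) := by
    rw [modelWithCornersSelf_prod, ← chartedSpaceSelf_prod]
    exact ContMDiffAt.prodMk contMDiffAt_fst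
      (((contMDiffAt_coord hx).of_le two_le_infty).comp ((0 : ℝ), x) contMDiffAt_snd)
  have h1 : ContDiffAt ℝ 2 (fun p : ℝ × E ↦ p.2 + p.1 • k p) (0, coord x x) :=
    contDiffAt_snd.add (contDiffAt_fst.smul hk)
  have h2 := ContMDiffAt.comp ((0 : ℝ), x) h1.contMDiffAt hc
  have hz : (coord x x : E) + (0 : ℝ) • k (0, coord x x) ∈ (extChartAt 𝓘(ℝ, E) x).target := by
    rw [zero_smul, add_zero]; exact coord_mem hx
  have h3 := ContMDiffAt.comp ((0 : ℝ), x) ((contMDiffAt_pt hz).of_le two_le_infty) h2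
  refine h3.congr_of_eventuallyEq ?_
  filter_upwards [hc.continuousAt.eventually hkφ,
    continuous_snd.continuousAt.eventually (source_mem_nhds hx)] with p h4 h5
  simp only [pt_coord h5] at h4
  simp only [Function.comp]
  rw [← h4.2, pt_coord h4.1]

/-- Since φ t = φ (t - s) ∘ φ s and short-time flow maps are C² near any given point, the times at
which φ t is C² at x form an open and closed set. It contains 0, and ℝ is connected. -/
theorem IsFlow.contMDiff (hφ : IsFlow V φ) (hV : IsC2Field V) (hK0 : 0 ≤ K)
    (hK : ∀ y, ‖V y‖ ≤ K) (t : ℝ) : ContMDiff 𝓘(ℝ, E) 𝓘(ℝ, E) 2 (φ t) := by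
  intro x
  have hev (y : M) : ∀ᶠ p : ℝ × M in 𝓝 (0, y), ContMDiffAt 𝓘(ℝ, E) 𝓘(ℝ, E) 2 (φ p.1) p.2 := by
    filter_upwards [(contMDiffAt_iff_contMDiffAt_nhds (by simp)).1
      (hφ.contMDiffAt_zero hV hK0 hK y)] with p hp
    have h1 : ContMDiffAt 𝓘(ℝ, E) (𝓘(ℝ, ℝ).prod 𝓘(ℝ, E)) 2 (fun y : M ↦ (p.1, y)) p.2 :=
      contMDiffAt_const.prodMk contMDiffAt_id
    exact ContMDiffAt.comp (g := fun p : ℝ × M ↦ φ p.1 p.2) p.2 hp h1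
  have hloc (t : ℝ) : ∀ᶠ s in 𝓝 t, (ContMDiffAt 𝓘(ℝ, E) 𝓘(ℝ, E) 2 (φ s) x ↔
      ContMDiffAt 𝓘(ℝ, E) 𝓘(ℝ, E) 2 (φ t) x) := by
    have h1 : Filter.Tendsto (fun s ↦ (s - t, φ t x)) (𝓝 t) (𝓝 ((0 : ℝ), φ t x)) := by
      refine Continuous.tendsto' (by fun_prop) _ _ (by simp)
    have h2 : Filter.Tendsto (fun s ↦ (t - s, φ s x)) (𝓝 t) (𝓝 ((0 : ℝ), φ t x)) := by
      have := hφ.continuous_time x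
      refine Continuous.tendsto' (by fun_prop) _ _ (by simp)
    filter_upwards [h1.eventually (hev _), h2.eventually (hev _)] with s hs1 hs2
    constructor
    · intro h
      have h3 : φ t = φ (t - s) ∘ φ s := by
        ext y; rw [Function.comp, ← hφ.map_add hV, sub_add_cancel]
      rw [h3]
      exact ContMDiffAt.comp x hs2 h
    · intro h
      have h3 : φ s = φ (s - t) ∘ φ t := by
        ext y; rw [Function.comp, ← hφ.map_add hV, sub_add_cancel]
      rw [h3]
      exact ContMDiffAt.comp x hs1 h
  have hclopen : IsClopen {t | ContMDiffAt 𝓘(ℝ, E) 𝓘(ℝ, E) 2 (φ t) x} := by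
    refine ⟨⟨isOpen_iff_mem_nhds.2 fun t ht ↦ ?_⟩, isOpen_iff_mem_nhds.2 fun t ht ↦ ?_⟩
    · filter_upwards [hloc t] with s hs h using ht (hs.1 h)
    · filter_upwards [hloc t] with s hs using hs.2 ht
  have h0 : φ 0 = id := funext hφ.map_zero
  have huniv := hclopen.eq_univ ⟨0, by simp only [Set.mem_ofPred_eq, h0]; exact contMDiffAt_id⟩
  exact (Set.eq_univ_iff_forall.1 huniv) t

theorem IsFlow.contMDiff_time (hφ : IsFlow V φ) (hV : IsC2Field V) (hK0 : 0 ≤ K)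
    (hK : ∀ y, ‖V y‖ ≤ K) (x : M) : ContMDiff 𝓘(ℝ, ℝ) 𝓘(ℝ, E) 2 (fun t ↦ φ t x) := by
  intro t
  have h1 : (fun s ↦ φ s x) = (fun p : ℝ × M ↦ φ p.1 p.2) ∘ fun s ↦ (s - t, φ t x) := by
    ext s; simp only [Function.comp]; rw [← hφ.map_add hV, sub_add_cancel]
  rw [h1]
  have h2 : ContMDiffAt 𝓘(ℝ, ℝ) 𝓘(ℝ, ℝ) 2 (fun s : ℝ ↦ s - t) t :=
    (contDiff_id.sub contDiff_const).contDiffAt.contMDiffAt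
  refine ContMDiffAt.comp_of_eq (hφ.contMDiffAt_zero hV hK0 hK (φ t x))
    (h2.prodMk contMDiffAt_const) (by simp)

end FlowRegularity

/-! ## Variation fields along the flow -/

section PartialDerivatives

variable {E : Type*} [NormedAddCommGroup E] [NormedSpace ℝ E]

theorem contDiffAt_deriv {f : ℝ → E} {s : ℝ} (hf : ContDiffAt ℝ 2 f s) :
    ContDiffAt ℝ 1 (deriv f) s := by
  have h : ContDiffAt ℝ 1 (fderiv ℝ f) s := hf.fderiv_right (m := 1) (by norm_num)
  exact h.clm_apply contDiffAt_const

theorem hasFDerivAt_section (t s : ℝ) :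
    HasFDerivAt (fun s : ℝ ↦ (t, s)) (ContinuousLinearMap.inr ℝ ℝ ℝ) s := by
  have h := (hasFDerivAt_const t s).prodMk (hasFDerivAt_id (𝕜 := ℝ) s)
  exact h

theorem deriv_section {q : ℝ × ℝ → E} {p : ℝ × ℝ} (hq : DifferentiableAt ℝ q p) :
    deriv (fun s ↦ q (p.1, s)) p.2 = fderiv ℝ q p (0, 1) := by
  have h := HasFDerivAt.comp p.2 (f := fun s : ℝ ↦ (p.1, s)) (g := q) hq.hasFDerivAt
    (hasFDerivAt_section p.1 p.2)
  rw [← fderiv_apply_one_eq_deriv]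
  exact (congrArg (fun L : ℝ →L[ℝ] E ↦ L 1) h.fderiv).trans (by simp)

variable {q : ℝ × ℝ → E} {t s : ℝ}

theorem eventually_deriv_section (hq : ContDiffAt ℝ 2 q (t, s)) :
    ∀ᶠ p in 𝓝 (t, s), deriv (fun s ↦ q (p.1, s)) p.2 = fderiv ℝ q p (0, 1) := by
  filter_upwards [hq.eventually (by simp)] with p hp
  exact deriv_section (hp.differentiableAt (by norm_num))

theorem eventually_deriv_deriv_section (hq : ContDiffAt ℝ 2 q (t, s)) :
    ∀ᶠ p in 𝓝 (t, s), deriv (deriv (fun s ↦ q (p.1, s))) p.2 =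
      fderiv ℝ (fun p ↦ fderiv ℝ q p (0, 1)) p (0, 1) := by
  have h1 : ContDiffAt ℝ 1 (fun p ↦ fderiv ℝ q p (0, 1)) (t, s) :=
    (hq.fderiv_right (m := 1) (by norm_num)).clm_apply contDiffAt_const
  filter_upwards [(eventually_deriv_section hq).eventually_nhds, h1.eventually (by simp)]
    with p hp hp1
  rw [← deriv_section (hp1.differentiableAt (by norm_num))]
  refine Filter.EventuallyEq.deriv_eq ?_
  have hc : Filter.Tendsto (fun s : ℝ ↦ (p.1, s)) (𝓝 p.2) (𝓝 p) :=
    (Continuous.prodMk_right p.1).tendsto p.2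
  exact hc.eventually hp

theorem tendsto_section (t s : ℝ) : Filter.Tendsto (fun r : ℝ ↦ (r, s)) (𝓝 t) (𝓝 (t, s)) :=
  (Continuous.prodMk_left s).tendsto t

theorem continuousAt_deriv_section (hq : ContDiffAt ℝ 2 q (t, s)) :
    ContinuousAt (fun r ↦ deriv (fun s ↦ q (r, s)) s) t := by
  have h1 : ContDiffAt ℝ 1 (fun p ↦ fderiv ℝ q p (0, 1)) (t, s) :=
    (hq.fderiv_right (m := 1) (by norm_num)).clm_apply contDiffAt_const
  refine (ContinuousAt.comp (f := fun r ↦ (r, s)) h1.continuousAt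
    (tendsto_section t s)).congr_of_eventuallyEq ?_
  exact (tendsto_section t s).eventually (eventually_deriv_section hq)

theorem continuousAt_deriv_deriv_section (hq : ContDiffAt ℝ 2 q (t, s)) :
    ContinuousAt (fun r ↦ deriv (deriv (fun s ↦ q (r, s))) s) t := by
  have h1 : ContDiffAt ℝ 1 (fun p ↦ fderiv ℝ q p (0, 1)) (t, s) :=
    (hq.fderiv_right (m := 1) (by norm_num)).clm_apply contDiffAt_const
  have h2 : ContDiffAt ℝ 0 (fun p ↦ fderiv ℝ (fun p ↦ fderiv ℝ q p (0, 1)) p (0, 1)) (t, s) :=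
    (h1.fderiv_right (m := 0) (by norm_num)).clm_apply contDiffAt_const
  refine (ContinuousAt.comp (f := fun r ↦ (r, s)) h2.continuousAt
    (tendsto_section t s)).congr_of_eventuallyEq ?_
  exact (tendsto_section t s).eventually (eventually_deriv_deriv_section hq)

/-- The slope at t is G r itself, so continuity of G suffices. This saves a derivative: the
r-derivative of ∂_s² exists at t although q is only C². -/
theorem hasDerivAt_add_sub_smul (b : E) {G : ℝ → E} (hG : ContinuousAt G t) :
    HasDerivAt (fun r ↦ b + (r - t) • G r) (G t) t := by
  rw [hasDerivAt_iff_tendsto_slope]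
  refine (hG.tendsto.mono_left nhdsWithin_le_nhds).congr' ?_
  filter_upwards [self_mem_nhdsWithin] with r hr
  have : r - t ≠ 0 := sub_ne_zero.2 hr
  simp [slope, smul_smul, inv_mul_cancel₀ this]

variable {F : ℝ → ℝ → E} {b : ℝ → E}

/-- If `F(r, s) = b(s) + (r - t) q(r, s)`, then the first two derivatives in `s` of `F` are
differentiable in `r` at `t`, with derivatives those of `q(t, ·)`. -/
theorem hasDerivAt_deriv_of_eq_add_smul (hb : ContDiffAt ℝ 2 b s) (hq : ContDiffAt ℝ 2 q (t, s))
    (hF : ∀ᶠ p : ℝ × ℝ in 𝓝 (t, s), F p.1 p.2 = b p.2 + (p.1 - t) • q p) :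
    HasDerivAt (fun r ↦ F r s) (q (t, s)) t ∧
    HasDerivAt (fun r ↦ deriv (F r) s) (deriv (fun s ↦ q (t, s)) s) t ∧
    HasDerivAt (fun r ↦ deriv (deriv (F r)) s) (deriv (deriv (fun s ↦ q (t, s))) s) t := by
  have h1 : ∀ᶠ p : ℝ × ℝ in 𝓝 (t, s), deriv (F p.1) p.2 =
      deriv b p.2 + (p.1 - t) • deriv (fun s ↦ q (p.1, s)) p.2 := by
    have hbs : ∀ᶠ p : ℝ × ℝ in 𝓝 (t, s), ContDiffAt ℝ 2 b p.2 :=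
      continuous_snd.continuousAt.eventually (hb.eventually (by simp))
    filter_upwards [hF.eventually_nhds, hbs, hq.eventually (by simp)] with p hp hpb hpq
    have hc : Filter.Tendsto (fun s : ℝ ↦ (p.1, s)) (𝓝 p.2) (𝓝 p) :=
      (Continuous.prodMk_right p.1).tendsto p.2
    have heq : F p.1 =ᶠ[𝓝 p.2] fun s ↦ b s + (p.1 - t) • q (p.1, s) := hc.eventually hp
    rw [heq.deriv_eq]
    have h2 : DifferentiableAt ℝ (fun s ↦ q (p.1, s)) p.2 :=
      DifferentiableAt.comp (g := q) (f := fun s : ℝ ↦ (p.1, s)) p.2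
        (hpq.differentiableAt (by norm_num)) (hasFDerivAt_section p.1 p.2).differentiableAt
    exact ((hpb.differentiableAt (by norm_num)).hasDerivAt.add
      (h2.hasDerivAt.const_smul (p.1 - t))).deriv
  have h2 : ∀ᶠ r in 𝓝 t, deriv (deriv (F r)) s =
      deriv (deriv b) s + (r - t) • deriv (deriv (fun s ↦ q (r, s))) s := by
    have hqd : ContDiffAt ℝ 1 (fun p ↦ fderiv ℝ q p (0, 1)) (t, s) :=
      (hq.fderiv_right (m := 1) (by norm_num)).clm_apply contDiffAt_const
    filter_upwards [(tendsto_section t s).eventually h1.eventually_nhds,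
      (tendsto_section t s).eventually (hqd.eventually (by simp)),
      (tendsto_section t s).eventually (eventually_deriv_section hq).eventually_nhds]
      with r hr hr1 hr2
    have hc : Filter.Tendsto (fun s' : ℝ ↦ (r, s')) (𝓝 s) (𝓝 (r, s)) :=
      (Continuous.prodMk_right r).tendsto s
    have heq : deriv (F r) =ᶠ[𝓝 s]
        fun s ↦ deriv b s + (r - t) • deriv (fun s ↦ q (r, s)) s := hc.eventually hr
    rw [heq.deriv_eq]
    have h3 : DifferentiableAt ℝ (deriv (fun s ↦ q (r, s))) s := by
      have h4 := DifferentiableAt.comp (g := fun p ↦ fderiv ℝ q p (0, 1))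
        (f := fun s : ℝ ↦ (r, s)) s (hr1.differentiableAt (by norm_num))
        (hasFDerivAt_section r s).differentiableAt
      exact h4.congr_of_eventuallyEq (hc.eventually hr2)
    exact (((contDiffAt_deriv hb).differentiableAt (by norm_num)).hasDerivAt.add
      (h3.hasDerivAt.const_smul (r - t))).deriv
  have hq0 : ContinuousAt (fun r ↦ q (r, s)) t :=
    ContinuousAt.comp (g := q) hq.continuousAt (tendsto_section t s)
  refine ⟨?_, ?_, ?_⟩
  · exact (hasDerivAt_add_sub_smul (b s) hq0).congr_of_eventuallyEq
      ((tendsto_section t s).eventually hF)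
  · exact (hasDerivAt_add_sub_smul (deriv b s)
      (continuousAt_deriv_section hq)).congr_of_eventuallyEq
      ((tendsto_section t s).eventually h1)
  · exact (hasDerivAt_add_sub_smul _ (continuousAt_deriv_deriv_section hq)).congr_of_eventuallyEq h2

theorem deriv_comp_eq {E : Type*} [NormedAddCommGroup E] [NormedSpace ℝ E] {W : E → E} {b : ℝ → E}
    {s : ℝ} (hb : ContDiffAt ℝ 2 b s) (hW : ContDiffAt ℝ 2 W (b s)) :
    deriv (fun s ↦ W (b s)) s = fderiv ℝ W (b s) (deriv b s) ∧
    deriv (deriv (fun s ↦ W (b s))) s = fderiv ℝ (fderiv ℝ W) (b s) (deriv b s) (deriv b s) +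
      fderiv ℝ W (b s) (deriv (deriv b) s) := by
  have h1 : ∀ᶠ s in 𝓝 s, deriv (fun s ↦ W (b s)) s = fderiv ℝ W (b s) (deriv b s) := by
    filter_upwards [hb.eventually (by simp), hb.continuousAt.eventually (hW.eventually (by simp))]
      with s hbs hWs
    exact (HasFDerivAt.comp_hasDerivAt s (hWs.differentiableAt (by norm_num)).hasFDerivAt
      (hbs.differentiableAt (by norm_num)).hasDerivAt).deriv
  refine ⟨h1.self_of_nhds, ?_⟩
  rw [Filter.EventuallyEq.deriv_eq h1]
  have h2 : DifferentiableAt ℝ (fderiv ℝ W) (b s) :=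
    (hW.fderiv_right (m := 1) (by norm_num)).differentiableAt (by norm_num)
  have h3 := h2.hasFDerivAt.comp_hasDerivAt s (hb.differentiableAt (by norm_num)).hasDerivAt
  exact (h3.clm_apply ((contDiffAt_deriv hb).differentiableAt (by norm_num)).hasDerivAt).deriv

end PartialDerivatives

/-! ### The first and second variational equations of the flow -/

section Variation

variable {E : Type*} [NormedAddCommGroup E] [NormedSpace ℝ E] [FiniteDimensional ℝ E]

section

variable {M : Type*} [TopologicalSpace M] [ChartedSpace E M] [IsManifold 𝓘(ℝ, E) ∞ M]
  [RiemannianBundle (fun x : M ↦ TangentSpace 𝓘(ℝ, E) x)]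
  [IsContMDiffRiemannianBundle 𝓘(ℝ, E) ∞ E (fun x : M ↦ TangentSpace 𝓘(ℝ, E) x)]

theorem contDiffAt_coord_curve {c : ℝ → M} {s : ℝ} (hc : ContMDiffAt 𝓘(ℝ, ℝ) 𝓘(ℝ, E) 2 c s) {x : M}
    (hx : c s ∈ (chartAt E x).source) : ContDiffAt ℝ 2 (fun s ↦ (coord x (c s) : E)) s :=
  contMDiffAt_iff_contDiffAt.1 (ContMDiffAt.comp s ((contMDiffAt_coord hx).of_le two_le_infty) hc)

theorem coframe_velocity {c : ℝ → M} {s : ℝ} (hc : MDifferentiableAt 𝓘(ℝ, ℝ) 𝓘(ℝ, E) c s) {x : M}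
    (hx : c s ∈ (chartAt E x).source) :
    coframe x (c s) (velocity c s) = deriv (fun s ↦ (coord x (c s) : E)) s := by
  rw [velocity_eq_frame hc hx, coframe_frame hx]

theorem hasDerivAt_coframe_velocity {c : ℝ → M} {s : ℝ}
    (hc : ContMDiffAt 𝓘(ℝ, ℝ) 𝓘(ℝ, E) 2 c s) {x : M} (hx : c s ∈ (chartAt E x).source) :
    HasDerivAt (fun r ↦ coframe x (c r) (velocity (E := E) c r))
      (deriv (deriv (fun s ↦ (coord x (c s) : E))) s) s := by
  have h1 := ((contDiffAt_deriv (contDiffAt_coord_curve hc hx)).differentiableAt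
    (by norm_num)).hasDerivAt
  refine h1.congr_of_eventuallyEq ?_
  filter_upwards [(contMDiffAt_iff_contMDiffAt_nhds (by simp)).1 hc,
    hc.continuousAt.eventually (source_mem_nhds hx)] with r hr hrx
  exact coframe_velocity (hr.mdifferentiableAt (by norm_num)) hrx

/-- The acceleration of a curve in a chart. -/
theorem coframe_acceleration {c : ℝ → M} {s : ℝ} (hc : ContMDiffAt 𝓘(ℝ, ℝ) 𝓘(ℝ, E) 2 c s) {x : M}
    (hx : c s ∈ (chartAt E x).source) :
    coframe x (c s) (covDerivAlong c (velocity (E := E) c) s) =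
      deriv (deriv (fun s ↦ (coord x (c s) : E))) s + christoffelCoeff x (coord x (c s))
        (deriv (fun s ↦ (coord x (c s) : E)) s) (deriv (fun s ↦ (coord x (c s) : E)) s) := by
  have hd := hc.mdifferentiableAt (by norm_num)
  rw [covDerivAlong_eq_frame hd hx (hasDerivAt_coframe_velocity hc hx), coframe_frame hx,
    coframe_velocity hd hx]

end

variable {M : Type*} [MetricSpace M] [ChartedSpace E M] [IsManifold 𝓘(ℝ, E) ∞ M]
  [RiemannianBundle (fun x : M ↦ TangentSpace 𝓘(ℝ, E) x)]
  [IsContMDiffRiemannianBundle 𝓘(ℝ, E) ∞ E (fun x : M ↦ TangentSpace 𝓘(ℝ, E) x)]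
  [IsRiemannianManifold 𝓘(ℝ, E) M] [CompleteSpace M]
  {V : ∀ y : M, TangentSpace 𝓘(ℝ, E) y} {K : ℝ} {φ : ℝ → M → M}

/-- The velocity, at parameter `s`, of the image under `φ t` of the curve `c`. -/
def flowVelocity (φ : ℝ → M → M) (c : ℝ → M) (s t : ℝ) : TangentSpace 𝓘(ℝ, E) (φ t (c s)) :=
  velocity (fun s ↦ φ t (c s)) s

/-- The acceleration, at parameter `s`, of the image under `φ t` of the curve `c`. -/
def flowAcceleration (φ : ℝ → M → M) (c : ℝ → M) (s t : ℝ) : TangentSpace 𝓘(ℝ, E) (φ t (c s)) :=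
  covDerivAlong (fun s ↦ φ t (c s)) (velocity (fun s ↦ φ t (c s))) s

/-- The velocity and the acceleration of the image of a curve under the flow of `V` satisfy the
first and the second variational equation. -/
theorem IsFlow.variation (hφ : IsFlow V φ) (hV : IsC2Field V) (hK0 : 0 ≤ K)
    (hK : ∀ y, ‖V y‖ ≤ K) {c : ℝ → M} {s : ℝ} (hc : ContMDiffAt 𝓘(ℝ, ℝ) 𝓘(ℝ, E) 2 c s) (t : ℝ) :
    (∃ v' : E, HasDerivAt (fun r ↦ coframe (φ t (c s)) (φ r (c s)) (flowVelocity φ c s r)) v' t) ∧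
    (∃ a' : E, HasDerivAt
      (fun r ↦ coframe (φ t (c s)) (φ r (c s)) (flowAcceleration φ c s r)) a' t) ∧
    covDerivAlong (fun r ↦ φ r (c s)) (flowVelocity φ c s) t =
      leviCivita V (φ t (c s)) (flowVelocity φ c s t) ∧
    covDerivAlong (fun r ↦ φ r (c s)) (flowAcceleration φ c s) t =
      secondCovDeriv V (φ t (c s)) (flowVelocity φ c s t) (flowVelocity φ c s t) +
        leviCivita V (φ t (c s)) (flowAcceleration φ c s t) +
        curvature (φ t (c s)) (V (φ t (c s))) (flowVelocity φ c s t) (flowVelocity φ c s t) := by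
  set x := φ t (c s) with hxdef
  have hx := mem_chart_source E x
  -- The chart is centred at φ t (c s), where the coordinate formulas for ∇²V and the curvature
  -- hold.
  obtain ⟨k, hk, hkφ, hk0⟩ := hφ.exists_contDiffAt hV hK0 hK x
  have hcr (r : ℝ) : ContMDiffAt 𝓘(ℝ, ℝ) 𝓘(ℝ, E) 2 (fun s ↦ φ r (c s)) s :=
    ContMDiffAt.comp s (hφ.contMDiff hV hK0 hK r (c s)) hc
  let b : ℝ → E := fun s ↦ coord x (φ t (c s))
  have hbs : b s = coord x x := rfl
  have hb : ContDiffAt ℝ 2 b s := contDiffAt_coord_curve (hcr t) hx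
  let q : ℝ × ℝ → E := fun p ↦ k (p.1 - t, b p.2)
  have hpair : ContDiffAt ℝ 2 (fun p : ℝ × ℝ ↦ (p.1 - t, b p.2)) (t, s) :=
    (contDiffAt_fst.sub contDiffAt_const).prodMk (ContDiffAt.comp (g := b) (t, s) hb contDiffAt_snd)
  have hpair0 : ((fun p : ℝ × ℝ ↦ (p.1 - t, b p.2)) (t, s)) = (0, coord x x) := by
    simp only [sub_self, hbs]
  have hpt : Filter.Tendsto (fun p : ℝ × ℝ ↦ (p.1 - t, b p.2)) (𝓝 (t, s)) (𝓝 (0, coord x x)) :=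
    hpair0 ▸ hpair.continuousAt
  have hq : ContDiffAt ℝ 2 q (t, s) :=
    ContDiffAt.comp (g := k) (t, s) (by simp only [sub_self, hbs]; exact hk) hpair
  let F : ℝ → ℝ → E := fun r s ↦ coord x (φ r (c s))
  have hsrc : ∀ᶠ s' in 𝓝 s, φ t (c s') ∈ (chartAt E x).source :=
    (hcr t).continuousAt.eventually (source_mem_nhds hx)
  -- From φ r = φ (r - t) ∘ φ t and the normal form of the short-time flow, expanded at the points φ
  -- t (c s').
  have hF : ∀ᶠ p : ℝ × ℝ in 𝓝 (t, s), F p.1 p.2 = b p.2 + (p.1 - t) • q p := by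
    filter_upwards [hpt.eventually hkφ, continuous_snd.continuousAt.eventually hsrc] with p h1 h2
    have h3 : pt x (b p.2) = φ t (c p.2) := pt_coord h2
    rw [h3, ← hφ.map_add hV, sub_add_cancel] at h1
    exact h1.2
  obtain ⟨hF0, hF1, hF2⟩ := hasDerivAt_deriv_of_eq_add_smul hb hq hF
  have hV2 : ContDiffAt ℝ 2 (rep x V) (b s) := contDiffAt_rep hV hx
  have hqV : (fun s ↦ q (t, s)) =ᶠ[𝓝 s] fun s ↦ rep x V (b s) := by
    filter_upwards [hb.continuousAt.eventually hk0] with s' hs'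
    simp only [q, sub_self]
    exact hs'
  have hqd : deriv (fun s ↦ q (t, s)) =ᶠ[𝓝 s] deriv fun s ↦ rep x V (b s) := hqV.deriv
  obtain ⟨hW1, hW2⟩ := deriv_comp_eq hb hV2
  have hq0 : q (t, s) = rep x V (b s) := hqV.self_of_nhds
  rw [hq0] at hF0
  rw [hqd.self_of_nhds, hW1] at hF1
  rw [hqd.deriv_eq, hW2] at hF2
  have hγ : MDifferentiableAt 𝓘(ℝ, ℝ) 𝓘(ℝ, E) (fun r ↦ φ r (c s)) t :=
    (hφ.hasMFDerivAt t (c s)).mdifferentiableAt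
  have hsrct : ∀ᶠ r in 𝓝 t, φ r (c s) ∈ (chartAt E x).source :=
    hγ.continuousAt.eventually (source_mem_nhds hx)
  have hS : HasDerivAt (fun r ↦ coframe x (φ r (c s)) (flowVelocity φ c s r))
      (fderiv ℝ (rep x V) (b s) (deriv b s)) t := by
    refine hF1.congr_of_eventuallyEq ?_
    filter_upwards [hsrct] with r hr
    exact coframe_velocity ((hcr r).mdifferentiableAt (by norm_num)) hr
  have hΓ : HasFDerivAt (christoffelCoeff x) (fderiv ℝ (christoffelCoeff x) (coord x x : E))
      (F t s) := (differentiableAt_christoffelCoeff (coord_mem hx)).hasFDerivAt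
  have hFt : F t = b := rfl
  -- The derivative in r of ∂_s²F + Γ(F)(∂_sF, ∂_sF), the acceleration in coordinates.
  have hA := hF2.add (((hΓ.comp_hasDerivAt t hF0).clm_apply hF1).clm_apply hF1)
  have hA' := hA.congr_of_eventuallyEq
    (f₁ := fun r ↦ coframe x (φ r (c s)) (flowAcceleration φ c s r))
    (by
      filter_upwards [hsrct] with r hr
      exact coframe_acceleration (hcr r) hr)
  have hvel : flowVelocity φ c s t = frame x x (deriv b s) := by
    rw [← frame_coframe hx (flowVelocity φ c s t)]
    exact congrArg (frame x x) (coframe_velocity ((hcr t).mdifferentiableAt (by norm_num)) hx)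
  have hacc : flowAcceleration φ c s t = frame x x (deriv (deriv b) s +
      christoffelCoeff x (coord x x) (deriv b s) (deriv b s)) := by
    rw [← frame_coframe hx (flowAcceleration φ c s t)]
    exact congrArg (frame x x) (coframe_acceleration (hcr t) hx)
  have hγd : deriv (fun r ↦ (coord x (φ r (c s)) : E)) t = rep x V (b s) := hF0.deriv
  refine ⟨⟨_, hS⟩, ⟨_, hA'⟩, ?_, ?_⟩
  · rw [covDerivAlong_eq_frame hγ hx hS, hγd]
    change frame x x (_ + christoffelCoeff x (coord x x) _ (coframe x x (flowVelocity φ c s t))) = _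
    rw [hvel, leviCivita_eq_frame hx (hV2.differentiableAt (by norm_num)), coframe_frame hx,
      christoffelCoeff_symm (coord_mem hx)]
  · rw [covDerivAlong_eq_frame hγ hx hA', hγd]
    change frame x x (_ + christoffelCoeff x (coord x x) _
      (coframe x x (flowAcceleration φ c s t))) = _
    rw [hvel, hacc, coframe_frame hx, variation_frame x hV2]
    rfl

end Variation

/-! ## Second-order Taylor bounds along the flow -/

section Bounds

/-- Gronwall: exp(-at)(f + b/a) is nonincreasing. The division forces a > 0, hence the rate 2K + 1
in the applications, where K may be 0. -/
theorem le_exp_mul_of_hasDerivAt_le {f f' : ℝ → ℝ} {a b T t : ℝ} (ha : 0 < a) (hb : 0 ≤ b)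
    (hf : ∀ t, HasDerivAt f (f' t) t) (h : ∀ t ∈ Set.Icc 0 T, f' t ≤ a * f t + b)
    (ht : t ∈ Set.Icc 0 T) : f t ≤ Real.exp (a * t) * (f 0 + b / a) := by
  let g : ℝ → ℝ := fun t ↦ Real.exp (-(a * t)) * (f t + b / a)
  have hg (t : ℝ) : HasDerivAt g (Real.exp (-(a * t)) * (f' t - (a * f t + b))) t := by
    have h1 : HasDerivAt (fun t ↦ Real.exp (-(a * t))) (Real.exp (-(a * t)) * -(a * 1)) t :=
      ((hasDerivAt_id t).const_mul a).fun_neg.exp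
    refine (h1.fun_mul ((hf t).add_const (b / a))).congr_deriv ?_
    field_simp
    ring
  have hanti : AntitoneOn g (Set.Icc 0 T) := by
    refine antitoneOn_of_deriv_nonpos (convex_Icc 0 T)
      (fun t _ ↦ (hg t).continuousAt.continuousWithinAt)
      (fun t _ ↦ (hg t).differentiableAt.differentiableWithinAt) fun t ht ↦ ?_
    rw [(hg t).deriv]
    exact mul_nonpos_of_nonneg_of_nonpos (Real.exp_pos _).le
      (sub_nonpos.2 (h t (interior_subset ht)))
  have h1 := hanti ⟨le_rfl, ht.1.trans ht.2⟩ ht ht.1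
  simp only [g, mul_zero, neg_zero, Real.exp_zero, one_mul] at h1
  rw [Real.exp_neg, inv_mul_le_iff₀ (Real.exp_pos _)] at h1
  linarith [div_nonneg hb ha.le]

/-- If `h(0) = 0`, `h'(0) = 0` and `|h''| ≤ G` on `[0, ∞)`, then `|h(s)| ≤ G s²`. -/
theorem abs_sub_sub_le_of_hasDerivAt {h h' h'' : ℝ → ℝ} {G : ℝ} (h1 : ∀ s, HasDerivAt h (h' s) s)
    (h2 : ∀ s, HasDerivAt h' (h'' s) s) (hG : ∀ s, 0 ≤ s → |h'' s| ≤ G) {s : ℝ} (hs : 0 ≤ s) :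
    |h s - h 0 - s * h' 0| ≤ G * s ^ 2 := by
  have hG0 : 0 ≤ G := (abs_nonneg _).trans (hG 0 le_rfl)
  have h3 (r : ℝ) (hr : r ∈ Set.Icc 0 s) : |h' r - h' 0| ≤ G * s := by
    have h4 := (convex_Icc 0 s).norm_image_sub_le_of_norm_hasDerivWithin_le
      (fun r _ ↦ (h2 r).hasDerivWithinAt) (fun r hr ↦ hG r hr.1)
      (Set.left_mem_Icc.2 hs) hr
    rw [Real.norm_eq_abs, Real.norm_eq_abs, sub_zero, abs_of_nonneg hr.1] at h4
    exact h4.trans (mul_le_mul_of_nonneg_left hr.2 hG0)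
  have h5 (r : ℝ) : HasDerivAt (fun r ↦ h r - r * h' 0) (h' r - h' 0) r := by
    simpa using (h1 r).fun_sub ((hasDerivAt_id r).mul_const (h' 0))
  have h6 := (convex_Icc 0 s).norm_image_sub_le_of_norm_hasDerivWithin_le
    (fun r _ ↦ (h5 r).hasDerivWithinAt) h3 (Set.left_mem_Icc.2 hs) (Set.right_mem_Icc.2 hs)
  rw [Real.norm_eq_abs, Real.norm_eq_abs, sub_zero, abs_of_nonneg hs, zero_mul, sub_zero] at h6
  calc |h s - h 0 - s * h' 0| = |h s - s * h' 0 - h 0| := by congr 1; ring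
    _ ≤ G * s * s := h6
    _ = G * s ^ 2 := by ring

variable {E : Type*} [NormedAddCommGroup E] [NormedSpace ℝ E] [FiniteDimensional ℝ E]

section

variable {M : Type*} [TopologicalSpace M] [ChartedSpace E M] [IsManifold 𝓘(ℝ, E) ∞ M]

theorem hasDerivAt_comp_velocity {u : M → ℝ} {c : ℝ → M} {s : ℝ}
    (hu : MDifferentiableAt 𝓘(ℝ, E) 𝓘(ℝ, ℝ) u (c s))
    (hc : MDifferentiableAt 𝓘(ℝ, ℝ) 𝓘(ℝ, E) c s) :
    HasDerivAt (fun s ↦ u (c s)) (mvfderiv 𝓘(ℝ, E) u (c s) (velocity c s)) s := by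
  have hd : DifferentiableAt ℝ (fun s ↦ u (c s)) s :=
    mdifferentiableAt_iff_differentiableAt.1 (hu.comp s hc)
  have h1 := mfderiv_comp_apply s hu hc (1 : ℝ)
  rw [mfderiv_eq_fderiv] at h1
  exact hd.hasDerivAt.congr_deriv (fderiv_apply_one_eq_deriv.symm.trans h1)

variable [RiemannianBundle (fun x : M ↦ TangentSpace 𝓘(ℝ, E) x)]
  [IsContMDiffRiemannianBundle 𝓘(ℝ, E) ∞ E (fun x : M ↦ TangentSpace 𝓘(ℝ, E) x)]

/-- This is the second derivative of g ∘ c. Since c need not be a geodesic, its acceleration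
contributes besides the Hessian. -/
theorem hasDerivAt_inner_grad_velocity {g : M → ℝ} (hg : ContMDiff 𝓘(ℝ, E) 𝓘(ℝ, ℝ) 2 g)
    {c : ℝ → M} {s : ℝ} (hc : ContMDiffAt 𝓘(ℝ, ℝ) 𝓘(ℝ, E) 2 c s) :
    HasDerivAt (fun s ↦ inner ℝ (grad E g (c s)) (velocity (E := E) c s))
      (inner ℝ (hess (E := E) g (c s) (velocity c s)) (velocity c s) +
        inner ℝ (grad E g (c s)) (covDerivAlong (E := E) c (velocity c) s)) s := by
  have hx := mem_chart_source E (c s)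
  have hd := hc.mdifferentiableAt (by norm_num)
  have hgr := (contDiffAt_rep_grad hx hg).differentiableAt (by norm_num)
  have h1 : HasDerivAt (fun r ↦ rep (c s) (grad E g) (coord (c s) (c r))) _ s :=
    HasFDerivAt.comp_hasDerivAt s (l := rep (c s) (grad E g)) hgr.hasFDerivAt
      ((contDiffAt_coord_curve hc hx).differentiableAt (by norm_num)).hasDerivAt
  have h2 := h1.congr_of_eventuallyEq (f₁ := fun r ↦ coframe (c s) (c r) (grad E g (c r))) (by
    filter_upwards [hc.continuousAt.eventually (source_mem_nhds hx)] with r hr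
    exact (rep_coord hr _).symm)
  have h3 := hasDerivAt_inner_along hd hx h2 (hasDerivAt_coframe_velocity hc hx)
  rwa [covDerivAlong_comp hd (mdifferentiableAt_section_of_rep hx hgr)] at h3

theorem norm_le_of_forall_unit {x : M} {L : TangentSpace 𝓘(ℝ, E) x →L[ℝ] TangentSpace 𝓘(ℝ, E) x}
    {K : ℝ} (hL : ∀ u, ‖u‖ = 1 → ‖L u‖ ≤ K) (u : TangentSpace 𝓘(ℝ, E) x) : ‖L u‖ ≤ |K| * ‖u‖ := by
  rcases eq_or_ne u 0 with rfl | hu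
  · simp
  · have hu' : 0 < ‖u‖ := norm_pos_iff.2 hu
    have h1 := hL (‖u‖⁻¹ • u) (by rw [norm_smul, norm_inv, norm_norm, inv_mul_cancel₀ hu'.ne'])
    rw [map_smul, norm_smul, norm_inv, norm_norm, inv_mul_le_iff₀ hu'] at h1
    rw [mul_comm]
    exact h1.trans (mul_le_mul_of_nonneg_left (le_abs_self K) hu'.le)

/-- The bounds, by `K`, on a vector field `V` of class `C²`, its covariant derivatives and the
curvature in the direction of `V`, which control the variational equations of its flow. -/
structure HasVariationBound (V : ∀ y : M, TangentSpace 𝓘(ℝ, E) y) (K : ℝ) : Prop where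
  isC2Field : IsC2Field V
  nonneg : 0 ≤ K
  norm_le : ∀ y, ‖V y‖ ≤ K
  norm_leviCivita_le : ∀ y u, ‖leviCivita V y u‖ ≤ K * ‖u‖
  norm_secondCovDeriv_le : ∀ y u, ‖secondCovDeriv V y u u‖ ≤ K * ‖u‖ ^ 2
  norm_curvature_le : ∀ y u, ‖curvature y (V y) u u‖ ≤ K * ‖u‖ ^ 2

end

variable {M : Type*} [MetricSpace M] [ChartedSpace E M] [IsManifold 𝓘(ℝ, E) ∞ M]
  [RiemannianBundle (fun x : M ↦ TangentSpace 𝓘(ℝ, E) x)]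
  [IsContMDiffRiemannianBundle 𝓘(ℝ, E) ∞ E (fun x : M ↦ TangentSpace 𝓘(ℝ, E) x)]
  [IsRiemannianManifold 𝓘(ℝ, E) M] [CompleteSpace M]
  {V : ∀ y : M, TangentSpace 𝓘(ℝ, E) y} {K : ℝ} {φ : ℝ → M → M}

/-- By metric compatibility the derivative is 2⟪∇_S V, S⟫ ≤ 2K‖S‖². The rate is weakened to 2K + 1
and the zero term kept to fit the Gronwall lemma. -/
theorem IsFlow.hasDerivAt_normSq_flowVelocity (hφ : IsFlow V φ) (hV : HasVariationBound V K)
    {c : ℝ → M} {s : ℝ} (hc : ContMDiffAt 𝓘(ℝ, ℝ) 𝓘(ℝ, E) 2 c s) (t : ℝ) :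
    ∃ d, HasDerivAt (fun r ↦ ‖flowVelocity (E := E) φ c s r‖ ^ 2) d t ∧
      d ≤ (2 * K + 1) * ‖flowVelocity (E := E) φ c s t‖ ^ 2 + 0 := by
  obtain ⟨⟨v', hv⟩, -, hS, -⟩ := hφ.variation hV.isC2Field hV.nonneg hV.norm_le hc t
  have h1 := hasDerivAt_inner_along (hφ.hasMFDerivAt t (c s)).mdifferentiableAt
    (mem_chart_source E _) hv hv
  simp only [real_inner_self_eq_norm_sq] at h1
  refine ⟨_, h1, ?_⟩
  rw [hS, real_inner_comm]
  have h2 := real_inner_le_norm (flowVelocity φ c s t)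
    (leviCivita V (φ t (c s)) (flowVelocity φ c s t))
  have h3 := mul_le_mul_of_nonneg_left (hV.norm_leviCivita_le _ (flowVelocity φ c s t))
    (norm_nonneg (flowVelocity (E := E) φ c s t))
  nlinarith [sq_nonneg ‖flowVelocity (E := E) φ c s t‖]

/-- The equation for A is linear in A up to a forcing by ∇²V(S, S) and R(V, S)S, each of norm at
most KQ. Squared norms are used because they are differentiable also where A vanishes. -/
theorem IsFlow.hasDerivAt_normSq_flowAcceleration (hφ : IsFlow V φ) (hV : HasVariationBound V K)
    {c : ℝ → M} {s : ℝ} (hc : ContMDiffAt 𝓘(ℝ, ℝ) 𝓘(ℝ, E) 2 c s) (t : ℝ) {Q : ℝ}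
    (hQ : ‖flowVelocity (E := E) φ c s t‖ ^ 2 ≤ Q) :
    ∃ d, HasDerivAt (fun r ↦ ‖flowAcceleration (E := E) φ c s r‖ ^ 2) d t ∧
      d ≤ (2 * K + 1) * ‖flowAcceleration (E := E) φ c s t‖ ^ 2 + (2 * K * Q) ^ 2 := by
  obtain ⟨-, ⟨a', ha⟩, -, hA⟩ := hφ.variation hV.isC2Field hV.nonneg hV.norm_le hc t
  have h1 := hasDerivAt_inner_along (hφ.hasMFDerivAt t (c s)).mdifferentiableAt
    (mem_chart_source E _) ha ha
  simp only [real_inner_self_eq_norm_sq] at h1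
  refine ⟨_, h1, ?_⟩
  rw [real_inner_comm]
  set A := flowAcceleration (E := E) φ c s t
  set S := flowVelocity (E := E) φ c s t
  set B := covDerivAlong (fun r ↦ φ r (c s)) (flowAcceleration (E := E) φ c s) t
  have h2 : ‖B‖ ≤ K * Q + K * ‖A‖ + K * Q := by
    rw [hA]
    have hKQ : K * ‖S‖ ^ 2 ≤ K * Q := mul_le_mul_of_nonneg_left hQ hV.nonneg
    refine (norm_add₃_le).trans (add_le_add_three ?_ ?_ ?_)
    · exact (hV.norm_secondCovDeriv_le _ _).trans hKQ
    · exact hV.norm_leviCivita_le _ _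
    · exact (hV.norm_curvature_le _ _).trans hKQ
  have h3 : inner ℝ A B ≤ ‖A‖ * (K * Q + K * ‖A‖ + K * Q) :=
    (real_inner_le_norm A B).trans (mul_le_mul_of_nonneg_left h2 (norm_nonneg A))
  -- Young's inequality 2‖A‖·2KQ ≤ ‖A‖² + (2KQ)² accounts for the extra 1 in the rate and for the
  -- additive constant.
  nlinarith [sq_nonneg (‖A‖ - 2 * K * Q)]

/-- Two Gronwall estimates in cascade: the bound Q on ‖S‖² feeds the forcing term for A. G is the
sum of the two bounds. -/
theorem IsFlow.exists_bound_variation (hφ : IsFlow V φ) (hV : HasVariationBound V K) (T D : ℝ) :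
    ∃ G, 0 ≤ G ∧ ∀ t ∈ Set.Icc 0 T, ∀ (c : ℝ → M) (s : ℝ), ContMDiffAt 𝓘(ℝ, ℝ) 𝓘(ℝ, E) 2 c s →
      ‖velocity (E := E) c s‖ ≤ D → ‖covDerivAlong (E := E) c (velocity c) s‖ ≤ D →
      ‖flowVelocity (E := E) φ c s t‖ ^ 2 ≤ G ∧ ‖flowAcceleration (E := E) φ c s t‖ ^ 2 ≤ G := by
  have hK := hV.nonneg
  have ha : 0 < 2 * K + 1 := by positivity
  set L := Real.exp ((2 * K + 1) * T)
  set Q := L * D ^ 2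
  refine ⟨Q + L * (D ^ 2 + (2 * K * Q) ^ 2 / (2 * K + 1)), by positivity,
    fun t ht c s hc hv hacc ↦ ?_⟩
  have hφ0 : (fun s ↦ φ 0 (c s)) = c := funext fun s ↦ hφ.map_zero (c s)
  -- φ 0 ∘ c equals c but not by definition, and the types of velocities depend on the curve, so the
  -- initial bounds are moved along the equality.
  have hinit (c' : ℝ → M) (h : c' = c) : ‖velocity (E := E) c' s‖ ≤ D ∧
      ‖covDerivAlong (E := E) c' (velocity c') s‖ ≤ D := by
    subst h
    exact ⟨hv, hacc⟩
  have hS0 : ‖flowVelocity (E := E) φ c s 0‖ ^ 2 ≤ D ^ 2 :=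
    pow_le_pow_left₀ (norm_nonneg _) (hinit _ hφ0).1 2
  have hA0 : ‖flowAcceleration (E := E) φ c s 0‖ ^ 2 ≤ D ^ 2 :=
    pow_le_pow_left₀ (norm_nonneg _) (hinit _ hφ0).2 2
  have hexp (t : ℝ) (ht : t ∈ Set.Icc 0 T) : Real.exp ((2 * K + 1) * t) ≤ L :=
    Real.exp_le_exp.2 (mul_le_mul_of_nonneg_left ht.2 ha.le)
  have hS (t : ℝ) (ht : t ∈ Set.Icc 0 T) : ‖flowVelocity (E := E) φ c s t‖ ^ 2 ≤ Q := by
    choose d hd hle using hφ.hasDerivAt_normSq_flowVelocity hV hc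
    refine (le_exp_mul_of_hasDerivAt_le ha le_rfl hd (fun t _ ↦ hle t) ht).trans ?_
    rw [zero_div, add_zero]
    exact mul_le_mul (hexp t ht) hS0 (sq_nonneg _) (Real.exp_pos _).le
  have hA (t : ℝ) (ht : t ∈ Set.Icc 0 T) : ‖flowAcceleration (E := E) φ c s t‖ ^ 2 ≤
      L * (D ^ 2 + (2 * K * Q) ^ 2 / (2 * K + 1)) := by
    -- Differentiability is needed at all times, while ‖S‖² ≤ Q holds only on [0, T]. Each t
    -- therefore first gets its own value ‖S‖² as bound.
    choose d hd hle using fun t ↦ hφ.hasDerivAt_normSq_flowAcceleration hV hc t (le_refl _)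
    refine (le_exp_mul_of_hasDerivAt_le ha (sq_nonneg (2 * K * Q)) hd (fun t ht ↦
      (hle t).trans ?_) ht).trans ?_
    · have := hS t ht
      gcongr
    · gcongr
      exact hexp t ht
  exact ⟨(hS t ht).trans (le_add_of_nonneg_right (by positivity)),
    (hA t ht).trans (le_add_of_nonneg_left (by positivity))⟩

/-- Second-order Taylor bound for `g ∘ φ t` along curves with bounded velocity and acceleration,
uniform in `t ∈ [0, T]` and in the curve. -/
theorem IsFlow.exists_taylor_bound (hφ : IsFlow V φ) (hV : HasVariationBound V K) (T D : ℝ)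
    {g : M → ℝ} (hg : IsC2Bounded E g) :
    ∃ G, 0 ≤ G ∧ ∀ t ∈ Set.Icc 0 T, ∀ c : ℝ → M, ContMDiff 𝓘(ℝ, ℝ) 𝓘(ℝ, E) 2 c →
      (∀ s, 0 ≤ s → ‖velocity (E := E) c s‖ ≤ D ∧ ‖covDerivAlong (E := E) c (velocity c) s‖ ≤ D) →
      ∀ s, 0 ≤ s → |g (φ t (c s)) - g (φ t (c 0)) -
        s * deriv (fun s ↦ g (φ t (c s))) 0| ≤ G * s ^ 2 := by
  obtain ⟨Kg, hKg⟩ := hg.bounded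
  obtain ⟨G, hG0, hG⟩ := hφ.exists_bound_variation hV T D
  refine ⟨|Kg| * G + |Kg| * (1 + G), by positivity, fun t ht c hc hcb s hs ↦ ?_⟩
  have hflow := hφ.contMDiff hV.isC2Field hV.nonneg hV.norm_le t
  have hcomp : ContMDiff 𝓘(ℝ, ℝ) 𝓘(ℝ, E) 2 (fun s ↦ φ t (c s)) := hflow.comp hc
  have h1 (s : ℝ) : HasDerivAt (fun s ↦ g (φ t (c s)))
      (inner ℝ (grad E g (φ t (c s))) (flowVelocity (E := E) φ c s t)) s := by
    rw [inner_grad]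
    exact hasDerivAt_comp_velocity ((hg.contMDiff _).mdifferentiableAt (by norm_num))
      ((hcomp s).mdifferentiableAt (by norm_num))
  have h2 (s : ℝ) : HasDerivAt
      (fun s ↦ inner ℝ (grad E g (φ t (c s))) (flowVelocity (E := E) φ c s t))
      (inner ℝ (hess g (φ t (c s)) (flowVelocity φ c s t)) (flowVelocity φ c s t) +
        inner ℝ (grad E g (φ t (c s))) (flowAcceleration φ c s t)) s :=
    hasDerivAt_inner_grad_velocity hg.contMDiff (hcomp s)
  rw [(h1 0).deriv]
  refine abs_sub_sub_le_of_hasDerivAt h1 h2 (fun s hs ↦ ?_) hs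
  obtain ⟨hS, hA⟩ := hG t ht c s (hc s) (hcb s hs).1 (hcb s hs).2
  obtain ⟨-, hgr, hhess⟩ := hKg (φ t (c s))
  set x := φ t (c s)
  set S := flowVelocity (E := E) φ c s t
  set A := flowAcceleration (E := E) φ c s t
  have hH : ‖hess (E := E) g x S‖ ≤ |Kg| * ‖S‖ := norm_le_of_forall_unit hhess S
  -- From 2‖A‖ ≤ 1 + ‖A‖² and ‖A‖² ≤ G.
  have hA1 : ‖A‖ ≤ 1 + G := by nlinarith [sq_nonneg (‖A‖ - 1)]
  refine (abs_add_le _ _).trans (add_le_add ?_ ?_)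
  · refine (abs_real_inner_le_norm _ _).trans ?_
    calc ‖hess (E := E) g x S‖ * ‖S‖ ≤ |Kg| * ‖S‖ * ‖S‖ :=
          mul_le_mul_of_nonneg_right hH (norm_nonneg _)
      _ = |Kg| * ‖S‖ ^ 2 := by ring
      _ ≤ |Kg| * G := mul_le_mul_of_nonneg_left hS (abs_nonneg _)
  · refine (abs_real_inner_le_norm _ _).trans ?_
    exact mul_le_mul (hgr.trans (le_abs_self _)) hA1 (norm_nonneg _) (abs_nonneg _)


end Bounds

/-! ## The negative of a bounded vector field -/

section Neg

variable {E : Type*} [NormedAddCommGroup E] [NormedSpace ℝ E] [FiniteDimensional ℝ E]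
  {M : Type*} [TopologicalSpace M] [ChartedSpace E M] [IsManifold 𝓘(ℝ, E) ∞ M]

theorem rep_neg (x : M) (V : ∀ y : M, TangentSpace 𝓘(ℝ, E) y) :
    rep x (fun y ↦ -V y) = -rep x V := by
  funext z
  exact map_neg _ _

theorem IsC2Field.neg {V : ∀ y : M, TangentSpace 𝓘(ℝ, E) y} (hV : IsC2Field V) :
    IsC2Field (fun y ↦ -V y) := by
  intro y
  rw [contMDiffAt_section_iff_rep two_le_infty (mem_chart_source E y), rep_neg]
  exact (contDiffAt_rep hV (mem_chart_source E y)).neg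

variable [RiemannianBundle (fun x : M ↦ TangentSpace 𝓘(ℝ, E) x)]
  [IsContMDiffRiemannianBundle 𝓘(ℝ, E) ∞ E (fun x : M ↦ TangentSpace 𝓘(ℝ, E) x)]
  {V : ∀ y : M, TangentSpace 𝓘(ℝ, E) y}

theorem leviCivita_neg (hV : IsC2Field V) (x : M) (u : TangentSpace 𝓘(ℝ, E) x) :
    leviCivita (fun y ↦ -V y) x u = -leviCivita V x u := by
  have hx := mem_chart_source E x
  have h1 := (contDiffAt_rep hV hx).differentiableAt (by norm_num)
  have h2 := (contDiffAt_rep hV.neg hx).differentiableAt (by norm_num)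
  rw [← frame_coframe hx u, leviCivita_eq_frame hx h1, leviCivita_eq_frame hx h2, rep_neg,
    ← map_neg]
  congr 1
  simp only [fderiv_neg, Pi.neg_apply, neg_apply, map_neg]
  abel

theorem secondCovDeriv_neg (hV : IsC2Field V) (x : M) (u w : TangentSpace 𝓘(ℝ, E) x) :
    secondCovDeriv (fun y ↦ -V y) x u w = -secondCovDeriv V x u w := by
  have hx := mem_chart_source E x
  have h3 : fderiv ℝ (-rep x V) = -fderiv ℝ (rep x V) := by
    funext z; exact fderiv_neg
  rw [← frame_coframe hx u, ← frame_coframe hx w, secondCovDeriv_frame x (contDiffAt_rep hV hx),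
    secondCovDeriv_frame x (contDiffAt_rep hV.neg hx), rep_neg, ← map_neg, h3, fderiv_neg]
  congr 1
  simp only [Pi.neg_apply, neg_apply, map_neg, map_add]
  abel

/-- `secondCovDeriv` is not bundled as a bilinear map; this homogeneity is what carries the bound
from unit vectors to all vectors, and r = 0 settles the zero vector. -/
theorem secondCovDeriv_smul_smul (hV : IsC2Field V) (x : M) (r : ℝ)
    (u : TangentSpace 𝓘(ℝ, E) x) :
    secondCovDeriv V x (r • u) (r • u) = r ^ 2 • secondCovDeriv V x u u := by
  have hx := mem_chart_source E x
  have h := contDiffAt_rep hV hx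
  rw [← frame_coframe hx u, ← map_smul, secondCovDeriv_frame x h, secondCovDeriv_frame x h]
  simp only [map_smul, _root_.smul_apply, smul_smul, ← pow_two]
  rw [← map_smul (frame x x)]
  congr 1
  simp only [map_add, map_smul, smul_add, smul_sub, smul_smul, ← pow_two]

theorem hasVariationBound_neg (hR : BoundedCurvature E M) (hV : IsC2BoundedVectorField V) :
    ∃ K, HasVariationBound (fun y ↦ -V y) K := by
  obtain ⟨R, hR⟩ := hR
  obtain ⟨K, hK⟩ := hV.bounded
  -- The summand |K| serves V, ∇V and ∇²V; |R||K| serves the curvature with V in its first slot.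
  refine ⟨|K| + |R| * |K|, ?_, by positivity, fun y ↦ ?_, fun y u ↦ ?_, fun y u ↦ ?_, fun y u ↦ ?_⟩
  · exact IsC2Field.neg hV.contMDiff
  · rw [norm_neg]
    exact ((hK y).1.trans (le_abs_self K)).trans (le_add_of_nonneg_right (by positivity))
  · rw [leviCivita_neg hV.contMDiff, norm_neg]
    exact (norm_le_of_forall_unit (hK y).2.1 u).trans
      (by gcongr; exact le_add_of_nonneg_right (by positivity))
  · rw [secondCovDeriv_neg hV.contMDiff, norm_neg]
    have h1 : ‖secondCovDeriv V y u u‖ ≤ |K| * ‖u‖ ^ 2 := by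
      rcases eq_or_ne u 0 with rfl | hu
      · have h2 := secondCovDeriv_smul_smul hV.contMDiff y 0 (0 : TangentSpace 𝓘(ℝ, E) y)
        rw [zero_smul, zero_pow two_ne_zero, zero_smul] at h2
        rw [h2]
        simp
      · have hu' : 0 < ‖u‖ := norm_pos_iff.2 hu
        have hunit : ‖‖u‖⁻¹ • u‖ = 1 := by
          rw [norm_smul, norm_inv, norm_norm, inv_mul_cancel₀ hu'.ne']
        have h2 := (hK y).2.2 (‖u‖⁻¹ • u) (‖u‖⁻¹ • u) hunit hunit
        rw [secondCovDeriv_smul_smul hV.contMDiff, norm_smul, norm_pow, norm_inv, norm_norm,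
          inv_pow, inv_mul_le_iff₀ (by positivity)] at h2
        rw [mul_comm]
        exact h2.trans (mul_le_mul_of_nonneg_left (le_abs_self K) (by positivity))
    exact h1.trans (by gcongr; exact le_add_of_nonneg_right (by positivity))
  · have h1 := hR y (-V y) u u
    rw [norm_neg] at h1
    have h2 : R * ‖V y‖ * ‖u‖ * ‖u‖ ≤ |R| * |K| * ‖u‖ * ‖u‖ := by
      gcongr
      · exact le_abs_self R
      · exact (hK y).1.trans (le_abs_self K)
    calc ‖curvature y (-V y) u u‖ ≤ |R| * |K| * ‖u‖ * ‖u‖ := h1.trans h2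
      _ = |R| * |K| * ‖u‖ ^ 2 := by ring
      _ ≤ (|K| + |R| * |K|) * ‖u‖ ^ 2 := by
        gcongr; exact le_add_of_nonneg_left (by positivity)

end Neg

/-! ## One step of the scheme and one step of the flow -/

section OneStep

variable {E : Type*} [NormedAddCommGroup E] [NormedSpace ℝ E] [FiniteDimensional ℝ E]

section

variable {M : Type*} [TopologicalSpace M] [ChartedSpace E M] [IsManifold 𝓘(ℝ, E) ∞ M]

theorem triv_smul {x y : M} (hy : y ∈ (chartAt E x).source) (r : ℝ) (v : TangentSpace 𝓘(ℝ, E) y) :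
    (trivializationAt E (TangentSpace 𝓘(ℝ, E)) x ⟨y, r • v⟩).2 =
      r • (trivializationAt E (TangentSpace 𝓘(ℝ, E)) x ⟨y, v⟩).2 := by
  rw [← coframe_apply hy, ← coframe_apply hy, map_smul]

theorem contMDiff_smul_fiber (y : M) (v : TangentSpace 𝓘(ℝ, E) y) :
    ContMDiff 𝓘(ℝ, ℝ) 𝓘(ℝ, E).tangent 2 (fun s : ℝ ↦ (⟨y, s • v⟩ : TangentBundle 𝓘(ℝ, E) M)) := by
  intro s
  rw [contMDiffAt_totalSpace]
  refine ⟨contMDiffAt_const, ?_⟩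
  simp only [triv_smul (mem_chart_source E y)]
  exact ContDiffAt.contMDiffAt (contDiffAt_id.smul contDiffAt_const)

theorem continuous_smul_totalSpace (r : ℝ) : Continuous fun p : TangentBundle 𝓘(ℝ, E) M ↦
    (⟨p.1, r • p.2⟩ : TangentBundle 𝓘(ℝ, E) M) := by
  rw [continuous_iff_continuousAt]
  intro p
  have hproj : ContinuousAt (fun p : TangentBundle 𝓘(ℝ, E) M ↦ p.1) p :=
    (FiberBundle.continuous_proj E (TangentSpace 𝓘(ℝ, E))).continuousAt
  rw [FiberBundle.continuousAt_totalSpace]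
  refine ⟨hproj, ?_⟩
  have h1 : ContinuousAt (fun q : TangentBundle 𝓘(ℝ, E) M ↦
      r • (trivializationAt E (TangentSpace 𝓘(ℝ, E)) p.1 q).2) p := by
    have h2 := ((FiberBundle.continuousAt_totalSpace E
      (fun q : TangentBundle 𝓘(ℝ, E) M ↦ q)).1 (continuousAt_id (x := p))).2
    exact h2.const_smul r
  refine h1.congr_of_eventuallyEq ?_
  filter_upwards [hproj.eventually (source_mem_nhds (mem_chart_source E p.1))] with q hq
  exact triv_smul hq r q.2

variable [RiemannianBundle (fun x : M ↦ TangentSpace 𝓘(ℝ, E) x)]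
  [IsContMDiffRiemannianBundle 𝓘(ℝ, E) ∞ E (fun x : M ↦ TangentSpace 𝓘(ℝ, E) x)]
  {retr : TangentBundle 𝓘(ℝ, E) M → M}

/-- The only use of D_0 retr_y = id: to first order the retraction moves in the direction v. -/
theorem IsUniformFirstOrderRetraction.deriv_comp (hretr : IsUniformFirstOrderRetraction retr)
    {u : M → ℝ} (hu : ContMDiff 𝓘(ℝ, E) 𝓘(ℝ, ℝ) 2 u) (y : M) (v : TangentSpace 𝓘(ℝ, E) y) :
    deriv (fun s : ℝ ↦ u (retr ⟨y, s • v⟩)) 0 = mvfderiv 𝓘(ℝ, E) u y v := by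
  let D : E →L[ℝ] ℝ := mvfderiv 𝓘(ℝ, E) u y
  -- The chain rule wants the derivative of u at retr ⟨y, 0⟩, which equals y only by a hypothesis.
  have hu' (y' : M) (h : y' = y) : HasMFDerivAt 𝓘(ℝ, E) 𝓘(ℝ, ℝ) u y' D := by
    subst h
    exact ((hu y').mdifferentiableAt (by norm_num)).hasMFDerivAt
  have h1 := HasMFDerivAt.comp (0 : E) (hu' _ (hretr.map_zero y)) (hretr.hasMFDerivAt_zero y)
  have h2 : HasFDerivAt (fun w : E ↦ u (retr ⟨y, w⟩)) D 0 := hasMFDerivAt_iff_hasFDerivAt.1 h1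
  have h3 : HasDerivAt (fun s : ℝ ↦ s • (v : E)) v 0 := by
    have := (hasDerivAt_id (0 : ℝ)).smul_const (v : E)
    rwa [one_smul] at this
  have h4 : HasFDerivAt (fun w : E ↦ u (retr ⟨y, w⟩)) D ((0 : ℝ) • (v : E)) := by
    rwa [zero_smul]
  exact (h4.comp_hasDerivAt (0 : ℝ) h3).deriv

end

variable {M : Type*} [MetricSpace M] [ChartedSpace E M] [IsManifold 𝓘(ℝ, E) ∞ M]
  [RiemannianBundle (fun x : M ↦ TangentSpace 𝓘(ℝ, E) x)]
  [IsContMDiffRiemannianBundle 𝓘(ℝ, E) ∞ E (fun x : M ↦ TangentSpace 𝓘(ℝ, E) x)]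
  [IsRiemannianManifold 𝓘(ℝ, E) M] [CompleteSpace M]
  {V : ∀ y : M, TangentSpace 𝓘(ℝ, E) y} {K : ℝ} {φ : ℝ → M → M}
  {retr : TangentBundle 𝓘(ℝ, E) M → M}

theorem IsFlow.deriv_comp (hφ : IsFlow V φ) {u : M → ℝ} (hu : ContMDiff 𝓘(ℝ, E) 𝓘(ℝ, ℝ) 2 u)
    (y : M) : deriv (fun s : ℝ ↦ u (φ s y)) 0 = mvfderiv 𝓘(ℝ, E) u y (V y) := by
  have h1 := hasDerivAt_comp_velocity (s := 0) ((hu (φ 0 y)).mdifferentiableAt (by norm_num))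
    (hφ.hasMFDerivAt 0 y).mdifferentiableAt
  rw [hφ.velocity_eq] at h1
  have h2 (y' : M) (h : y' = y) : mvfderiv 𝓘(ℝ, E) u y' (V y') = mvfderiv 𝓘(ℝ, E) u y (V y) := by
    rw [h]
  exact h1.deriv.trans (h2 _ (hφ.map_zero y))

/-- The acceleration of a trajectory is ∇_V V. Trajectories are thus admissible curves in
`IsFlow.exists_taylor_bound`. -/
theorem IsFlow.norm_velocity_le (hφ : IsFlow V φ) (hV : HasVariationBound V K) (y : M) (s : ℝ) :
    ‖velocity (E := E) (fun s ↦ φ s y) s‖ ≤ K ∧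
      ‖covDerivAlong (E := E) (fun s ↦ φ s y) (velocity (fun s ↦ φ s y)) s‖ ≤ K * K := by
  have h1 : (fun s ↦ velocity (E := E) (fun s ↦ φ s y) s) = fun s ↦ V (φ s y) :=
    funext fun s ↦ hφ.velocity_eq s y
  have h2 := covDerivAlong_comp (hφ.hasMFDerivAt s y).mdifferentiableAt
    ((hV.isC2Field (φ s y)).mdifferentiableAt (by norm_num))
  refine ⟨?_, ?_⟩
  · rw [hφ.velocity_eq]; exact hV.norm_le _
  · change ‖covDerivAlong (E := E) (fun s ↦ φ s y) (fun s ↦ velocity (fun s ↦ φ s y) s) s‖ ≤ K * K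
    rw [h1, h2, hφ.velocity_eq]
    exact (hV.norm_leviCivita_le _ _).trans (mul_le_mul_of_nonneg_left (hV.norm_le _) hV.nonneg)

/-- For `u = g ∘ φ t`, first-order expansions with quadratic remainder of `u` along one step of the
retraction and along the flow, uniformly in `t ∈ [0, T]` and in the base point. -/
theorem IsFlow.exists_step_bound (hφ : IsFlow V φ) (hV : HasVariationBound V K)
    (hretr : IsUniformFirstOrderRetraction retr) (T : ℝ) {g : M → ℝ} (hg : IsC2Bounded E g) :
    ∃ G, 0 ≤ G ∧ ∀ t ∈ Set.Icc 0 T, ∀ y : M,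
      (∀ η, 0 ≤ η → ∀ w : TangentSpace 𝓘(ℝ, E) y, |g (φ t (retr ⟨y, -η • w⟩)) - g (φ t y) +
        η * mvfderiv 𝓘(ℝ, E) (fun y ↦ g (φ t y)) y w| ≤ G * (η ^ 2 * ‖w‖ ^ 2)) ∧
      ∀ η, 0 ≤ η → |g (φ (t + η) y) - g (φ t y) -
        η * mvfderiv 𝓘(ℝ, E) (fun y ↦ g (φ t y)) y (V y)| ≤ G * η ^ 2 := by
  obtain ⟨C, hC⟩ := hretr.bounded
  have hK := hV.nonneg
  -- This D dominates the bounds for the retraction curves (C) and for the trajectories (K and K²)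
  -- simultaneously.
  obtain ⟨G, hG0, hG⟩ := hφ.exists_taylor_bound hV T (|C| + K + K * K) hg
  refine ⟨G, hG0, fun t ht y ↦ ?_⟩
  have hu : ContMDiff 𝓘(ℝ, E) 𝓘(ℝ, ℝ) 2 (fun y ↦ g (φ t y)) :=
    hg.contMDiff.comp (hφ.contMDiff hV.isC2Field hV.nonneg hV.norm_le t)
  have hKK : 0 ≤ K * K := mul_nonneg hK hK
  refine ⟨fun η hη w ↦ ?_, fun η hη ↦ ?_⟩
  · rcases eq_or_ne w 0 with rfl | hw
    · have h0 : retr ⟨y, -η • (0 : TangentSpace 𝓘(ℝ, E) y)⟩ = y := by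
        rw [smul_zero]; exact hretr.map_zero y
      rw [h0, _root_.map_zero, sub_self, mul_zero, add_zero, abs_zero]
      positivity
    · have hw' : 0 < ‖w‖ := norm_pos_iff.2 hw
      -- The retraction is controlled along unit directions at nonnegative times only, so -ηw is
      -- reached in direction -w/‖w‖ at time η‖w‖.
      have hunit : ‖(-‖w‖⁻¹) • w‖ = 1 := by
        rw [norm_smul, norm_neg, norm_inv, norm_norm, inv_mul_cancel₀ hw'.ne']
      have hs : (η * ‖w‖) • ((-‖w‖⁻¹) • w) = -η • w := by
        rw [smul_smul]; congr 1; field_simp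
      have h1 := hG t ht (fun s : ℝ ↦ retr ⟨y, s • ((-‖w‖⁻¹) • w)⟩)
        (hretr.contMDiff.comp (contMDiff_smul_fiber y _)) (fun s hs ↦ ?_) (η * ‖w‖) (by positivity)
      · have h0 : retr ⟨y, (0 : ℝ) • ((-‖w‖⁻¹) • w)⟩ = y := by
          rw [zero_smul]; exact hretr.map_zero y
        rw [hretr.deriv_comp hu y, hs, h0, map_smul, smul_eq_mul] at h1
        have h2 : η * ‖w‖ * (-‖w‖⁻¹ * mvfderiv 𝓘(ℝ, E) (fun y ↦ g (φ t y)) y w) =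
            -(η * mvfderiv 𝓘(ℝ, E) (fun y ↦ g (φ t y)) y w) := by field_simp
        rw [h2, sub_neg_eq_add, mul_pow] at h1
        exact h1
      · obtain ⟨h1, h2⟩ := hC y _ hunit s hs
        have := le_abs_self C
        exact ⟨h1.trans (by linarith), h2.trans (by linarith)⟩
  · have h1 := hG t ht (fun s : ℝ ↦ φ s y)
      (hφ.contMDiff_time hV.isC2Field hV.nonneg hV.norm_le y) (fun s _ ↦ ?_) η hη
    · rw [hφ.deriv_comp hu, hφ.map_zero, ← hφ.map_add hV.isC2Field] at h1
      exact h1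
    · obtain ⟨h1, h2⟩ := hφ.norm_velocity_le hV y s
      have := abs_nonneg C
      exact ⟨h1.trans (by linarith), h2.trans (by linarith)⟩

end OneStep

/-! ## Measurability and integrability of the gradient estimator -/

section Estimator

variable {E : Type*} [NormedAddCommGroup E] [NormedSpace ℝ E] [FiniteDimensional ℝ E]
  {M : Type*} [TopologicalSpace M] [ChartedSpace E M] [IsManifold 𝓘(ℝ, E) ∞ M]
  [MeasurableSpace M] [BorelSpace M] {Ξ : Type*} [MeasurableSpace Ξ]
  {F : ∀ x : M, Ξ → TangentSpace 𝓘(ℝ, E) x}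

theorem measurable_step
    (hF : @Measurable (M × Ξ) (TangentBundle 𝓘(ℝ, E) M) inferInstance (borel _)
      (fun p ↦ ⟨p.1, F p.1 p.2⟩))
    {retr : TangentBundle 𝓘(ℝ, E) M → M} (hretr : Continuous retr) (r : ℝ) :
    Measurable fun p : M × Ξ ↦ retr ⟨p.1, r • F p.1 p.2⟩ := by
  borelize (TangentBundle 𝓘(ℝ, E) M)
  exact (hretr.comp (continuous_smul_totalSpace r)).measurable.comp hF

variable [RiemannianBundle (fun x : M ↦ TangentSpace 𝓘(ℝ, E) x)] {θ : Measure Ξ}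

/-- The inclusion of a fibre into the tangent bundle is inducing, so the Borel σ-algebra of the
fibre is pulled back from the bundle. Finite dimension then upgrades measurability to strong
measurability. -/
theorem aestronglyMeasurable_estimator
    (hF : @Measurable (M × Ξ) (TangentBundle 𝓘(ℝ, E) M) inferInstance (borel _)
      (fun p ↦ ⟨p.1, F p.1 p.2⟩)) (y : M) : AEStronglyMeasurable (F y) θ := by
  have h1 : @Measurable Ξ (TangentBundle 𝓘(ℝ, E) M) _ (borel _) (fun s ↦ ⟨y, F y s⟩) :=
    hF.comp measurable_prodMk_left
  have h2 : Topology.IsInducing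
      (TotalSpace.mk y : TangentSpace 𝓘(ℝ, E) y → TangentBundle 𝓘(ℝ, E) M) :=
    FiberBundle.totalSpaceMk_isInducing E (TangentSpace 𝓘(ℝ, E)) y
  have h3 : @Measurable Ξ (TangentSpace 𝓘(ℝ, E) y) _ (borel _) (F y) := by
    rw [h2.eq_induced, borel_comap]
    exact measurable_comap_iff.2 h1
  have : ProperSpace (TangentSpace 𝓘(ℝ, E) y) := FiniteDimensional.proper ℝ _
  borelize (TangentSpace 𝓘(ℝ, E) y)
  exact h3.stronglyMeasurable.aestronglyMeasurable

theorem memLp_estimator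
    (hF : @Measurable (M × Ξ) (TangentBundle 𝓘(ℝ, E) M) inferInstance (borel _)
      (fun p ↦ ⟨p.1, F p.1 p.2⟩)) (hF_moment : ⨆ x : M, ∫⁻ s, ‖F x s‖ₑ ^ 2 ∂θ < ⊤) (y : M) :
    MemLp (F y) 2 θ := by
  refine ⟨aestronglyMeasurable_estimator hF y, ?_⟩
  rw [eLpNorm_lt_top_iff_lintegral_rpow_enorm_lt_top two_ne_zero ENNReal.ofNat_ne_top]
  have h1 := (le_iSup (fun x : M ↦ ∫⁻ s, ‖F x s‖ₑ ^ 2 ∂θ) y).trans_lt hF_moment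
  simpa using! h1

theorem integral_normSq_estimator_le
    (hF : @Measurable (M × Ξ) (TangentBundle 𝓘(ℝ, E) M) inferInstance (borel _)
      (fun p ↦ ⟨p.1, F p.1 p.2⟩)) (hF_moment : ⨆ x : M, ∫⁻ s, ‖F x s‖ₑ ^ 2 ∂θ < ⊤) (y : M) :
    ∫ s, ‖F y s‖ ^ 2 ∂θ ≤ (⨆ x : M, ∫⁻ s, ‖F x s‖ₑ ^ 2 ∂θ).toReal := by
  rw [integral_eq_lintegral_of_nonneg_ae (Filter.Eventually.of_forall fun s ↦ sq_nonneg _)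
    ((aestronglyMeasurable_estimator hF y).norm.pow 2)]
  refine ENNReal.toReal_mono hF_moment.ne ?_
  refine le_trans (le_of_eq ?_) (le_iSup (fun x : M ↦ ∫⁻ s, ‖F x s‖ₑ ^ 2 ∂θ) y)
  refine lintegral_congr fun s ↦ ?_
  rw [ENNReal.ofReal_pow (norm_nonneg _), ofReal_norm]

end Estimator

/-! ## The iterates -/

section Iterates

variable {E : Type*} [NormedAddCommGroup E] [NormedSpace ℝ E]
  {M : Type*} [TopologicalSpace M] [ChartedSpace E M] [MeasurableSpace M]
  {Ξ Ω : Type*} [MeasurableSpace Ξ] [MeasurableSpace Ω] {P : Measure Ω}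
  {F : ∀ x : M, Ξ → TangentSpace 𝓘(ℝ, E) x} {retr : TangentBundle 𝓘(ℝ, E) M → M}
  {ξ : ℕ → Ω → Ξ} {η : ℝ}

theorem measurable_iterate (hstep : Measurable fun p : M × Ξ ↦ retr ⟨p.1, -η • F p.1 p.2⟩)
    (hξ : ∀ n, Measurable (ξ n)) (x : M) (n : ℕ) : Measurable (iterate retr F ξ η x n) := by
  induction n with
  | zero => exact measurable_const
  | succ n ih => exact hstep.comp (ih.prodMk (hξ n))

/-- The `n`-th iterate is a measurable function of the first `n` samples. -/
theorem exists_iterate_eq_comp (hstep : Measurable fun p : M × Ξ ↦ retr ⟨p.1, -η • F p.1 p.2⟩)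
    (ξ : ℕ → Ω → Ξ) (x : M) (n : ℕ) : ∃ ψ : (Finset.range n → Ξ) → M, Measurable ψ ∧
      iterate retr F ξ η x n = fun o ↦ ψ fun i ↦ ξ i o := by
  induction n with
  | zero => exact ⟨fun _ ↦ x, measurable_const, rfl⟩
  | succ n ih =>
    obtain ⟨ψ, hψ, h⟩ := ih
    have hsub (i : Finset.range n) : (i : ℕ) ∈ Finset.range (n + 1) :=
      Finset.mem_range.2 ((Finset.mem_range.1 i.2).trans n.lt_succ_self)
    refine ⟨fun w ↦ retr ⟨ψ fun i ↦ w ⟨i, hsub i⟩, -η • F (ψ fun i ↦ w ⟨i, hsub i⟩)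
      (w ⟨n, Finset.self_mem_range_succ n⟩)⟩, ?_, ?_⟩
    · refine hstep.comp ((hψ.comp (measurable_pi_lambda _ fun i ↦ ?_)).prodMk ?_)
      · exact measurable_pi_apply _
      · exact measurable_pi_apply _
    · funext o
      rw [iterate, h]

/-- The n-th iterate uses samples with index below n, a set disjoint from {n}. -/
theorem indepFun_iterate (hstep : Measurable fun p : M × Ξ ↦ retr ⟨p.1, -η • F p.1 p.2⟩)
    (hξ : ∀ n, Measurable (ξ n)) (hξ_indep : iIndepFun ξ P) (x : M) (n : ℕ) :
    IndepFun (iterate retr F ξ η x n) (ξ n) P := by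
  obtain ⟨ψ, hψ, h⟩ := exists_iterate_eq_comp hstep ξ x n
  have h1 := hξ_indep.indepFun_finset (Finset.range n) {n} (by simp) hξ
  have h2 := h1.comp hψ (measurable_pi_apply (⟨n, Finset.mem_singleton_self n⟩ : ({n} : Finset ℕ)))
  rw [h]
  exact h2

/-- Conditioning on the first `n` samples. -/
theorem integral_iterate_succ [IsProbabilityMeasure P] {θ : Measure Ξ} [IsProbabilityMeasure θ]
    (hstep : Measurable fun p : M × Ξ ↦ retr ⟨p.1, -η • F p.1 p.2⟩)
    (hξ : ∀ n, Measurable (ξ n)) (hξ_law : ∀ n, P.map (ξ n) = θ) (hξ_indep : iIndepFun ξ P)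
    {u : M → ℝ} (hu : Measurable u) {B : ℝ} (hB : ∀ y, |u y| ≤ B) (x : M) (n : ℕ) :
    ∫ o, u (iterate retr F ξ η x (n + 1) o) ∂P =
      ∫ o, ∫ s, u (retr ⟨iterate retr F ξ η x n o, -η • F (iterate retr F ξ η x n o) s⟩) ∂θ ∂P := by
  have hZ := measurable_iterate hstep hξ x n
  -- Independence makes the joint law of (Z_n, ξ_n) a product, so Fubini integrates out the new
  -- sample first.
  have hlaw := (indepFun_iff_map_prod_eq_prod_map_map hZ.aemeasurable (hξ n).aemeasurable).1
    (indepFun_iterate hstep hξ hξ_indep x n)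
  rw [hξ_law] at hlaw
  have : IsProbabilityMeasure (P.map (iterate retr F ξ η x n)) :=
    Measure.isProbabilityMeasure_map hZ.aemeasurable
  have hw : Measurable fun p : M × Ξ ↦ u (retr ⟨p.1, -η • F p.1 p.2⟩) := hu.comp hstep
  have hint : Integrable (fun p : M × Ξ ↦ u (retr ⟨p.1, -η • F p.1 p.2⟩))
      ((P.map (iterate retr F ξ η x n)).prod θ) :=
    Integrable.of_bound hw.aestronglyMeasurable B (Filter.Eventually.of_forall fun p ↦ hB _)
  have h1 := integral_prod _ hint
  rw [← hlaw, integral_map (hZ.prodMk (hξ n)).aemeasurable (by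
    rw [hlaw]; exact hint.aestronglyMeasurable)] at h1
  refine h1.trans ?_
  rw [integral_map hZ.aemeasurable]
  exact hint.aestronglyMeasurable.integral_prod_right'

end Iterates

/-! ## Weak error of the scheme -/

section WeakError

variable {E : Type*} [NormedAddCommGroup E] [NormedSpace ℝ E] [FiniteDimensional ℝ E]
  {M : Type*} [MetricSpace M] [ChartedSpace E M] [IsManifold 𝓘(ℝ, E) ∞ M]
  [RiemannianBundle (fun x : M ↦ TangentSpace 𝓘(ℝ, E) x)]
  [IsContMDiffRiemannianBundle 𝓘(ℝ, E) ∞ E (fun x : M ↦ TangentSpace 𝓘(ℝ, E) x)]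
  [IsRiemannianManifold 𝓘(ℝ, E) M] [CompleteSpace M] [MeasurableSpace M] [BorelSpace M]
  {V : ∀ y : M, TangentSpace 𝓘(ℝ, E) y} {K : ℝ} {φ : ℝ → M → M}
  {retr : TangentBundle 𝓘(ℝ, E) M → M}
  {Ξ Ω : Type*} [MeasurableSpace Ξ] [MeasurableSpace Ω] {P : Measure Ω} [IsProbabilityMeasure P]
  {θ : Measure Ξ} [IsProbabilityMeasure θ] {F : ∀ x : M, Ξ → TangentSpace 𝓘(ℝ, E) x}
  {ξ : ℕ → Ω → Ξ}

/-- The weak error of one step is of order `η²`, uniformly in the starting point. -/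
theorem IsFlow.exists_weak_step_bound (hφ : IsFlow V φ) (hV : HasVariationBound V K)
    (hretr : IsUniformFirstOrderRetraction retr)
    (hF : @Measurable (M × Ξ) (TangentBundle 𝓘(ℝ, E) M) inferInstance (borel _)
      (fun p ↦ ⟨p.1, F p.1 p.2⟩))
    (hF_mean : ∀ x : M, ∫ s, F x s ∂θ = -V x)
    (hF_moment : ⨆ x : M, ∫⁻ s, ‖F x s‖ₑ ^ 2 ∂θ < ⊤) (T : ℝ) {g : M → ℝ} (hg : IsC2Bounded E g) :
    ∃ C, 0 ≤ C ∧ ∀ t ∈ Set.Icc 0 T, ∀ η, 0 ≤ η → ∀ y : M,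
      |∫ s, g (φ t (retr ⟨y, -η • F y s⟩)) ∂θ - g (φ (t + η) y)| ≤ C * η ^ 2 := by
  obtain ⟨G, hG0, hG⟩ := hφ.exists_step_bound hV hretr T hg
  obtain ⟨Kg, hKg⟩ := hg.bounded
  set m := (⨆ x : M, ∫⁻ s, ‖F x s‖ₑ ^ 2 ∂θ).toReal with hm
  -- G m comes from the random step, with m bounding the second moments; G comes from the step of
  -- the flow.
  refine ⟨G * (m + 1), by positivity, fun t ht η hη y ↦ ?_⟩
  obtain ⟨h1, h2⟩ := hG t ht y
  replace h2 := h2 η hη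
  set D : TangentSpace 𝓘(ℝ, E) y →L[ℝ] ℝ := mvfderiv 𝓘(ℝ, E) (fun y ↦ g (φ t y)) y
  have hLp := memLp_estimator hF hF_moment y
  have hFint : Integrable (F y) θ := hLp.integrable one_le_two
  have hflow := hφ.contMDiff hV.isC2Field hV.nonneg hV.norm_le t
  have hcont : Continuous fun y ↦ g (φ t y) := hg.contMDiff.continuous.comp hflow.continuous
  have hmeas : Measurable fun s ↦ g (φ t (retr ⟨y, -η • F y s⟩)) :=
    hcont.measurable.comp ((measurable_step hF hretr.contMDiff.continuous (-η)).comp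
      measurable_prodMk_left)
  have hint1 : Integrable (fun s ↦ g (φ t (retr ⟨y, -η • F y s⟩))) θ :=
    Integrable.of_bound hmeas.aestronglyMeasurable Kg
      (Filter.Eventually.of_forall fun s ↦ (hKg _).1)
  have hDint : Integrable (fun s ↦ η * D (F y s)) θ := (D.integrable_comp hFint).const_mul η
  -- Unbiasedness: the mean of the linear term of the random step matches the linear term of the
  -- flow, so both drop out of the difference.
  have hmean : ∫ s, η * D (F y s) ∂θ = -(η * D (V y)) := by
    rw [integral_const_mul, D.integral_comp_comm hFint, hF_mean, _root_.map_neg, mul_neg]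
  have h3 : |∫ s, (g (φ t (retr ⟨y, -η • F y s⟩)) - g (φ t y) + η * D (F y s)) ∂θ| ≤
      G * (η ^ 2 * m) := by
    rw [← Real.norm_eq_abs]
    refine (norm_integral_le_of_norm_le (((hLp.integrable_norm_pow two_ne_zero).const_mul
      (η ^ 2)).const_mul G) (Filter.Eventually.of_forall fun s ↦
        (Real.norm_eq_abs _).trans_le (h1 η hη (F y s)))).trans ?_
    rw [integral_const_mul, integral_const_mul]
    gcongr
    exact integral_normSq_estimator_le hF hF_moment y
  have hint2 : Integrable (fun s ↦ g (φ t (retr ⟨y, -η • F y s⟩)) - g (φ t y)) θ :=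
    hint1.sub (integrable_const _)
  rw [integral_add hint2 hDint, integral_sub hint1 (integrable_const _),
    integral_const, probReal_univ, one_smul, hmean] at h3
  rw [abs_le] at h2 h3 ⊢
  constructor <;> linarith [h2.1, h2.2, h3.1, h3.2]

/-- The one-step errors are summed by induction on n, with the test function g ∘ φ t absorbing the
steps already exchanged for the flow. -/
theorem IsFlow.exists_weak_error_bound (hφ : IsFlow V φ) (hV : HasVariationBound V K)
    (hretr : IsUniformFirstOrderRetraction retr)
    (hF : @Measurable (M × Ξ) (TangentBundle 𝓘(ℝ, E) M) inferInstance (borel _)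
      (fun p ↦ ⟨p.1, F p.1 p.2⟩))
    (hF_mean : ∀ x : M, ∫ s, F x s ∂θ = -V x)
    (hF_moment : ⨆ x : M, ∫⁻ s, ‖F x s‖ₑ ^ 2 ∂θ < ⊤)
    (hξ : ∀ n, Measurable (ξ n)) (hξ_law : ∀ n, P.map (ξ n) = θ) (hξ_indep : iIndepFun ξ P)
    {T : ℝ} (hT : 0 ≤ T) {g : M → ℝ} (hg : IsC2Bounded E g) :
    ∃ C, 0 ≤ C ∧ ∀ η, 0 < η → ∀ (x : M) (n : ℕ), n ≤ ⌊T / η⌋₊ →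
      |∫ o, g (iterate retr F ξ η x n o) ∂P - g (φ (n * η) x)| ≤ C * η := by
  obtain ⟨C, hC0, hC⟩ := hφ.exists_weak_step_bound hV hretr hF hF_mean hF_moment T hg
  obtain ⟨Kg, hKg⟩ := hg.bounded
  refine ⟨T * C, by positivity, fun η hη x n hn ↦ ?_⟩
  have hstep := measurable_step hF hretr.contMDiff.continuous (-η)
  have hcont (t : ℝ) : Continuous fun y ↦ g (φ t y) :=
    hg.contMDiff.continuous.comp (hφ.contMDiff hV.isC2Field hV.nonneg hV.norm_le t).continuous
  -- Generalized over t: exchanging the last step of the scheme for the flow turns (n + 1, t) into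
  -- (n, t + η). The constraint t + nη ≤ T keeps each t used in [0, T], where C is valid.
  have hind (n : ℕ) : ∀ t, 0 ≤ t → t + n * η ≤ T →
      |∫ o, g (φ t (iterate retr F ξ η x n o)) ∂P - g (φ (t + n * η) x)| ≤ n * (C * η ^ 2) := by
    induction n with
    | zero =>
      intro t _ _
      simp [iterate]
    | succ n ih =>
      intro t ht htn
      push_cast at htn ⊢
      have hnη : 0 ≤ n * η := by positivity
      have htT : t ∈ Set.Icc 0 T := ⟨ht, by linarith⟩
      have h1 := ih (t + η) (by positivity) (by linarith)
      have hZ := measurable_iterate hstep hξ x n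
      have hint1 : Integrable (fun o ↦ ∫ s, g (φ t (retr ⟨iterate retr F ξ η x n o,
          -η • F (iterate retr F ξ η x n o) s⟩)) ∂θ) P := by
        have hm : StronglyMeasurable fun y ↦ ∫ s, g (φ t (retr ⟨y, -η • F y s⟩)) ∂θ :=
          ((hcont t).measurable.comp hstep).stronglyMeasurable.integral_prod_right'
        refine Integrable.of_bound (hm.comp_measurable hZ).aestronglyMeasurable Kg
          (Filter.Eventually.of_forall fun o ↦ ?_)
        refine (norm_integral_le_of_norm_le_const
          (Filter.Eventually.of_forall fun s ↦ (hKg _).1)).trans ?_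
        simp
      have hint2 : Integrable (fun o ↦ g (φ (t + η) (iterate retr F ξ η x n o))) P :=
        Integrable.of_bound ((hcont _).measurable.comp hZ).aestronglyMeasurable Kg
          (Filter.Eventually.of_forall fun o ↦ (hKg _).1)
      have h2 : |∫ o, g (φ t (iterate retr F ξ η x (n + 1) o)) ∂P -
          ∫ o, g (φ (t + η) (iterate retr F ξ η x n o)) ∂P| ≤ C * η ^ 2 := by
        rw [integral_iterate_succ (u := fun y ↦ g (φ t y)) hstep hξ hξ_law hξ_indep
          (hcont t).measurable (fun y ↦ (hKg _).1), ← integral_sub hint1 hint2,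
          ← Real.norm_eq_abs]
        refine (norm_integral_le_of_norm_le_const (C := C * η ^ 2)
          (Filter.Eventually.of_forall fun o ↦ (Real.norm_eq_abs _).trans_le
            (hC t htT η hη.le (iterate retr F ξ η x n o)))).trans ?_
        simp
      have h3 : t + (n + 1) * η = t + η + n * η := by ring
      rw [h3]
      calc _ ≤ C * η ^ 2 + n * (C * η ^ 2) := (abs_sub_le _ _ _).trans (add_le_add h2 h1)
        _ = (n + 1) * (C * η ^ 2) := by ring
  have hnT : n * η ≤ T := by
    rw [← le_div_iff₀ hη]
    exact (Nat.le_floor_iff (by positivity)).1 hn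
  have h := hind n 0 le_rfl (by linarith)
  simp only [hφ.map_zero, zero_add] at h
  calc _ ≤ n * (C * η ^ 2) := h
    _ = n * η * (C * η) := by ring
    _ ≤ T * (C * η) := by gcongr
    _ = T * C * η := by ring

/-- An integral curve on `[0, ∞)` is a trajectory of the flow. -/
theorem IsFlow.eq_of_isMIntegralCurveOn_Ici (hφ : IsFlow V φ) (hV : IsC2Field V) {γ : ℝ → M}
    (hγ : IsMIntegralCurveOn (I := 𝓘(ℝ, E)) γ V (Set.Ici 0)) {t : ℝ} (ht : 0 ≤ t) :
    γ t = φ t (γ 0) := by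
  classical
  let β : ℝ → M := fun t ↦ if 0 ≤ t then γ t else φ t (γ 0)
  have hβ1 (t : ℝ) (ht : t ∈ Set.Ici (0 : ℝ)) : β t = γ t := if_pos ht
  have hβ2 (t : ℝ) (ht : t ∈ Set.Iic (0 : ℝ)) : β t = φ t (γ 0) := by
    rcases eq_or_lt_of_le (Set.mem_Iic.1 ht) with h | h
    · simp only [β, h, le_refl, if_true, hφ.map_zero]
    · exact if_neg (not_le.2 h)
  have hv1 (t : ℝ) (ht : t ∈ Set.Ici (0 : ℝ)) : HasMFDerivWithinAt 𝓘(ℝ, ℝ) 𝓘(ℝ, E) β (Set.Ici 0) t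
      ((1 : ℝ →L[ℝ] ℝ).smulRight (V (β t))) := by
    rw [hβ1 t ht]
    exact (hγ t ht).congr_of_eventuallyEq (Filter.eventuallyEq_of_mem self_mem_nhdsWithin hβ1)
      (hβ1 t ht)
  have hv2 (t : ℝ) (ht : t ∈ Set.Iic (0 : ℝ)) : HasMFDerivWithinAt 𝓘(ℝ, ℝ) 𝓘(ℝ, E) β (Set.Iic 0) t
      ((1 : ℝ →L[ℝ] ℝ).smulRight (V (β t))) := by
    rw [hβ2 t ht]
    exact (hφ.hasMFDerivAt t (γ 0)).hasMFDerivWithinAt.congr_of_eventuallyEq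
      (Filter.eventuallyEq_of_mem self_mem_nhdsWithin hβ2) (hβ2 t ht)
  have hβ : IsMIntegralCurve (I := 𝓘(ℝ, E)) β V := by
    intro t
    rcases lt_trichotomy t 0 with h | h | h
    · exact (hv2 t h.le).hasMFDerivAt (Iic_mem_nhds h)
    · have h1 := (hv2 t h.le).union (hv1 t h.ge)
      rw [Set.Iic_union_Ici] at h1
      exact hasMFDerivWithinAt_univ.1 h1
    · exact (hv1 t h.le).hasMFDerivAt (Ici_mem_nhds h)
  have h := isMIntegralCurve_Ioo_eq_of_contMDiff_boundaryless (t₀ := 0) hV.contMDiff_one hβ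
    (hφ.isMIntegralCurve (γ 0)) (by rw [hβ2 0 Set.self_mem_Iic])
  rw [← hβ1 t ht, h]

end WeakError

end RSGD

end

/-! ### The weak error estimate for RSGD -/

theorem theorem3p1
    {E : Type*} [NormedAddCommGroup E] [NormedSpace ℝ E] [FiniteDimensional ℝ E]
    {M : Type*} [MetricSpace M] [ChartedSpace E M] [IsManifold 𝓘(ℝ, E) ∞ M]
    [RiemannianBundle (fun x : M ↦ TangentSpace 𝓘(ℝ, E) x)]
    [IsContMDiffRiemannianBundle 𝓘(ℝ, E) ∞ E (fun x : M ↦ TangentSpace 𝓘(ℝ, E) x)]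
    [IsRiemannianManifold 𝓘(ℝ, E) M] [CompleteSpace M] [ConnectedSpace M]
    [MeasurableSpace M] [BorelSpace M]
    {Ξ : Type*} [MeasurableSpace Ξ] (θ : Measure Ξ) [IsProbabilityMeasure θ]
    {Ω : Type*} [MeasurableSpace Ω] (P : Measure Ω) [IsProbabilityMeasure P]
    (ξ : ℕ → Ω → Ξ) (hξ : ∀ n, Measurable (ξ n)) (hξ_law : ∀ n, P.map (ξ n) = θ)
    (hξ_indep : iIndepFun ξ P)
    (hR : RSGD.BoundedCurvature E M)
    (retr : TangentBundle 𝓘(ℝ, E) M → M) (hretr : RSGD.IsUniformFirstOrderRetraction retr)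
    (f : M → ℝ) (hf : ContMDiff 𝓘(ℝ, E) 𝓘(ℝ, ℝ) 1 f)
    (hgrad : RSGD.IsC2BoundedVectorField (RSGD.grad E f))
    (F : ∀ x : M, Ξ → TangentSpace 𝓘(ℝ, E) x)
    (hF : @Measurable (M × Ξ) (TangentBundle 𝓘(ℝ, E) M) inferInstance (borel _)
      (fun p ↦ ⟨p.1, F p.1 p.2⟩))
    (hF_mean : ∀ x : M, ∫ s, F x s ∂θ = RSGD.grad E f x)
    (hF_moment : ⨆ x : M, ∫⁻ s, ‖F x s‖ₑ ^ 2 ∂θ < ⊤) :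
    (∃ X : M → ℝ → M, RSGD.IsGradientFlow E f X) ∧
    ∀ X : M → ℝ → M, RSGD.IsGradientFlow E f X →
      ∀ T : ℝ, 0 ≤ T → ∀ g : M → ℝ, RSGD.IsC2Bounded E g →
        ∃ C : ℝ, 0 ≤ C ∧ ∀ η : ℝ, 0 < η → ∀ (x : M) (n : ℕ), n ≤ ⌊T / η⌋₊ →
          |∫ o, g (RSGD.iterate retr F ξ η x n o) ∂P - g (X x (n * η))| ≤ C * η := by
  obtain ⟨K, hV⟩ := RSGD.hasVariationBound_neg hR hgrad
  obtain ⟨φ, hφ⟩ := RSGD.exists_isFlow hV.isC2Field hV.nonneg hV.norm_le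
  refine ⟨⟨fun x t ↦ φ t x, fun x ↦ ⟨hφ.map_zero x,
    (hφ.isMIntegralCurve x).isMIntegralCurveOn _⟩⟩, fun X hX T hT g hg ↦ ?_⟩
  -- The flow is that of V = -grad f, so the mean grad f of the estimator has to be read as -V.
  obtain ⟨C, hC0, hC⟩ := hφ.exists_weak_error_bound hV hretr hF
    (fun x ↦ (hF_mean x).trans (neg_neg _).symm) hF_moment hξ hξ_law hξ_indep hT hg
  refine ⟨C, hC0, fun η hη x n hn ↦ ?_⟩
  -- An arbitrary family of solutions on [0, ∞) agrees with φ, so the constant obtained for φ serves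
  -- it.
  have h := hφ.eq_of_isMIntegralCurveOn_Ici hV.isC2Field (hX x).2 (t := n * η) (by positivity)
  rw [h, (hX x).1]
  exact hC η hη x n hn
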